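/- **Setting.** Let $\mathcal S,\mathcal A$ be finite sets with $S=|\mathcal S|\ge 1$, $A=|\mathcal A|$, let $\tilde{\mathsf P}(\cdot\mid s,a)$ be a nominal transition kernel, $r:\mathcal S\times\mathcal A\to\mathbb R$ a reward, $\pi$ a stationary policy, and $\mathcal P=\bigotimes_{s,a}\mathcal P^a_s$ one of the following uncertainty sets around $\tilde{\mathsf P}$: contamination, $\mathcal P^a_s=\{(1-\delta)\tilde{\mathsf P}^a_s+\delta q\}$ with $q$ ranging over all distributions on $\mathcal S$; total variation, $\mathcal P^a_s=\{q:\tfrac12\|q-\tilde{\mathsf P}^a_s\|_1\le\delta\}$; Wasserstein, $\mathcal P^a_s=\{q:W_l(\tilde{\mathsf P}^a_s,q)\le\delta\}$ for a metric $d$ on $\mathcal S$ and $l\ge1$. Write $\sigma_{\mathcal P^a_s}(V)=\min_{p\in\mathcal P^a_s}p^\top V$ and $\mathbf T_g(V)(s)=\sum_a\pi(a|s)[r(s,a)-g+\sigma_{\mathcal P^a_s}(V)]$. For a kernel $\mathsf P$ let $\mathsf P^\pi$ be the state chain induced by $\pi$. Assume that $\tilde{\mathsf P}^\pi$ is irreducible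 and aperiodic, and the radius conditions: $0\le\delta<1$ for contamination; for TV, $\delta\ge 0$ and for some $m\ge1$ the matrix $(\tilde{\mathsf P}^\pi)^m$ is entrywise positive with $\delta<b_0/m$, $b_0=\min_{i,j}((\tilde{\mathsf P}^\pi)^m)_{ij}$; for Wasserstein, the same with $\delta<b_0\min_{x\ne y}d(x,y)/m$. Let $g^\pi_{\mathcal P}$ be the minimum over $\mathsf P\in\mathcal P$ of $\lim_{T}\mathbb E_{\pi,\mathsf P}[\frac1T\sum_{t<T}r_t\mid S_0=s]$ (independent of $s$), and let $t_{\mathrm{mix}}=\sup_{\mathsf P\in\mathcal P}\min\{t\ge1:\max_{\mu_0}\|\mu_0(\mathsf P^\pi)^t-\nu_{\mathsf P}\|_1\le\frac12\}$, $\nu_{\mathsf P}$ being the invariant law of $\mathsf P^\pi$. **Algorithm.** An independent estimate $\hat\sigma_{\mathcal P^a_s}(V)$ is drawn for every $(s,a)$ in every round. For contamination it is $(1-\delta)V(s')+\delta\min V$ with one sample $s'\sim\tilde{\mathsf P}^a_s$. For TV and Wasserstein it is the truncated multi-level Monte Carlo estimate: draw $N$ geometric with parameter $\frac12$ on $\{0,1,\dots\}$,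 put $N'=\min(N,N_{\max})$, draw $2^{N'+1}$ samples from $\tilde{\mathsf P}^a_s$, and return the support function of the uncertainty set centred at the first sample plus $\Delta_{N'}/\mathbb P(N'=n)|_{n=N'}$, where $\Delta_{N'}$ is the support function of the set centred at the full empirical distribution minus the average of those centred at the empirical distributions of the even- and of the odd-indexed samples. First phase: for $t<T$, $V_{t+1}=V_t+\eta_t(\hat{\mathbf T}_0(V_t)-V_t)$, then subtract the constant $V_{t+1}(s_0)$. Second phase: $g_0=0$ and, for $t<T$, $g_{t+1}=g_t+\beta_t(\bar\delta_t-g_t)$ with $\bar\delta_t=\frac1S\sum_s\{\sum_a\pi(a|s)[r(s,a)+\hat\sigma_{\mathcal P^a_s}(V_T)]-V_T(s)\}$. **Constants.** A contraction semi-norm with factor $\gamma\in(0,1)$ is a semi-norm $\|\cdot\|_{\mathcal P}$ on $\mathbb R^{\mathcal S}$ whose kernel is the constant vectors and for which $\|\mathbf T_g(V_1)-\mathbf T_g(V_2)\|_{\mathcal P}\le\gamma\|V_1-V_2\|_{\mathcal P}$ for all $V_1,V_2,g$. Its constants are bounded by $B$ if there are $c_{\mathcal P},C_{\mathcal P}$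 with $c_{\mathcal P}>0$ and $c_{\mathcal P}\|x\|_{\mathrm{sp}}\le\|x\|_{\mathcal P}\le C_{\mathcal P}\|x\|_{\mathrm{sp}}$ (span semi-norm), and a smoothing semi-norm $\|\cdot\|_s$ with $\ell\|x\|_s\le\|x\|_{\mathcal P}\le u\|x\|_s$, $\ell>0$, such that $\frac12\|\cdot\|_s^2$ is $L$-smooth with respect to $\|\cdot\|_s$, and a $\mu>0$, for which, with the Moreau envelope constants $c_u=1+\mu u^2$, $c_l=1+\mu\ell^2$, and $\alpha_2=1-\gamma\sqrt{c_u/c_l}$, $$C_{\mathcal P}\le B\,c_{\mathcal P},\qquad 1-\gamma\le B\,\alpha_2,\qquad c_u\,\frac{L}{\mu\,\ell^2}\le B .$$ **Theorem.** Under the assumptions above $g^\pi_{\mathcal P}$ exists, a contraction semi-norm exists, and the constants of every contraction semi-norm are bounded by some $B$. Moreover, for every $B$ there is $C$, depending on $B$ only, such that for all such problems, all anchor states $s_0$, all contraction semi-norms with factor $\gamma$ and constants bounded by $B$, all rewards with $|r|\le B$ and all $V_0$ with $\|V_0\|_{\mathrm{sp}}\le B\,t_{\mathrm{mix}}$, the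 following hold with $\beta_t=\frac1{t+1}$ and $\eta_t=\frac{a}{t+K}$ for suitable $0<a\le\frac{C}{1-\gamma}$, $K\ge1$. 1. (Rate.) For every $N_{\max}\ge 0$ the numbers $a,K$ can be chosen such that for all $T\ge2$: for contamination sets $$\mathbb E|g_T-g^\pi_{\mathcal P}|\le C\Bigl(\tfrac1T+\tfrac{\log T}T+\tfrac{t_{\mathrm{mix}}\log T}{\sqrt T(1-\gamma)}\Bigr),$$ and for TV and Wasserstein sets $$\mathbb E|g_T-g^\pi_{\mathcal P}|\le C\Bigl(\tfrac1T+\tfrac{\log T}T+\tfrac{t_{\mathrm{mix}}\sqrt{SN_{\max}}\log T}{\sqrt T(1-\gamma)}+\tfrac{\sqrt S\,t_{\mathrm{mix}}2^{-N_{\max}/4}\log^{3/2}T}{\sqrt{1-\gamma}}+\sqrt S\,2^{-N_{\max}/2}t_{\mathrm{mix}}\log T\Bigr).$$ 2. (Sample complexity.) For every $\varepsilon\in(0,1]$ there are $a,K,N_{\max},T$ with $\mathbb E|g_T-g^\pi_{\mathcal P}|\le\varepsilon$ for which the expected total number of samples drawn in both phases is at most $$C\,\frac{SA\,t_{\mathrm{mix}}^2}{\varepsilon^2(1-\gamma)^2}\,\Lambda,$$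 with $\Lambda=1+\log\frac{t_{\mathrm{mix}}}{\varepsilon(1-\gamma)}$ for contamination and $\Lambda=\bigl(1+\log\frac{\sqrt S\,t_{\mathrm{mix}}}{\varepsilon(1-\gamma)}\bigr)^4$ for TV and Wasserstein sets. In particular it is $\tilde{\mathcal O}\bigl(SA\,t_{\mathrm{mix}}^2/(\varepsilon^2(1-\gamma)^2)\bigr)$ in all three cases. -/

import Mathlib

open Filter Topology
open scoped ENNReal

universe u v

noncomputable section

namespace RobustAvg

/-! ### Discrete probability -/

/-- Expectation of a nonnegative extended-real cost under a discrete distribution. -/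
def expect {α : Type*} (p : PMF α) (f : α → ℝ≥0∞) : ℝ≥0∞ := ∑' x, p x * f x

theorem tsum_prod_fin {α : Type*} (n : ℕ) (f : Fin n → α → ℝ≥0∞) :
    ∑' x : Fin n → α, ∏ i, f i (x i) = ∏ i, ∑' a, f i a := by
  induction n with
  | zero => simp [tsum_fintype]
  | succ n ih =>
    rw [← (Fin.consEquiv (fun _ : Fin (n + 1) => α)).tsum_eq, ENNReal.tsum_prod',
      Fin.prod_univ_succ]
    simp only [Fin.consEquiv_apply, Fin.prod_univ_succ, Fin.cons_zero, Fin.cons_succ]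
    simp_rw [ENNReal.tsum_mul_left, ih, ENNReal.tsum_mul_right]

theorem tsum_prod_pi {ι α : Type*} [Fintype ι] (f : ι → α → ℝ≥0∞) :
    ∑' x : ι → α, ∏ i, f i (x i) = ∏ i, ∑' a, f i a := by
  have e := Fintype.equivFin ι
  rw [← (Equiv.arrowCongr e.symm (Equiv.refl α)).tsum_eq]
  rw [← e.symm.prod_comp (fun i => ∑' a, f i a),
    ← tsum_prod_fin _ (fun j => f (e.symm j))]
  refine tsum_congr fun x => ?_
  rw [← e.symm.prod_comp]
  simp [Equiv.arrowCongr]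

/-- The joint law of independent draws, the `i`-th one with law `p i`. -/
def indepProduct {ι α : Type*} [Fintype ι] (p : ι → PMF α) : PMF (ι → α) :=
  ⟨fun x => ∏ i, p i (x i), by
    have h : ∑' x : ι → α, ∏ i, p i (x i) = 1 := by
      rw [tsum_prod_pi]; simp
    exact h ▸ ENNReal.summable.hasSum⟩

/-! ### Uncertainty sets -/

section Uncertainty

variable {S : Type u} [Fintype S]

/-- Total variation distance, i.e. half the `ℓ¹` distance. -/
def tvDist (p q : PMF S) : ℝ := (1 / 2) * ∑ x, |(p x).toReal - (q x).toReal|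

/-- The couplings of `p` and `q`: laws on `S × S` with marginals `p` and `q`. -/
def couplings (p q : PMF S) : Set (PMF (S × S)) :=
  {c | c.map Prod.fst = p ∧ c.map Prod.snd = q}

/-- The `l`-Wasserstein distance for the metric `d`. -/
def wassersteinDist (d : MetricSpace S) (l : ℝ) (p q : PMF S) : ℝ :=
  sInf ((fun c : PMF (S × S) =>
    (∑ x, ∑ y, (c (x, y)).toReal * (d.dist x y) ^ l) ^ (1 / l)) '' couplings p q)

/-- The three kinds of uncertainty sets; `δ` is the radius. -/
inductive UncertaintyModel (S : Type u) : Type u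
  | contamination (δ : ℝ) : UncertaintyModel S
  | tv (δ : ℝ) : UncertaintyModel S
  | wasserstein (d : MetricSpace S) (l δ : ℝ) : UncertaintyModel S

/-- The set of distributions allowed when the nominal distribution is `p`. -/
def UncertaintyModel.ball : UncertaintyModel S → PMF S → Set (PMF S)
  | .contamination δ, p =>
      {q | ∃ q' : PMF S, ∀ x, (q x).toReal = (1 - δ) * (p x).toReal + δ * (q' x).toReal}
  | .tv δ, p => {q | tvDist q p ≤ δ}
  | .wasserstein d l δ, p => {q | wassersteinDist d l p q ≤ δ}

/-- The support function of the uncertainty set centred at `p`, `min_{q} qᵀ V`. -/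
def supportFn (U : UncertaintyModel S) (p : PMF S) (V : S → ℝ) : ℝ :=
  sInf ((fun q : PMF S => ∑ x, (q x).toReal * V x) '' U.ball p)

/-- The span semi-norm `max V - min V`. -/
def spanSeminorm (V : S → ℝ) : ℝ := (⨆ s, V s) - ⨅ s, V s

end Uncertainty

/-! ### Robust average-reward MDPs -/

/-- A robust MDP with finite state and action spaces: nominal transition kernel, rewards, and the
kind of `(s,a)`-rectangular uncertainty set that is put around the nominal kernel. -/
structure RobustMDP (S : Type u) (A : Type v) where
  nominal : S → A → PMF S
  reward : S → A → ℝ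
  model : UncertaintyModel S

section MDP

variable {S : Type u} {A : Type v} [Fintype S] [DecidableEq S] [Fintype A]

/-- State transition matrix induced by the policy `π` under the kernel `P`. -/
def policyMatrix (π : S → PMF A) (P : S → A → PMF S) : Matrix S S ℝ :=
  Matrix.of fun s s' => ∑ a, (π s a).toReal * (P s a s').toReal

/-- Expected one-step reward of the policy `π`. -/
def policyReward (M : RobustMDP S A) (π : S → PMF A) (s : S) : ℝ :=
  ∑ a, (π s a).toReal * M.reward s a

/-- The rectangular uncertainty set of transition kernels. -/
def uncertaintySet (M : RobustMDP S A) : Set (S → A → PMF S) :=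
  {P | ∀ s a, P s a ∈ M.model.ball (M.nominal s a)}

/-- `E_{π,P}[(1/T) ∑_{t<T} r_t | S₀ = s]`. -/
def averageRewardUpTo (M : RobustMDP S A) (π : S → PMF A) (P : S → A → PMF S) (s : S) (T : ℕ) : ℝ :=
  (1 / (T : ℝ)) *
    ∑ t ∈ Finset.range T, ((policyMatrix π P ^ t).mulVec (policyReward M π)) s

/-- `g` is the robust average reward of `π`: from every initial state it is the minimum, over the
kernels in the uncertainty set, of the long-run average reward. -/
def IsRobustAverageReward (M : RobustMDP S A) (π : S → PMF A) (g : ℝ) : Prop :=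
  ∀ s, IsLeast {x | ∃ P ∈ uncertaintySet M,
    Tendsto (averageRewardUpTo M π P s) atTop (𝓝 x)} g

/-- Aperiodicity of a Markov chain: for each state the return times have no common divisor
other than `1`. -/
def IsAperiodic (K : Matrix S S ℝ) : Prop :=
  ∀ i, ∀ k : ℕ, (∀ n : ℕ, 1 ≤ n → 0 < (K ^ n) i i → k ∣ n) → k = 1

/-- The chain induced by `π` under the nominal kernel is irreducible and aperiodic. -/
def NominalErgodic (M : RobustMDP S A) (π : S → PMF A) : Prop :=
  (policyMatrix π M.nominal).IsIrreducible ∧ IsAperiodic (policyMatrix π M.nominal)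

/-- The restrictions on the radius of the uncertainty set. -/
def RadiusCondition (M : RobustMDP S A) (π : S → PMF A) : Prop :=
  match M.model with
  | .contamination δ => 0 ≤ δ ∧ δ < 1
  | .tv δ => 0 ≤ δ ∧ ∃ m : ℕ, 1 ≤ m ∧
      ∀ i j, 0 < (policyMatrix π M.nominal ^ m) i j ∧
        δ < (policyMatrix π M.nominal ^ m) i j / m
  | .wasserstein d l δ => 1 ≤ l ∧ 0 ≤ δ ∧ ∃ m : ℕ, 1 ≤ m ∧
      ∀ i j, 0 < (policyMatrix π M.nominal ^ m) i j ∧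
        ∀ x y : S, x ≠ y → δ < d.dist x y * (policyMatrix π M.nominal ^ m) i j / m

/-- Mixing time of a chain: the first `t ≥ 1` for which, from every initial law, the law at time `t`
is within `ℓ¹` distance `1/2` of the invariant law. -/
def mixingTime (K : Matrix S S ℝ) : ℕ :=
  sInf {t | 1 ≤ t ∧ ∃ ν ∈ stdSimplex ℝ S, Matrix.vecMul ν K = ν ∧
    ∀ μ₀ ∈ stdSimplex ℝ S, ∑ s, |Matrix.vecMul μ₀ (K ^ t) s - ν s| ≤ 1 / 2}

/-- `t_mix`: the supremum of the mixing times over the uncertainty set. -/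
def tMix (M : RobustMDP S A) (π : S → PMF A) : ℕ :=
  sSup {n | ∃ P ∈ uncertaintySet M, n = mixingTime (policyMatrix π P)}

/-- The robust Bellman operator `T_g`. -/
def robustBellman (M : RobustMDP S A) (π : S → PMF A) (g : ℝ) (V : S → ℝ) (s : S) : ℝ :=
  ∑ a, (π s a).toReal * (M.reward s a - g + supportFn M.model (M.nominal s a) V)

/-- `N` is a semi-norm with kernel the constant vectors for which all the robust Bellman operators
`T_g` are contractions with factor `γ`. -/
def IsContractionSeminorm (M : RobustMDP S A) (π : S → PMF A) (N : Seminorm ℝ (S → ℝ)) (γ : ℝ) :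
    Prop :=
  0 < γ ∧ γ < 1 ∧ (∀ x, N x = 0 ↔ ∃ c : ℝ, x = fun _ => c) ∧
    ∀ (V₁ V₂ : S → ℝ) (g : ℝ),
      N (robustBellman M π g V₁ - robustBellman M π g V₂) ≤ γ * N (V₁ - V₂)

end MDP

/-! ### The constants behind the `O`-notation -/

/-- The problem constants attached to a contraction semi-norm `N` with factor `γ` are controlled
by the number `B`. They are:
* `cP, CP`, comparing `N` with the span semi-norm, `cP ‖x‖_sp ≤ N x ≤ CP ‖x‖_sp`;
* the constants of the Moreau envelope `E x = inf_z ½ N(z)² + s(x - z)² / (2 μ)` built from `N`,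
  a smoothing semi-norm `s` with `l s ≤ N ≤ u s`, and a parameter `μ > 0`. Here `½ s²` is `L`-smooth
  with respect to `s`, which for the convex function `½ s²` is the displayed inequality on its second
  differences. The envelope is then `(L / μ)`-smooth with respect to `s`, and
  `(1 + μ l²) E ≤ ½ N² ≤ (1 + μ u²) E`; the contraction survives the smoothing if
  `α₂ = 1 - γ √((1 + μ u²) / (1 + μ l²))` is positive. -/
def ConstantsAtMost {S : Type u} [Fintype S] (N : Seminorm ℝ (S → ℝ)) (γ B : ℝ) : Prop :=
  ∃ (s : Seminorm ℝ (S → ℝ)) (cP CP l u L μ : ℝ),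
    0 < cP ∧ 0 < l ∧ 0 < μ ∧
    (∀ x, cP * spanSeminorm x ≤ N x ∧ N x ≤ CP * spanSeminorm x) ∧
    (∀ x, l * s x ≤ N x ∧ N x ≤ u * s x) ∧
    (∀ x y, s (x + y) ^ 2 + s (x - y) ^ 2 ≤ 2 * s x ^ 2 + 2 * L * s y ^ 2) ∧
    CP ≤ B * cP ∧
    1 - γ ≤ B * (1 - γ * √((1 + μ * u ^ 2) / (1 + μ * l ^ 2))) ∧
    (1 + μ * u ^ 2) * (L / μ) ≤ B * l ^ 2

/-! ### The algorithms -/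

section Algorithms

variable {S : Type u} {A : Type v} [Fintype S] [Fintype A]

/-- Empirical distribution of a nonempty sample. -/
def empirical {n : ℕ} [NeZero n] (X : Fin n → S) : PMF S :=
  (PMF.uniformOfFintype (Fin n)).map X

/-- Law of `N' = min N N_max`, where `N` is geometric with parameter `1/2` on `{0, 1, 2, …}`. -/
def truncGeom (Nmax : ℕ) : PMF ℕ :=
  (ProbabilityTheory.geometricMeasure ⟨1 / 2, by norm_num, by norm_num⟩).toPMF.map
    fun n => min n Nmax

theorem two_mul_lt {n : ℕ} (i : Fin (2 ^ n)) : 2 * (i : ℕ) < 2 ^ (n + 1) := by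
  have := i.isLt
  rw [pow_succ]; omega

theorem two_mul_add_one_lt {n : ℕ} (i : Fin (2 ^ n)) : 2 * (i : ℕ) + 1 < 2 ^ (n + 1) := by
  have := i.isLt
  rw [pow_succ]; omega

/-- The value returned by the truncated multi-level Monte Carlo estimator at level `n` from the
`2 ^ (n + 1)` samples `X 0, X 1, …`: first-sample estimate plus the level correction
divided by the probability of the level. -/
def mlmcValue (U : UncertaintyModel S) (Nmax : ℕ) (V : S → ℝ) (n : ℕ)
    (X : Fin (2 ^ (n + 1)) → S) : ℝ :=
  supportFn U (PMF.pure (X 0)) V +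
    (supportFn U (empirical X) V -
      (1 / 2) * (supportFn U (empirical fun i : Fin (2 ^ n) => X ⟨2 * i + 1, two_mul_add_one_lt i⟩) V
        + supportFn U (empirical fun i : Fin (2 ^ n) => X ⟨2 * i, two_mul_lt i⟩) V)) /
      (truncGeom Nmax n).toReal

/-- Law of the truncated multi-level Monte Carlo estimator together with the number of samples
drawn from the nominal distribution `p`. -/
def mlmcEstimator (U : UncertaintyModel S) (Nmax : ℕ) (V : S → ℝ) (p : PMF S) : PMF (ℝ × ℕ) :=
  (truncGeom Nmax).bind fun n =>
    (indepProduct fun _ : Fin (2 ^ (n + 1)) => p).map fun X =>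
      (mlmcValue U Nmax V n X, 2 ^ (n + 1))

/-- Law of the estimator of the support function, with the number of samples used. -/
def supportEstimator (U : UncertaintyModel S) (Nmax : ℕ) (V : S → ℝ) (p : PMF S) : PMF (ℝ × ℕ) :=
  match U with
  | .contamination δ => p.map fun x => ((1 - δ) * V x + δ * ⨅ y, V y, 1)
  | .tv _ => mlmcEstimator U Nmax V p
  | .wasserstein _ _ _ => mlmcEstimator U Nmax V p

/-- Independent support function estimates for all state-action pairs. -/
def sampleRound (M : RobustMDP S A) (Nmax : ℕ) (V : S → ℝ) : PMF (S × A → ℝ × ℕ) :=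
  indepProduct fun sa : S × A => supportEstimator M.model Nmax V (M.nominal sa.1 sa.2)

/-- Number of samples used in a round. -/
def roundCount (d : S × A → ℝ × ℕ) : ℕ := ∑ sa, (d sa).2

/-- The estimate `∑_a π(a|s) (r(s,a) - g + σ̂(s,a))` of the robust Bellman operator. -/
def bellmanEstimate (M : RobustMDP S A) (π : S → PMF A) (g : ℝ) (d : S × A → ℝ × ℕ) (s : S) : ℝ :=
  ∑ a, (π s a).toReal * (M.reward s a - g + (d (s, a)).1)

/-- One update of the value function, anchored at `s₀`. -/
def valueUpdate (M : RobustMDP S A) (π : S → PMF A) (s₀ : S) (η g₀ : ℝ) (V : S → ℝ)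
    (d : S × A → ℝ × ℕ) : S → ℝ :=
  let W : S → ℝ := fun s => V s + η * (bellmanEstimate M π g₀ d s - V s)
  fun s => W s - W s₀

/-- First phase: joint law of `V_t` and of the number of samples used so far (with `g₀ = 0`). -/
def valuePhase (M : RobustMDP S A) (π : S → PMF A) (s₀ : S) (η : ℕ → ℝ) (Nmax : ℕ) (V₀ : S → ℝ) :
    ℕ → PMF ((S → ℝ) × ℕ)
  | 0 => PMF.pure (V₀, 0)
  | t + 1 => (valuePhase M π s₀ η Nmax V₀ t).bind fun Vn =>
      (sampleRound M Nmax Vn.1).map fun d =>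
        (valueUpdate M π s₀ (η t) 0 Vn.1 d, Vn.2 + roundCount d)

/-- The averaged Bellman residual `δ̄ = (1/S) ∑_s (∑_a π(a|s) (r(s,a) + σ̂(s,a)) - V(s))`. -/
def residualEstimate (M : RobustMDP S A) (π : S → PMF A) (V : S → ℝ) (d : S × A → ℝ × ℕ) : ℝ :=
  (1 / (Fintype.card S : ℝ)) * ∑ s, (bellmanEstimate M π 0 d s - V s)

/-- Second phase, run with the value function `V`: joint law of `g_t` and of the number of samples
used so far in this phase, started from `g₀ = 0`. -/
def rewardPhase (M : RobustMDP S A) (π : S → PMF A) (β : ℕ → ℝ) (Nmax : ℕ) (V : S → ℝ) :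
    ℕ → PMF (ℝ × ℕ)
  | 0 => PMF.pure (0, 0)
  | t + 1 => (rewardPhase M π β Nmax V t).bind fun gn =>
      (sampleRound M Nmax V).map fun d =>
        (gn.1 + β t * (residualEstimate M π V d - gn.1), gn.2 + roundCount d)

/-- Robust average-reward TD learning: joint law of `V_T`, of `g_T`, and of the total
number of samples drawn from the nominal model. -/
def robustTD (M : RobustMDP S A) (π : S → PMF A) (s₀ : S) (η β : ℕ → ℝ) (Nmax : ℕ) (V₀ : S → ℝ)
    (T : ℕ) : PMF ((S → ℝ) × ℝ × ℕ) :=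
  (valuePhase M π s₀ η Nmax V₀ T).bind fun Vn =>
    (rewardPhase M π β Nmax Vn.1 T).map fun gm => (Vn.1, gm.1, Vn.2 + gm.2)

/-- `E |g_T - g|`. -/
def expectedError (M : RobustMDP S A) (π : S → PMF A) (s₀ : S) (η β : ℕ → ℝ) (Nmax : ℕ)
    (V₀ : S → ℝ) (T : ℕ) (g : ℝ) : ℝ≥0∞ :=
  expect (robustTD M π s₀ η β Nmax V₀ T) fun z => ENNReal.ofReal |z.2.1 - g|

/-- Expected total number of samples. -/
def expectedSamples (M : RobustMDP S A) (π : S → PMF A) (s₀ : S) (η β : ℕ → ℝ) (Nmax : ℕ)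
    (V₀ : S → ℝ) (T : ℕ) : ℝ≥0∞ :=
  expect (robustTD M π s₀ η β Nmax V₀ T) fun z => (z.2.2 : ℝ≥0∞)

end Algorithms

/-! ### The rates -/

/-- The error rate of `g_T`, for `n` states, mixing time `t` and contraction factor `γ`. -/
def errorRate {S : Type u} (U : UncertaintyModel S) (n t γ : ℝ) (Nmax T : ℕ) : ℝ :=
  match U with
  | .contamination _ =>
      1 / T + Real.log T / T + t * Real.log T / (√T * (1 - γ))
  | _ =>
      1 / T + Real.log T / T + t * √(n * Nmax) * Real.log T / (√T * (1 - γ))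
        + √n * t * (2 : ℝ) ^ (-(Nmax : ℝ) / 4) * Real.log T ^ ((3 : ℝ) / 2) / √(1 - γ)
        + √n * (2 : ℝ) ^ (-(Nmax : ℝ) / 2) * t * Real.log T

/-- The polylogarithmic factor of the sample complexity. -/
def logFactor {S : Type u} (U : UncertaintyModel S) (n t γ ε : ℝ) : ℝ :=
  match U with
  | .contamination _ => 1 + Real.log (t / (ε * (1 - γ)))
  | _ => (1 + Real.log (√n * t / (ε * (1 - γ)))) ^ 4

end RobustAvg

end

noncomputable section

/-! The proof separates the deterministic robust Bellman operator from the noise of its estimates.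

Under the radius conditions, all the chains induced by kernels in the uncertainty set lie in a
family of stochastic matrices that is closed under row-wise convex combinations and whose products
of some fixed length have uniformly positive entries (`exists_scrambling_family`). Products from
such a family contract the span geometrically, and the supremum of the spans along all products,
rescaled by a power of the contraction rate, is a semi-norm contracted by every member
(`Scrambling.exists_seminorm`). Since a difference of two values of the robust Bellman operator is
the image of the difference of the arguments under one member of the family, the operator contracts
too. Its fixed point modulo constants solves the Bellman equation; the additive constant there is
the robust average reward (`isRobustAverageReward_of_bellman`), and the span of the solution is at
most a multiple of the mixing time (`span_bellman_solution_le`).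

For the stochastic recursion a contraction semi-norm is replaced by its Moreau envelope, which is
smooth and still contracted (`exists_smooth_seminorm`), so that centred noise enters squared norms
only through its second moment. A smooth semi-norm comparable to the span can exist only if the
number of states is bounded in terms of the comparison constants (`IsSmooth.card_le`). Hence powers
of the number of states coming from crude variance estimates can be absorbed in a constant depending
on `B` alone.

The support function of a total variation or Wasserstein ball is Lipschitz in its centre, with
constant the span of the value function (`supportFn_le_add`). Together with the mean square error of
empirical laws this bounds the bias of the multi-level estimator, which telescopes to a plug-in
estimate from the finest level, and its variance, which grows only linearly in the truncation level.
The second phase averages independent residuals, so the final error is governed by the span of the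
error of `V_T`, and by the span of `V_T` times the bias plus the standard deviation over `√T`.

The first phase has two regimes. If the bias is small compared with `1 - γ`, half of the contraction
absorbs it, and a scalar recursion gives the rate (`expectedError_le_of_small_bias`). Otherwise
contraction is of no use, but the mean of the estimate still stays within the range of `V` up to the
reward bound, so a time-dependent smoothing of the span shows that `V_T` grows only logarithmically
(`expectedError_le_of_any_bias`). In that regime the term with `2^(-N_max/4)` in the claimed rate
already dominates the mixing time times `log T`. For the sample complexity, `N_max` is taken
logarithmically large, which forces the first regime. -/

namespace RobustAvg

/-! ### Expectations over finite probability spaces -/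

section Expectation

variable {Ω Ω' α β : Type*}

/-- Expectation of a real function on a finite probability space. -/
def ev [Fintype Ω] (P : PMF Ω) (f : Ω → ℝ) : ℝ := ∑ ω, (P ω).toReal * f ω

theorem sum_toReal [Fintype Ω] (P : PMF Ω) : ∑ ω, (P ω).toReal = 1 := by
  rw [← ENNReal.toReal_sum (fun ω _ => P.apply_ne_top ω), ← tsum_fintype (L := .unconditional _),
    P.tsum_coe, ENNReal.toReal_one]

section

variable [Fintype Ω] (P : PMF Ω)

theorem ev_const (c : ℝ) : ev P (fun _ => c) = c := by
  simp only [ev, ← Finset.sum_mul, sum_toReal, one_mul]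

theorem ev_add (f g : Ω → ℝ) : ev P (fun ω => f ω + g ω) = ev P f + ev P g := by
  simp only [ev, mul_add, Finset.sum_add_distrib]

theorem ev_sub (f g : Ω → ℝ) : ev P (fun ω => f ω - g ω) = ev P f - ev P g := by
  simp only [ev, mul_sub, Finset.sum_sub_distrib]

theorem ev_mul_left (c : ℝ) (f : Ω → ℝ) : ev P (fun ω => c * f ω) = c * ev P f := by
  simp only [ev, Finset.mul_sum]
  exact Finset.sum_congr rfl fun _ _ => by ring

theorem ev_mul_right (c : ℝ) (f : Ω → ℝ) : ev P (fun ω => f ω * c) = ev P f * c := by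
  simp only [mul_comm _ c, ev_mul_left]

theorem ev_sum {ι : Type*} (s : Finset ι) (f : ι → Ω → ℝ) :
    ev P (fun ω => ∑ i ∈ s, f i ω) = ∑ i ∈ s, ev P (f i) := by
  simp only [ev, Finset.mul_sum]
  exact Finset.sum_comm

variable {P}

theorem ev_mono {f g : Ω → ℝ} (h : ∀ ω, f ω ≤ g ω) : ev P f ≤ ev P g :=
  Finset.sum_le_sum fun ω _ => mul_le_mul_of_nonneg_left (h ω) ENNReal.toReal_nonneg

theorem ev_nonneg {f : Ω → ℝ} (h : ∀ ω, 0 ≤ f ω) : 0 ≤ ev P f :=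
  Finset.sum_nonneg fun ω _ => mul_nonneg ENNReal.toReal_nonneg (h ω)

theorem ev_le_of_forall_le {f : Ω → ℝ} {c : ℝ} (h : ∀ ω, f ω ≤ c) : ev P f ≤ c :=
  (ev_mono h).trans_eq (ev_const P c)

theorem le_ev_of_forall_le {f : Ω → ℝ} {c : ℝ} (h : ∀ ω, c ≤ f ω) : c ≤ ev P f :=
  (ev_const P c).symm.trans_le (ev_mono h)

theorem abs_ev_le (f : Ω → ℝ) : |ev P f| ≤ ev P fun ω => |f ω| := by
  refine abs_le.2 ⟨?_, ev_mono fun ω => le_abs_self _⟩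
  have := ev_mono (P := P) (f := fun ω => (-1) * |f ω|) (g := f)
    fun ω => by linarith [neg_abs_le (f ω)]
  rw [ev_mul_left] at this; linarith

theorem ev_sq_sub (f : Ω → ℝ) (c : ℝ) :
    ev P (fun ω => (f ω - c) ^ 2) = ev P (fun ω => (f ω - ev P f) ^ 2) + (ev P f - c) ^ 2 := by
  have h : ∀ d, ev P (fun ω => (f ω - d) ^ 2) = ev P (fun ω => f ω ^ 2) - 2 * d * ev P f + d ^ 2 := by
    intro d
    rw [← ev_mul_left, ← ev_sub, ← ev_const P (d ^ 2), ← ev_add]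
    congr 1; ext ω; ring
  rw [h, h]; ring

theorem ev_variance_le (f : Ω → ℝ) (c : ℝ) :
    ev P (fun ω => (f ω - ev P f) ^ 2) ≤ ev P (fun ω => (f ω - c) ^ 2) := by
  rw [ev_sq_sub f c]; nlinarith [sq_nonneg (ev P f - c)]

theorem sq_ev_le (f : Ω → ℝ) : (ev P f) ^ 2 ≤ ev P fun ω => f ω ^ 2 := by
  have h := ev_sq_sub (P := P) f 0
  simp only [sub_zero] at h
  rw [h]
  have := ev_nonneg (P := P) (f := fun ω => (f ω - ev P f) ^ 2) fun ω => sq_nonneg _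
  linarith

theorem ev_sqrt_le {f : Ω → ℝ} (h : ∀ ω, 0 ≤ f ω) : ev P (fun ω => √(f ω)) ≤ √(ev P f) := by
  refine Real.le_sqrt_of_sq_le ((sq_ev_le _).trans_eq ?_)
  congr 1; ext ω; exact Real.sq_sqrt (h ω)

theorem ev_bind [Fintype Ω'] (f : Ω → PMF Ω') (g : Ω' → ℝ) :
    ev (P.bind f) g = ev P fun ω => ev (f ω) g := by
  simp only [ev, PMF.bind_apply, tsum_fintype]
  simp_rw [ENNReal.toReal_sum (fun a _ => ENNReal.mul_ne_top (P.apply_ne_top a)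
    ((f a).apply_ne_top _)), ENNReal.toReal_mul, Finset.sum_mul, Finset.mul_sum]
  rw [Finset.sum_comm]
  exact Finset.sum_congr rfl fun _ _ => Finset.sum_congr rfl fun _ _ => by ring

theorem ev_pure (a : Ω) (g : Ω → ℝ) : ev (PMF.pure a) g = g a := by
  classical
  simp only [ev, PMF.pure_apply]
  rw [Finset.sum_eq_single a] <;> simp +contextual

theorem ev_map [Fintype Ω'] (f : Ω → Ω') (g : Ω' → ℝ) :
    ev (P.map f) g = ev P fun ω => g (f ω) := by
  rw [PMF.map, ev_bind]
  simp only [Function.comp_apply, ev_pure]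

end

theorem expect_bind (p : PMF α) (f : α → PMF β) (g : β → ℝ≥0∞) :
    expect (p.bind f) g = expect p fun x => expect (f x) g := by
  simp only [expect, PMF.bind_apply, ← ENNReal.tsum_mul_right, ← ENNReal.tsum_mul_left]
  rw [ENNReal.tsum_comm]
  exact tsum_congr fun _ => tsum_congr fun _ => by ring

theorem expect_pure (a : α) (g : α → ℝ≥0∞) : expect (PMF.pure a) g = g a := by
  classical
  rw [expect, tsum_eq_single a] <;> simp +contextual [PMF.pure_apply]

theorem expect_map (p : PMF α) (f : α → β) (g : β → ℝ≥0∞) :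
    expect (p.map f) g = expect p fun x => g (f x) := by
  rw [PMF.map, expect_bind]
  simp only [Function.comp_apply, expect_pure]

theorem expect_mono {p : PMF α} {f g : α → ℝ≥0∞} (h : ∀ x, f x ≤ g x) : expect p f ≤ expect p g :=
  ENNReal.tsum_le_tsum fun x => by gcongr; exact h x

theorem expect_const (p : PMF α) (c : ℝ≥0∞) : expect p (fun _ => c) = c := by
  simp only [expect, ENNReal.tsum_mul_right, p.tsum_coe, one_mul]

theorem expect_add (p : PMF α) (f g : α → ℝ≥0∞) :
    expect p (fun x => f x + g x) = expect p f + expect p g := by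
  simp only [expect, mul_add, ENNReal.tsum_add]

theorem expect_mul_left (p : PMF α) (c : ℝ≥0∞) (f : α → ℝ≥0∞) :
    expect p (fun x => c * f x) = c * expect p f := by
  simp only [expect, ← ENNReal.tsum_mul_left]
  exact tsum_congr fun _ => by ring

theorem expect_sum {ι : Type*} (p : PMF α) (s : Finset ι) (f : ι → α → ℝ≥0∞) :
    expect p (fun x => ∑ i ∈ s, f i x) = ∑ i ∈ s, expect p (f i) := by
  simp only [expect, Finset.mul_sum]
  exact Summable.tsum_finsetSum fun _ _ => ENNReal.summable

theorem expect_ofReal [Fintype Ω] (P : PMF Ω) {f : Ω → ℝ} (h : ∀ ω, 0 ≤ f ω) :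
    expect P (fun ω => ENNReal.ofReal (f ω)) = ENNReal.ofReal (ev P f) := by
  rw [expect, tsum_fintype, ev,
    ENNReal.ofReal_sum_of_nonneg fun ω _ => mul_nonneg ENNReal.toReal_nonneg (h ω)]
  refine Finset.sum_congr rfl fun ω _ => ?_
  rw [ENNReal.ofReal_mul ENNReal.toReal_nonneg, ENNReal.ofReal_toReal (P.apply_ne_top ω)]

/-- Bounding a first moment by a second one. -/
theorem expect_le_of_sq {p : PMF α} {f : α → ℝ} {c : ℝ} (hc : 0 ≤ c)
    (h : expect p (fun x => ENNReal.ofReal (f x ^ 2)) ≤ ENNReal.ofReal (c ^ 2)) :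
    expect p (fun x => ENNReal.ofReal (f x)) ≤ ENNReal.ofReal c := by
  -- In place of Jensen's inequality, `f ≤ f² / (2d) + d / 2` is integrated for every `d > c` and
  -- `d` decreases to `c`. Taking `d` strictly above `c` keeps the division meaningful when `c = 0`.
  refine le_of_forall_gt_imp_ge_of_dense fun b hb => ?_
  obtain ⟨d, hcd, hdb⟩ : ∃ d, c < d ∧ ENNReal.ofReal d ≤ b := by
    rcases eq_or_ne b ⊤ with rfl | hb'
    · exact ⟨c + 1, by linarith, le_top⟩
    · exact ⟨b.toReal, (ENNReal.ofReal_lt_iff_lt_toReal hc hb').1 hb, ENNReal.ofReal_toReal_le⟩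
  refine le_trans ?_ hdb
  have hd : 0 < d := hc.trans_lt hcd
  calc expect p (fun x => ENNReal.ofReal (f x))
      ≤ expect p (fun x => ENNReal.ofReal (1 / (2 * d)) * ENNReal.ofReal (f x ^ 2)
          + ENNReal.ofReal (d / 2)) := by
        refine expect_mono fun x => ?_
        rw [← ENNReal.ofReal_mul (by positivity), ← ENNReal.ofReal_add (by positivity)
          (by positivity)]
        refine ENNReal.ofReal_le_ofReal ?_
        have : 1 / (2 * d) * f x ^ 2 + d / 2 - f x = (f x - d) ^ 2 / (2 * d) := by
          field_simp; ring
        have h2 : 0 ≤ (f x - d) ^ 2 / (2 * d) := by positivity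
        linarith
    _ ≤ ENNReal.ofReal (1 / (2 * d)) * ENNReal.ofReal (d ^ 2) + ENNReal.ofReal (d / 2) := by
        rw [expect_add, expect_const, expect_mul_left]
        gcongr
        exact h.trans (ENNReal.ofReal_le_ofReal (by nlinarith))
    _ = ENNReal.ofReal d := by
        rw [← ENNReal.ofReal_mul (by positivity), ← ENNReal.ofReal_add (by positivity)
          (by positivity)]
        congr 1; field_simp; ring

/-! ### Independent products -/

section Product

variable {ι : Type*} [Fintype ι]

theorem indepProduct_apply (p : ι → PMF α) (x : ι → α) : indepProduct p x = ∏ i, p i (x i) := rfl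

/-- A function of one coordinate is a product over all coordinates with every other factor equal to
`1`, so the sum factorises and the other factors are total masses. -/
theorem expect_indepProduct_apply (p : ι → PMF α) (i : ι) (f : α → ℝ≥0∞) :
    expect (indepProduct p) (fun x => f (x i)) = expect (p i) f := by
  classical
  have h : ∀ x : ι → α, indepProduct p x * f (x i) =
      ∏ j, p j (x j) * (if j = i then f (x j) else 1) := by
    intro x
    rw [Finset.prod_mul_distrib, indepProduct_apply]
    simp
  simp only [expect, h]
  rw [tsum_prod_pi (fun j a => p j a * if j = i then f a else 1), Finset.prod_eq_single i]
  · simp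
  · intro j _ hj; simp [hj]
  · simp

theorem indepProduct_map (p : ι → PMF α) (f : ι → α → β) :
    indepProduct (fun i => (p i).map (f i)) = (indepProduct p).map fun x i => f i (x i) := by
  classical
  ext y
  simp only [indepProduct_apply, PMF.map_apply]
  rw [← tsum_prod_pi (fun i a => if y i = f i a then p i a else 0)]
  refine tsum_congr fun x => ?_
  split_ifs with h
  · subst h; simp
  · obtain ⟨i, hi⟩ := Function.ne_iff.1 h
    exact Finset.prod_eq_zero (Finset.mem_univ i) (if_neg hi)

/-- Being mapped to `y` is a constraint that factorises over coordinates. Injectivity puts exactly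
one constraint on each coordinate in the image of `e`, and the free coordinates sum to one. This is
what identifies the even and the odd half of a sample as samples in their own right. -/
theorem indepProduct_map_comp {κ : Type*} [Fintype κ] (p : PMF α) (e : κ → ι)
    (he : Function.Injective e) :
    (indepProduct fun _ : ι => p).map (fun x => x ∘ e) = indepProduct fun _ : κ => p := by
  classical
  ext y
  simp only [indepProduct_apply, PMF.map_apply]
  trans ∑' x : ι → α, ∏ i, if ∀ k, e k = i → y k = x i then p (x i) else 0
  · refine tsum_congr fun x => ?_
    split_ifs with hx
    · subst hx
      refine Finset.prod_congr rfl fun i _ => (if_pos ?_).symm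
      rintro k rfl; rfl
    · obtain ⟨k, hk⟩ := Function.ne_iff.1 hx
      exact (Finset.prod_eq_zero (Finset.mem_univ (e k))
        (if_neg fun hc => hk (hc k rfl))).symm
  rw [tsum_prod_pi (fun i a => if ∀ k, e k = i → y k = a then p a else 0)]
  have hr : ∀ i, i ∉ Finset.univ.image e →
      (∑' a, if ∀ k, e k = i → y k = a then p a else 0) = 1 := by
    intro i hi
    rw [← p.tsum_coe]
    refine tsum_congr fun a => if_pos fun k hk => ?_
    exact absurd (Finset.mem_image.2 ⟨k, Finset.mem_univ k, hk⟩) hi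
  rw [← Finset.prod_subset (Finset.subset_univ (Finset.univ.image e)) fun i _ => hr i,
    Finset.prod_image fun a _ b _ h => he h]
  refine Finset.prod_congr rfl fun k _ => ?_
  rw [tsum_eq_single (y k)]
  · simp [he.eq_iff]
  · intro a ha
    exact if_neg fun hc => ha (hc k rfl).symm

theorem ev_indepProduct_comp [DecidableEq ι] [Fintype α] {κ : Type*} [Fintype κ] [DecidableEq κ]
    (p : PMF α) (e : κ → ι) (he : Function.Injective e) (f : (κ → α) → ℝ) :
    ev (indepProduct fun _ : ι => p) (fun x => f (x ∘ e)) = ev (indepProduct fun _ : κ => p) f := by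
  rw [← indepProduct_map_comp p e he, ev_map]

theorem ev_indepProduct_apply [DecidableEq ι] [Fintype α] (p : ι → PMF α) (i : ι) (f : α → ℝ) :
    ev (indepProduct p) (fun x => f (x i)) = ev (p i) f := by
  have h : ∀ x : ι → α, (indepProduct p x).toReal * f (x i) =
      ∏ j, (p j (x j)).toReal * (if j = i then f (x j) else 1) := by
    intro x
    rw [Finset.prod_mul_distrib, indepProduct_apply, ENNReal.toReal_prod]
    simp
  simp only [ev, h]
  rw [← Fintype.piFinset_univ, ← Finset.prod_univ_sum
    (fun _ => Finset.univ) (fun j a => (p j a).toReal * if j = i then f a else 1),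
    Finset.prod_eq_single i]
  · simp
  · intro j _ hj; simp [hj, sum_toReal]
  · simp

theorem ev_indepProduct_mul [DecidableEq ι] [Fintype α] (p : ι → PMF α) {i k : ι} (hik : i ≠ k)
    (f g : α → ℝ) :
    ev (indepProduct p) (fun x => f (x i) * g (x k)) = ev (p i) f * ev (p k) g := by
  have h : ∀ x : ι → α, (indepProduct p x).toReal * (f (x i) * g (x k)) =
      ∏ j, (p j (x j)).toReal * ((if j = i then f (x j) else 1) * if j = k then g (x j) else 1) := by
    intro x
    rw [Finset.prod_mul_distrib, Finset.prod_mul_distrib, indepProduct_apply, ENNReal.toReal_prod]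
    simp
  simp only [ev, h]
  rw [← Fintype.piFinset_univ, ← Finset.prod_univ_sum (fun _ => Finset.univ)
    (fun j a => (p j a).toReal * ((if j = i then f a else 1) * if j = k then g a else 1)),
    ← Finset.prod_subset (Finset.subset_univ {i, k}), Finset.prod_pair hik]
  · simp [hik, hik.symm]
  · intro j _ hj
    simp only [Finset.mem_insert, Finset.mem_singleton, not_or] at hj
    simp [hj.1, hj.2, sum_toReal]

end Product

end Expectation

/-! ### The span semi-norm -/

/-- Through this the anchoring at `s₀` and the unknown constant `g` drop out of all estimates. -/
theorem seminorm_congr_of_const {S : Type*} (q : Seminorm ℝ (S → ℝ)) (hq : ∀ c : ℝ, q (fun _ => c) = 0)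
    {x y : S → ℝ} {c : ℝ} (h : ∀ i, x i = y i + c) : q x = q y := by
  have hx : x = y + fun _ => c := funext h
  have hy : y = x - fun _ => c := by rw [hx]; simp
  apply le_antisymm
  · calc q x ≤ q y + q (fun _ => c) := by rw [hx]; exact map_add_le_add q _ _
      _ = q y := by rw [hq, add_zero]
  · calc q y ≤ q x + q (fun _ => c) := by
          conv_lhs => rw [hy]
          exact map_sub_le_add q _ _
      _ = q x := by rw [hq, add_zero]

section Span

variable {S : Type*} [Fintype S]

theorem bddAbove_range_of_finite (V : S → ℝ) : BddAbove (Set.range V) := (Set.finite_range V).bddAbove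

theorem bddBelow_range_of_finite (V : S → ℝ) : BddBelow (Set.range V) := (Set.finite_range V).bddBelow

theorem le_iSup_fin (V : S → ℝ) (i : S) : V i ≤ ⨆ s, V s := le_ciSup (bddAbove_range_of_finite V) i

theorem iInf_fin_le (V : S → ℝ) (i : S) : ⨅ s, V s ≤ V i := ciInf_le (bddBelow_range_of_finite V) i

theorem sub_le_span (V : S → ℝ) (i j : S) : V i - V j ≤ spanSeminorm V :=
  sub_le_sub (le_iSup_fin V i) (iInf_fin_le V j)

theorem abs_sub_le_span (V : S → ℝ) (i j : S) : |V i - V j| ≤ spanSeminorm V :=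
  abs_le.2 ⟨by linarith [sub_le_span V j i], sub_le_span V i j⟩

variable [Nonempty S]

theorem exists_iSup_eq (V : S → ℝ) : ∃ i, V i = ⨆ s, V s := exists_eq_ciSup_of_finite

theorem exists_iInf_eq (V : S → ℝ) : ∃ i, V i = ⨅ s, V s := exists_eq_ciInf_of_finite

theorem span_le_iff {V : S → ℝ} {c : ℝ} : spanSeminorm V ≤ c ↔ ∀ i j, V i - V j ≤ c := by
  refine ⟨fun h i j => (sub_le_span V i j).trans h, fun h => ?_⟩
  obtain ⟨i, hi⟩ := exists_iSup_eq V
  obtain ⟨j, hj⟩ := exists_iInf_eq V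
  rw [spanSeminorm, ← hi, ← hj]; exact h i j

theorem exists_span_eq (V : S → ℝ) : ∃ i j, V i - V j = spanSeminorm V := by
  obtain ⟨i, hi⟩ := exists_iSup_eq V
  obtain ⟨j, hj⟩ := exists_iInf_eq V
  exact ⟨i, j, by rw [spanSeminorm, ← hi, ← hj]⟩

theorem span_nonneg (V : S → ℝ) : 0 ≤ spanSeminorm V := by
  have := sub_le_span V (Classical.arbitrary S) (Classical.arbitrary S)
  linarith

/-- The span semi-norm as a bundled semi-norm. -/
def spanS (S : Type*) [Fintype S] [Nonempty S] : Seminorm ℝ (S → ℝ) :=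
  Seminorm.of spanSeminorm
    (fun x y => span_le_iff.2 fun i j => by
      have h1 := sub_le_span x i j
      have h2 := sub_le_span y i j
      simp only [Pi.add_apply]; linarith)
    (fun a x => by
      apply le_antisymm
      · refine span_le_iff.2 fun i j => ?_
        simp only [Pi.smul_apply, smul_eq_mul, ← mul_sub, Real.norm_eq_abs]
        calc a * (x i - x j) ≤ |a * (x i - x j)| := le_abs_self _
          _ = |a| * |x i - x j| := abs_mul _ _
          _ ≤ _ := mul_le_mul_of_nonneg_left (abs_sub_le_span x i j) (abs_nonneg a)
      · obtain ⟨i, j, h⟩ := exists_span_eq x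
        rw [← h, Real.norm_eq_abs]
        have h0 : 0 ≤ x i - x j := h ▸ span_nonneg x
        rw [← abs_of_nonneg h0, ← abs_mul, mul_sub]
        exact abs_sub_le_span (a • x) i j)

theorem spanS_apply (x : S → ℝ) : spanS S x = spanSeminorm x := rfl

theorem span_const (c : ℝ) : spanSeminorm (fun _ : S => c) = 0 :=
  le_antisymm (span_le_iff.2 fun i j => by simp) (span_nonneg _)

theorem span_eq_zero_iff {x : S → ℝ} : spanSeminorm x = 0 ↔ ∃ c : ℝ, x = fun _ => c := by
  refine ⟨fun h => ⟨x (Classical.arbitrary S), funext fun i => ?_⟩, ?_⟩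
  · have h1 := abs_sub_le_span x i (Classical.arbitrary S)
    rw [h] at h1
    linarith [abs_nonpos_iff.1 h1]
  · rintro ⟨c, rfl⟩; exact span_const c

theorem span_le_two_mul {x : S → ℝ} {c : ℝ} (h : ∀ i, |x i| ≤ c) : spanSeminorm x ≤ 2 * c :=
  span_le_iff.2 fun i j => by
    have h1 := abs_le.1 (h i)
    have h2 := abs_le.1 (h j)
    linarith

end Span

/-! ### Laws on a finite set as points of the simplex -/

section Simplex

variable {S : Type u} [Fintype S]

/-- The law with given weights. -/
def ofWeights {α : Type*} [Fintype α] (w : α → ℝ) (h0 : ∀ x, 0 ≤ w x) (h1 : ∑ x, w x = 1) : PMF α :=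
  PMF.ofFintype (fun x => ENNReal.ofReal (w x)) (by
    rw [← ENNReal.ofReal_sum_of_nonneg fun x _ => h0 x, h1, ENNReal.ofReal_one])

theorem toReal_ofWeights {α : Type*} [Fintype α] {w : α → ℝ} (h0 : ∀ x, 0 ≤ w x)
    (h1 : ∑ x, w x = 1) (x : α) : (ofWeights w h0 h1 x).toReal = w x := by
  rw [ofWeights, PMF.ofFintype_apply, ENNReal.toReal_ofReal (h0 x)]

theorem pmf_ext_toReal {α : Type*} {p q : PMF α} (h : ∀ x, (p x).toReal = (q x).toReal) : p = q :=
  PMF.ext fun x => (ENNReal.toReal_eq_toReal_iff' (p.apply_ne_top x) (q.apply_ne_top x)).1 (h x)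

theorem toReal_map [DecidableEq S] {Ω : Type*} [Fintype Ω] (P : PMF Ω) (f : Ω → S) (x : S) :
    ((P.map f) x).toReal = ev P fun ω => if f ω = x then 1 else 0 := by
  classical
  have h := ev_map (P := P) f (fun y => if y = x then (1 : ℝ) else 0)
  rw [← h, ev]
  simp

theorem map_fst_toReal (c : PMF (S × S)) (x : S) :
    ((c.map Prod.fst) x).toReal = ∑ y, (c (x, y)).toReal := by
  classical
  rw [toReal_map, ev, Fintype.sum_prod_type, Finset.sum_eq_single x] <;> simp +contextual

theorem map_snd_toReal (c : PMF (S × S)) (y : S) :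
    ((c.map Prod.snd) y).toReal = ∑ x, (c (x, y)).toReal := by
  classical
  rw [toReal_map, ev, Fintype.sum_prod_type_right, Finset.sum_eq_single y] <;> simp +contextual

/-! ### Transport plans -/

/-- `c` is a transport plan starting from the weights `p`. -/
def IsPlan (p : S → ℝ) (c : S → S → ℝ) : Prop := (∀ x y, 0 ≤ c x y) ∧ ∀ x, ∑ y, c x y = p x

/-- Total cost of a transport plan. -/
def planCost (w c : S → S → ℝ) : ℝ := ∑ x, ∑ y, c x y * w x y

theorem continuous_planCost (w : S → S → ℝ) : Continuous (planCost w) := by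
  unfold planCost; fun_prop

theorem isCompact_isPlan (p : S → ℝ) : IsCompact {c | IsPlan p c} := by
  refine Metric.isCompact_of_isClosed_isBounded ?_ ?_
  · have : {c | IsPlan p c} =
        (⋂ x, ⋂ y, {c : S → S → ℝ | 0 ≤ c x y}) ∩ ⋂ x, {c : S → S → ℝ | ∑ y, c x y = p x} := by
      ext c; simp [IsPlan]
    rw [this]
    refine IsClosed.inter (isClosed_iInter fun x => isClosed_iInter fun y => ?_)
      (isClosed_iInter fun x => ?_)
    · exact isClosed_le continuous_const (by fun_prop)
    · exact isClosed_eq (by fun_prop) continuous_const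
  · refine (Metric.isBounded_Icc (0 : S → S → ℝ) (fun x _ => p x)).subset ?_
    intro c hc
    refine ⟨fun x y => hc.1 x y, fun x y => ?_⟩
    beta_reduce
    rw [← hc.2 x]
    exact Finset.single_le_sum (f := fun y => c x y) (fun y _ => hc.1 x y) (Finset.mem_univ y)

/-- The ball `U` consists of the laws that can be reached by transport plans of bounded cost. -/
def IsTransportBall (U : UncertaintyModel S) (w : S → S → ℝ) (κ : ℝ) : Prop :=
  0 ≤ κ ∧ (∀ x y, 0 ≤ w x y) ∧ (∀ x, w x x = 0) ∧ ∀ p q : PMF S, q ∈ U.ball p ↔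
    ∃ c, IsPlan (fun x => (p x).toReal) c ∧ (∀ y, ∑ x, c x y = (q y).toReal) ∧ planCost w c ≤ κ

theorem sum_plan_right {p : PMF S} {c : S → S → ℝ} (hc : IsPlan (fun x => (p x).toReal) c) :
    ∑ y, ∑ x, c x y = 1 := by
  rw [Finset.sum_comm, ← sum_toReal p]
  exact Finset.sum_congr rfl fun x _ => hc.2 x

theorem exists_coupling_iff (w : S → S → ℝ) (p q : PMF S) (r : ℝ) :
    (∃ c ∈ couplings p q, ∑ x, ∑ y, (c (x, y)).toReal * w x y = r) ↔
    ∃ c, IsPlan (fun x => (p x).toReal) c ∧ (∀ y, ∑ x, c x y = (q y).toReal) ∧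
      planCost w c = r := by
  constructor
  · rintro ⟨c, ⟨h1, h2⟩, h3⟩
    refine ⟨fun x y => (c (x, y)).toReal, ⟨fun _ _ => ENNReal.toReal_nonneg, fun x => ?_⟩,
      fun y => ?_, h3⟩
    · simp only [← h1, map_fst_toReal]
    · simp only [← h2, map_snd_toReal]
  · rintro ⟨c, h1, h2, h3⟩
    have h0 : ∀ z : S × S, 0 ≤ c z.1 z.2 := fun z => h1.1 _ _
    have hs : ∑ z : S × S, c z.1 z.2 = 1 := by
      rw [Fintype.sum_prod_type_right]; exact sum_plan_right h1
    refine ⟨ofWeights _ h0 hs, ⟨pmf_ext_toReal fun x => ?_, pmf_ext_toReal fun y => ?_⟩, ?_⟩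
    · simp only [map_fst_toReal, toReal_ofWeights]; exact h1.2 x
    · simp only [map_snd_toReal, toReal_ofWeights]; exact h2 y
    · simp only [toReal_ofWeights]; exact h3

/-- The plans between two given laws form a nonempty compact set on which the cost is continuous, so
the infimum over couplings is attained and the ball condition becomes the existence of a plan of
cost at most `δ ^ l`. -/
theorem isTransportBall_wasserstein (d : MetricSpace S) {l δ : ℝ} (hl : 1 ≤ l) (hδ : 0 ≤ δ) :
    IsTransportBall (.wasserstein d l δ) (fun x y => d.dist x y ^ l) (δ ^ l) := by
  have hw : ∀ x y, 0 ≤ d.dist x y ^ l := fun x y => Real.rpow_nonneg dist_nonneg l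
  have hl0 : l ≠ 0 := by linarith
  have hl1 : 0 < 1 / l := by positivity
  refine ⟨Real.rpow_nonneg hδ l, hw, fun x => ?_, fun p q => ?_⟩
  · beta_reduce
    rw [show d.dist x x = 0 from dist_self x, Real.zero_rpow hl0]
  have hcost : ∀ c : S → S → ℝ, (∀ x y, 0 ≤ c x y) → 0 ≤ planCost (fun x y => d.dist x y ^ l) c :=
    fun c hc => Finset.sum_nonneg fun x _ => Finset.sum_nonneg fun y _ => mul_nonneg (hc x y) (hw x y)
  set F : Set ℝ := (fun c : PMF (S × S) =>
    (∑ x, ∑ y, (c (x, y)).toReal * (d.dist x y) ^ l) ^ (1 / l)) '' couplings p q with hF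
  have hmem : ∀ c, IsPlan (fun x => (p x).toReal) c → (∀ y, ∑ x, c x y = (q y).toReal) →
      planCost (fun x y => d.dist x y ^ l) c ^ (1 / l) ∈ F := by
    intro c h1 h2
    obtain ⟨c', hc', h⟩ := (exists_coupling_iff (fun x y => d.dist x y ^ l) p q _).2 ⟨c, h1, h2, rfl⟩
    exact ⟨c', hc', by simp only [h]⟩
  have hbdd : BddBelow F := by
    refine ⟨0, ?_⟩
    rintro _ ⟨c, -, rfl⟩
    exact Real.rpow_nonneg (Finset.sum_nonneg fun x _ => Finset.sum_nonneg fun y _ =>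
      mul_nonneg ENNReal.toReal_nonneg (hw x y)) _
  show sInf F ≤ δ ↔ _
  constructor
  · intro h
    set K : Set (S → S → ℝ) := {c | IsPlan (fun x => (p x).toReal) c} ∩
      ⋂ y, {c : S → S → ℝ | ∑ x, c x y = (q y).toReal} with hK
    have hKc : IsCompact K := (isCompact_isPlan _).inter_right
      (isClosed_iInter fun y => isClosed_eq (by fun_prop) continuous_const)
    have hKn : K.Nonempty := by
      refine ⟨fun x y => (p x).toReal * (q y).toReal, ⟨fun x y => by positivity, fun x => ?_⟩, ?_⟩
      · rw [← Finset.mul_sum, sum_toReal, mul_one]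
      · simp only [Set.mem_iInter]
        intro y
        show ∑ x, _ = _
        rw [← Finset.sum_mul, sum_toReal, one_mul]
    obtain ⟨c, hcK, hmin⟩ := hKc.exists_isMinOn hKn
      (continuous_planCost fun x y => d.dist x y ^ l).continuousOn
    have hc2 : ∀ y, ∑ x, c x y = (q y).toReal := fun y => Set.mem_iInter.1 hcK.2 y
    refine ⟨c, hcK.1, hc2, ?_⟩
    have hle : planCost (fun x y => d.dist x y ^ l) c ^ (1 / l) ≤ sInf F := by
      refine le_csInf ⟨_, hmem c hcK.1 hc2⟩ ?_
      rintro _ ⟨c', hc', rfl⟩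
      obtain ⟨c'', h1, h2, h3⟩ := (exists_coupling_iff (fun x y => d.dist x y ^ l) p q _).1
        ⟨c', hc', rfl⟩
      refine Real.rpow_le_rpow (hcost c hcK.1.1) ?_ hl1.le
      rw [← h3]
      exact hmin ⟨h1, Set.mem_iInter.2 h2⟩
    have h3 := Real.rpow_le_rpow (Real.rpow_nonneg (hcost c hcK.1.1) _) (hle.trans h)
      (by linarith : 0 ≤ l)
    rwa [← Real.rpow_mul (hcost c hcK.1.1), one_div_mul_cancel hl0, Real.rpow_one] at h3
  · rintro ⟨c, h1, h2, h3⟩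
    refine (csInf_le hbdd (hmem c h1 h2)).trans ?_
    have h4 := Real.rpow_le_rpow (hcost c h1.1) h3 hl1.le
    rwa [← Real.rpow_mul hδ, mul_one_div_cancel hl0, Real.rpow_one] at h4

theorem sum_sub_min {p q : PMF S} :
    ∑ x, ((p x).toReal - min (p x).toReal (q x).toReal) = tvDist p q := by
  have h : ∀ x, (p x).toReal - min (p x).toReal (q x).toReal =
      (1 / 2) * |(p x).toReal - (q x).toReal| + (1 / 2) * ((p x).toReal - (q x).toReal) := by
    intro x
    rcases le_total (p x).toReal (q x).toReal with h | h
    · rw [min_eq_left h, abs_of_nonpos (by linarith)]; ring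
    · rw [min_eq_right h, abs_of_nonneg (by linarith)]; ring
  rw [Finset.sum_congr rfl fun x _ => h x, Finset.sum_add_distrib, ← Finset.mul_sum,
    ← Finset.mul_sum, Finset.sum_sub_distrib, sum_toReal, sum_toReal, tvDist]
  ring

theorem tvDist_comm (p q : PMF S) : tvDist p q = tvDist q p := by
  simp only [tvDist, abs_sub_comm]

theorem tvDist_nonneg (p q : PMF S) : 0 ≤ tvDist p q := by
  unfold tvDist; positivity

/-- Leave the common mass `min p q` in place and spread the excess of `p` over the deficit
proportionally; the moved mass is the total variation distance. Conversely the diagonal of any plan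
is at most `min p q`, so at least that much mass must move. -/
theorem isTransportBall_tv [DecidableEq S] {δ : ℝ} (hδ : 0 ≤ δ) :
    IsTransportBall (.tv δ : UncertaintyModel S) (fun x y => if x = y then 0 else 1) δ := by
  refine ⟨hδ, fun x y => by positivity, fun x => if_pos rfl, fun p q => ?_⟩
  show tvDist q p ≤ δ ↔ _
  constructor
  · intro h
    set m : S → ℝ := fun x => min (p x).toReal (q x).toReal with hm
    have hm0 : ∀ x, 0 ≤ m x := fun x => le_min ENNReal.toReal_nonneg ENNReal.toReal_nonneg
    set a : S → ℝ := fun x => (p x).toReal - m x with ha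
    set b : S → ℝ := fun x => (q x).toReal - m x with hb
    have ha0 : ∀ x, 0 ≤ a x := fun x => sub_nonneg.2 (min_le_left _ _)
    have hb0 : ∀ x, 0 ≤ b x := fun x => sub_nonneg.2 (min_le_right _ _)
    set τ := tvDist p q with hτ
    have hsa : ∑ x, a x = τ := sum_sub_min
    have hsb : ∑ x, b x = τ := by
      rw [hτ, tvDist_comm, ← sum_sub_min]; simp only [hb, hm, min_comm]
    have hτ0 : 0 ≤ τ := tvDist_nonneg p q
    -- When `τ = 0` the quotient below is zero by convention, which is the right value because
    -- excess and deficit vanish.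
    have hz : τ = 0 → (∀ x, a x = 0) ∧ ∀ x, b x = 0 := by
      intro h0
      rw [h0] at hsa hsb
      exact ⟨fun x => (Finset.sum_eq_zero_iff_of_nonneg fun x _ => ha0 x).1 hsa x (Finset.mem_univ x),
        fun x => (Finset.sum_eq_zero_iff_of_nonneg fun x _ => hb0 x).1 hsb x (Finset.mem_univ x)⟩
    refine ⟨fun x y => (if x = y then m x else 0) + a x * b y / τ, ⟨fun x y => ?_, fun x => ?_⟩,
      fun y => ?_, ?_⟩
    · have := hm0 x
      have := mul_nonneg (ha0 x) (hb0 y)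
      positivity
    · rw [Finset.sum_add_distrib, ← Finset.sum_div, ← Finset.mul_sum, hsb]
      rcases eq_or_ne τ 0 with h0 | h0
      · have := (hz h0).1 x
        simp [h0]; linarith
      · rw [mul_div_cancel_right₀ _ h0]; simp [ha]
    · rw [Finset.sum_add_distrib, ← Finset.sum_div, ← Finset.sum_mul, hsa]
      rcases eq_or_ne τ 0 with h0 | h0
      · have := (hz h0).2 y
        simp [h0]; linarith
      · rw [mul_div_cancel_left₀ _ h0]; simp [hb]
    · refine le_trans ?_ (tvDist_comm q p ▸ h)
      calc planCost (fun x y => if x = y then 0 else 1)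
            (fun x y => (if x = y then m x else 0) + a x * b y / τ)
          ≤ ∑ x, ∑ y, a x * b y / τ := by
            refine Finset.sum_le_sum fun x _ => Finset.sum_le_sum fun y _ => ?_
            have : 0 ≤ a x * b y / τ := div_nonneg (mul_nonneg (ha0 x) (hb0 y)) hτ0
            beta_reduce
            split_ifs <;> simp [this]
        _ = τ := by
            simp_rw [← Finset.sum_div, ← Finset.mul_sum, hsb]
            rw [← Finset.sum_mul, hsa]
            exact mul_self_div_self τ
  · rintro ⟨c, h1, h2, h3⟩
    rw [tvDist_comm, ← sum_sub_min]
    refine le_trans (Finset.sum_le_sum fun x _ => ?_) h3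
    have hle : c x x ≤ min (p x).toReal (q x).toReal := by
      refine le_min ?_ ?_
      · refine le_of_le_of_eq ?_ (h1.2 x)
        exact Finset.single_le_sum (f := fun y => c x y) (fun y _ => h1.1 x y) (Finset.mem_univ x)
      · refine le_of_le_of_eq ?_ (h2 x)
        exact Finset.single_le_sum (f := fun y => c y x) (fun y _ => h1.1 y x) (Finset.mem_univ x)
    have : ∑ y, c x y * (if x = y then 0 else 1) = ∑ y, c x y - c x x := by
      rw [← Finset.sum_erase_add _ _ (Finset.mem_univ x), ← Finset.sum_erase_add _ _ (Finset.mem_univ x)]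
      simp only [if_true, mul_zero, add_zero, add_sub_cancel_right]
      refine Finset.sum_congr rfl fun y hy => ?_
      rw [if_neg (Finset.ne_of_mem_erase hy).symm, mul_one]
    rw [this, h1.2 x]
    linarith

/-! ### Support functions -/

/-- The values of the radius for which the uncertainty sets are sensible. -/
def Admissible : UncertaintyModel S → Prop
  | .contamination δ => 0 ≤ δ ∧ δ < 1
  | .tv δ => 0 ≤ δ
  | .wasserstein _ l δ => 1 ≤ l ∧ 0 ≤ δ

theorem supportFn_eq_of_isLeast {U : UncertaintyModel S} {p q : PMF S} {V : S → ℝ}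
    (hq : q ∈ U.ball p) (h : ∀ q' ∈ U.ball p, ev q V ≤ ev q' V) : supportFn U p V = ev q V := by
  refine IsLeast.csInf_eq ⟨⟨q, hq, rfl⟩, ?_⟩
  rintro _ ⟨q', hq', rfl⟩
  exact h q' hq'

/-- The support function is a minimum. -/
def IsMinimizer (U : UncertaintyModel S) (p : PMF S) (V : S → ℝ) (q : PMF S) : Prop :=
  q ∈ U.ball p ∧ ∀ q' ∈ U.ball p, ev q V ≤ ev q' V

/-- The minimisation is carried out over plans rather than over laws: plans of cost at most `κ` are
compact in a space of real matrices, and the objective is linear in them. -/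
theorem exists_isMinimizer_of_transport {U : UncertaintyModel S} {w : S → S → ℝ} {κ : ℝ}
    (hU : IsTransportBall U w κ) (p : PMF S) (V : S → ℝ) : ∃ q, IsMinimizer U p V q := by
  classical
  obtain ⟨hκ, hw0, hww, hb⟩ := hU
  set K : Set (S → S → ℝ) := {c | IsPlan (fun x => (p x).toReal) c} ∩ {c | planCost w c ≤ κ}
  have hKc : IsCompact K := (isCompact_isPlan _).inter_right
    (isClosed_le (continuous_planCost w) continuous_const)
  have hKn : K.Nonempty := by
    refine ⟨fun x y => if x = y then (p x).toReal else 0,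
      ⟨fun x y => by positivity, fun x => by simp⟩, ?_⟩
    simpa [planCost, hww] using hκ
  obtain ⟨c, hc, hmin⟩ := hKc.exists_isMinOn hKn
    (f := fun c => ∑ y, (∑ x, c x y) * V y) (by fun_prop)
  have h0 : ∀ y, 0 ≤ ∑ x, c x y := fun y => Finset.sum_nonneg fun x _ => hc.1.1 x y
  refine ⟨ofWeights _ h0 (sum_plan_right hc.1), (hb _ _).2 ⟨c, hc.1, fun y => ?_, hc.2⟩,
    fun q' hq' => ?_⟩
  · rw [toReal_ofWeights]
  · obtain ⟨c', h1, h2, h3⟩ := (hb _ _).1 hq'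
    simp only [ev, toReal_ofWeights, ← h2]
    exact hmin ⟨h1, h3⟩

theorem ev_of_contamination {δ : ℝ} {p q q' : PMF S}
    (h : ∀ x, (q x).toReal = (1 - δ) * (p x).toReal + δ * (q' x).toReal) (V : S → ℝ) :
    ev q V = (1 - δ) * ev p V + δ * ev q' V := by
  simp only [ev, h, add_mul, Finset.sum_add_distrib, Finset.mul_sum, mul_assoc]

theorem isMinimizer_contamination [Nonempty S] {δ : ℝ} (h0 : 0 ≤ δ) (h1 : δ < 1) (p : PMF S)
    (V : S → ℝ) : ∃ q, IsMinimizer (.contamination δ) p V q ∧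
      ev q V = (1 - δ) * ev p V + δ * ⨅ y, V y := by
  classical
  obtain ⟨i, hi⟩ := exists_iInf_eq V
  set d : PMF S := PMF.pure i
  have hn : ∀ x, 0 ≤ (1 - δ) * (p x).toReal + δ * (d x).toReal := fun x =>
    add_nonneg (mul_nonneg (by linarith) ENNReal.toReal_nonneg) (mul_nonneg h0 ENNReal.toReal_nonneg)
  have hs : ∑ x, ((1 - δ) * (p x).toReal + δ * (d x).toReal) = 1 := by
    rw [Finset.sum_add_distrib, ← Finset.mul_sum, ← Finset.mul_sum, sum_toReal, sum_toReal]; ring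
  have hq : ∀ x, (ofWeights _ hn hs x).toReal = (1 - δ) * (p x).toReal + δ * (d x).toReal :=
    toReal_ofWeights hn hs
  have he : ev (ofWeights _ hn hs) V = (1 - δ) * ev p V + δ * ⨅ y, V y := by
    rw [ev_of_contamination hq, ev_pure, hi]
  refine ⟨_, ⟨⟨d, hq⟩, fun q' hq' => ?_⟩, he⟩
  obtain ⟨d', hd'⟩ := hq'
  rw [he, ev_of_contamination hd']
  have : ⨅ y, V y ≤ ev d' V := le_ev_of_forall_le fun x => iInf_fin_le V x
  nlinarith

theorem exists_isMinimizer [Nonempty S] {U : UncertaintyModel S} (hU : Admissible U) (p : PMF S)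
    (V : S → ℝ) : ∃ q, IsMinimizer U p V q := by
  classical
  cases U with
  | contamination δ =>
    obtain ⟨q, hq, -⟩ := isMinimizer_contamination hU.1 hU.2 p V
    exact ⟨q, hq⟩
  | tv δ => exact exists_isMinimizer_of_transport (isTransportBall_tv hU) p V
  | wasserstein d l δ =>
    exact exists_isMinimizer_of_transport (isTransportBall_wasserstein d hU.1 hU.2) p V

theorem IsMinimizer.supportFn_eq {U : UncertaintyModel S} {p q : PMF S} {V : S → ℝ}
    (h : IsMinimizer U p V q) : supportFn U p V = ev q V :=
  supportFn_eq_of_isLeast h.1 h.2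

theorem supportFn_contamination [Nonempty S] {δ : ℝ} (h0 : 0 ≤ δ) (h1 : δ < 1) (p : PMF S)
    (V : S → ℝ) :
    supportFn (.contamination δ) p V = (1 - δ) * ev p V + δ * ⨅ y, V y := by
  obtain ⟨q, hq, h⟩ := isMinimizer_contamination h0 h1 p V
  rw [hq.supportFn_eq, h]

theorem supportFn_le [Nonempty S] {U : UncertaintyModel S} (hU : Admissible U) {p q : PMF S}
    (hq : q ∈ U.ball p) (V : S → ℝ) : supportFn U p V ≤ ev q V := by
  obtain ⟨q₀, h₀⟩ := exists_isMinimizer hU p V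
  rw [h₀.supportFn_eq]; exact h₀.2 q hq

theorem iInf_le_supportFn [Nonempty S] {U : UncertaintyModel S} (hU : Admissible U) (p : PMF S)
    (V : S → ℝ) : ⨅ y, V y ≤ supportFn U p V := by
  obtain ⟨q, h⟩ := exists_isMinimizer hU p V
  rw [h.supportFn_eq]; exact le_ev_of_forall_le fun x => iInf_fin_le V x

theorem supportFn_le_iSup [Nonempty S] {U : UncertaintyModel S} (hU : Admissible U) (p : PMF S)
    (V : S → ℝ) : supportFn U p V ≤ ⨆ y, V y := by
  obtain ⟨q, h⟩ := exists_isMinimizer hU p V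
  rw [h.supportFn_eq]; exact ev_le_of_forall_le fun x => le_iSup_fin V x

/-- Replacing the centre of a transport ball changes the support function by at most the distance
of the centres times the span. -/
theorem supportFn_le_add [Nonempty S] {U : UncertaintyModel S} {w : S → S → ℝ} {κ : ℝ}
    (hU : IsTransportBall U w κ) (p p' : PMF S) (V : S → ℝ) :
    supportFn U p' V ≤ supportFn U p V + tvDist p' p * spanSeminorm V := by
  classical
  obtain ⟨q, hq⟩ := exists_isMinimizer_of_transport hU p V
  obtain ⟨q₁, hq₁⟩ := exists_isMinimizer_of_transport hU p' V
  rw [hq.supportFn_eq, hq₁.supportFn_eq]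
  obtain ⟨hκ, hw0, hww, hb⟩ := hU
  obtain ⟨c, h1, h2, h3⟩ := (hb _ _).1 hq.1
  set m : S → ℝ := fun x => min (p' x).toReal (p x).toReal with hm
  -- An optimal plan from `p` is turned into a plan from `p'`: row `x` is scaled down to the common
  -- mass `min (p' x) (p x)`, and the excess of `p'` stays where it is at zero cost. The cost cannot
  -- increase.
  set θ : S → ℝ := fun x => m x / (p x).toReal with hθ
  have hp0 : ∀ x, 0 ≤ (p x).toReal := fun x => ENNReal.toReal_nonneg
  have hp0' : ∀ x, 0 ≤ (p' x).toReal := fun x => ENNReal.toReal_nonneg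
  have hm0 : ∀ x, 0 ≤ m x := fun x => le_min (hp0' x) (hp0 x)
  have hθ0 : ∀ x, 0 ≤ θ x := fun x => div_nonneg (hm0 x) (hp0 x)
  have hθ1 : ∀ x, θ x ≤ 1 := fun x => div_le_one_of_le₀ (min_le_right _ _) (hp0 x)
  have hθm : ∀ x, θ x * (p x).toReal = m x := by
    intro x
    rcases eq_or_ne (p x).toReal 0 with h | h
    · have : m x = 0 := le_antisymm (h ▸ min_le_right _ _) (hm0 x)
      rw [h, this, mul_zero]
    · exact div_mul_cancel₀ _ h
  set e : S → ℝ := fun x => (p' x).toReal - m x with he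
  have he0 : ∀ x, 0 ≤ e x := fun x => sub_nonneg.2 (min_le_left _ _)
  set c' : S → S → ℝ := fun x y => θ x * c x y + if x = y then e x else 0 with hc'
  have h1' : IsPlan (fun x => (p' x).toReal) c' := by
    refine ⟨fun x y => ?_, fun x => ?_⟩
    · have := mul_nonneg (hθ0 x) (h1.1 x y)
      have := he0 x
      simp only [hc']; positivity
    · simp only [hc', Finset.sum_add_distrib, ← Finset.mul_sum, h1.2, hθm]
      simp [he]
  have h0' : ∀ y, 0 ≤ ∑ x, c' x y := fun y => Finset.sum_nonneg fun x _ => h1'.1 x y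
  set q' : PMF S := ofWeights _ h0' (sum_plan_right h1') with hq'
  have hq'b : q' ∈ U.ball p' := by
    refine (hb _ _).2 ⟨c', h1', fun y => ?_, ?_⟩
    · rw [hq', toReal_ofWeights]
    · refine le_trans (Finset.sum_le_sum fun x _ => Finset.sum_le_sum fun y _ => ?_) h3
      simp only [hc']
      split_ifs with hxy
      · subst hxy; simp [hww]
      · rw [add_zero]
        exact mul_le_mul_of_nonneg_right (mul_le_of_le_one_left (h1.1 x y) (hθ1 x)) (hw0 x y)
  refine (hq₁.2 q' hq'b).trans ?_
  -- Shifting `V` to be nonnegative makes the scaling by `θ ≤ 1` harmless; the excess mass, of total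
  -- `tvDist p' p`, then contributes at most the span per unit.
  set v := ⨅ y, V y with hv
  have hV0 : ∀ y, 0 ≤ V y - v := fun y => sub_nonneg.2 (iInf_fin_le V y)
  have hV1 : ∀ y, V y - v ≤ spanSeminorm V := fun y => sub_le_sub_right (le_iSup_fin V y) _
  have key : ev q' (fun y => V y - v) ≤ ev q (fun y => V y - v) + tvDist p' p * spanSeminorm V := by
    rw [← sum_sub_min, Finset.sum_mul]
    simp only [ev, hq', toReal_ofWeights, ← h2]
    rw [← Finset.sum_add_distrib]
    refine Finset.sum_le_sum fun y _ => ?_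
    simp only [hc', Finset.sum_add_distrib, add_mul]
    refine add_le_add (mul_le_mul_of_nonneg_right (Finset.sum_le_sum fun x _ =>
      mul_le_of_le_one_left (h1.1 x y) (hθ1 x)) (hV0 y)) ?_
    simp only [Finset.sum_ite_eq', Finset.mem_univ, if_true]
    exact mul_le_mul_of_nonneg_left (hV1 y) (he0 y)
  rw [ev_sub, ev_sub, ev_const, ev_const] at key
  linarith

theorem abs_supportFn_sub_le [Nonempty S] {U : UncertaintyModel S} {w : S → S → ℝ} {κ : ℝ}
    (hU : IsTransportBall U w κ) (p p' : PMF S) (V : S → ℝ) :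
    |supportFn U p' V - supportFn U p V| ≤ tvDist p' p * spanSeminorm V := by
  rw [abs_le]
  have h1 := supportFn_le_add hU p p' V
  have h2 := supportFn_le_add hU p' p V
  rw [tvDist_comm] at h2
  constructor <;> linarith

end Simplex

/-! ### Stochastic matrices -/

section Stochastic

variable {S : Type u} [Fintype S]

/-- Row-stochastic matrices. -/
def IsStoch (Q : Matrix S S ℝ) : Prop := (∀ i j, 0 ≤ Q i j) ∧ ∀ i, ∑ j, Q i j = 1

theorem mulVec_le_of_le {Q : Matrix S S ℝ} (hQ : IsStoch Q) {x : S → ℝ} {c : ℝ} (h : ∀ j, x j ≤ c)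
    (i : S) : Q.mulVec x i ≤ c := by
  calc ∑ j, Q i j * x j ≤ ∑ j, Q i j * c :=
        Finset.sum_le_sum fun j _ => mul_le_mul_of_nonneg_left (h j) (hQ.1 i j)
    _ = c := by rw [← Finset.sum_mul, hQ.2, one_mul]

theorem le_mulVec_of_le {Q : Matrix S S ℝ} (hQ : IsStoch Q) {x : S → ℝ} {c : ℝ} (h : ∀ j, c ≤ x j)
    (i : S) : c ≤ Q.mulVec x i := by
  calc c = ∑ j, Q i j * c := by rw [← Finset.sum_mul, hQ.2, one_mul]
    _ ≤ ∑ j, Q i j * x j :=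
        Finset.sum_le_sum fun j _ => mul_le_mul_of_nonneg_left (h j) (hQ.1 i j)

theorem mulVec_const {Q : Matrix S S ℝ} (hQ : IsStoch Q) (c : ℝ) :
    Q.mulVec (fun _ => c) = fun _ => c := by
  funext i
  exact le_antisymm (mulVec_le_of_le hQ (fun _ => le_rfl) i) (le_mulVec_of_le hQ (fun _ => le_rfl) i)

theorem mulVec_mono {Q : Matrix S S ℝ} (hQ : IsStoch Q) {x y : S → ℝ} (h : ∀ j, x j ≤ y j) (i : S) :
    Q.mulVec x i ≤ Q.mulVec y i :=
  Finset.sum_le_sum fun j _ => mul_le_mul_of_nonneg_left (h j) (hQ.1 i j)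

theorem IsStoch.mul {Q R : Matrix S S ℝ} (hQ : IsStoch Q) (hR : IsStoch R) : IsStoch (Q * R) := by
  refine ⟨fun i j => Finset.sum_nonneg fun k _ => mul_nonneg (hQ.1 i k) (hR.1 k j), fun i => ?_⟩
  simp only [Matrix.mul_apply]
  rw [Finset.sum_comm]
  simp only [← Finset.mul_sum, hR.2, mul_one, hQ.2]

theorem isStoch_one [DecidableEq S] : IsStoch (1 : Matrix S S ℝ) := by
  refine ⟨fun i j => ?_, fun i => ?_⟩
  · rw [Matrix.one_apply]; positivity
  · simp [Matrix.one_apply]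

theorem isStoch_list_prod [DecidableEq S] {l : List (Matrix S S ℝ)} (h : ∀ Q ∈ l, IsStoch Q) :
    IsStoch l.prod := by
  induction l with
  | nil => exact isStoch_one
  | cons Q l ih =>
    rw [List.prod_cons]
    exact (h Q (by simp)).mul (ih fun R hR => h R (by simp [hR]))

theorem IsStoch.pow [DecidableEq S] {Q : Matrix S S ℝ} (hQ : IsStoch Q) (k : ℕ) :
    IsStoch (Q ^ k) := by
  rw [← List.prod_replicate]
  exact isStoch_list_prod fun R hR => (List.eq_of_mem_replicate hR) ▸ hQ

/-- The family is closed under row-wise convex combinations. -/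
def RowConvex (F : Set (Matrix S S ℝ)) : Prop :=
  ∀ Q ∈ F, ∀ R ∈ F, ∀ θ : S → ℝ, (∀ i, 0 ≤ θ i ∧ θ i ≤ 1) →
    (Matrix.of fun i j => θ i * Q i j + (1 - θ i) * R i j) ∈ F

theorem isStoch_convex {Q R : Matrix S S ℝ} (hQ : IsStoch Q) (hR : IsStoch R) {θ : S → ℝ}
    (hθ : ∀ i, 0 ≤ θ i ∧ θ i ≤ 1) :
    IsStoch (Matrix.of fun i j => θ i * Q i j + (1 - θ i) * R i j) := by
  refine ⟨fun i j => add_nonneg (mul_nonneg (hθ i).1 (hQ.1 i j))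
    (mul_nonneg (sub_nonneg.2 (hθ i).2) (hR.1 i j)), fun i => ?_⟩
  simp only [Matrix.of_apply]
  rw [Finset.sum_add_distrib, ← Finset.mul_sum, ← Finset.mul_sum, hQ.2, hR.2]; ring

/-- Stochastic matrices dominating a multiple of `P`. -/
def dominatingFamily (P : Matrix S S ℝ) (c : ℝ) : Set (Matrix S S ℝ) :=
  {Q | IsStoch Q ∧ ∀ i j, c * P i j ≤ Q i j}

/-- Stochastic matrices whose rows are close to those of `P`. -/
def tvFamily (P : Matrix S S ℝ) (δ : ℝ) : Set (Matrix S S ℝ) :=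
  {Q | IsStoch Q ∧ ∀ i, ∑ j, |Q i j - P i j| ≤ 2 * δ}

theorem rowConvex_dominatingFamily (P : Matrix S S ℝ) (c : ℝ) : RowConvex (dominatingFamily P c) := by
  intro Q hQ R hR θ hθ
  refine ⟨isStoch_convex hQ.1 hR.1 hθ, fun i j => ?_⟩
  simp only [Matrix.of_apply]
  have h1 := mul_le_mul_of_nonneg_left (hQ.2 i j) (hθ i).1
  have h2 := mul_le_mul_of_nonneg_left (hR.2 i j) (sub_nonneg.2 (hθ i).2)
  linarith

theorem rowConvex_tvFamily (P : Matrix S S ℝ) (δ : ℝ) : RowConvex (tvFamily P δ) := by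
  intro Q hQ R hR θ hθ
  refine ⟨isStoch_convex hQ.1 hR.1 hθ, fun i => ?_⟩
  have h0 := (hθ i).1
  have h1 := sub_nonneg.2 (hθ i).2
  calc ∑ j, |θ i * Q i j + (1 - θ i) * R i j - P i j|
      ≤ ∑ j, (θ i * |Q i j - P i j| + (1 - θ i) * |R i j - P i j|) := by
        refine Finset.sum_le_sum fun j _ => ?_
        have : θ i * Q i j + (1 - θ i) * R i j - P i j =
          θ i * (Q i j - P i j) + (1 - θ i) * (R i j - P i j) := by ring
        rw [this]
        refine (abs_add_le _ _).trans ?_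
        rw [abs_mul, abs_mul, abs_of_nonneg h0, abs_of_nonneg h1]
    _ ≤ 2 * δ := by
        rw [Finset.sum_add_distrib, ← Finset.mul_sum, ← Finset.mul_sum]
        have := mul_le_mul_of_nonneg_left (hQ.2 i) h0
        have := mul_le_mul_of_nonneg_left (hR.2 i) h1
        linarith

/-- An irreducible aperiodic chain has a strictly positive power. -/
theorem exists_pow_pos_of_ergodic [DecidableEq S] {P : Matrix S S ℝ} (hP : IsStoch P)
    (hirr : P.IsIrreducible) (hap : IsAperiodic P) : ∃ m : ℕ, 1 ≤ m ∧ ∀ i j, 0 < (P ^ m) i j := by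
  have hmul : ∀ (a b : ℕ) (i j k : S), 0 < (P ^ a) i j → 0 < (P ^ b) j k → 0 < (P ^ (a + b)) i k := by
    intro a b i j k h1 h2
    rw [pow_add, Matrix.mul_apply]
    refine lt_of_lt_of_le (mul_pos h1 h2) (Finset.single_le_sum
      (f := fun l => (P ^ a) i l * (P ^ b) l k)
      (fun l _ => mul_nonneg ((hP.pow a).1 i l) ((hP.pow b).1 l k)) (Finset.mem_univ j))
  have hret : ∀ i, ∃ n, ∀ k ≥ n, 0 < (P ^ k) i i := by
    intro i
    -- The return times form an additive submonoid, and aperiodicity says that their greatest common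
    -- divisor is `1`; such a submonoid contains all large integers.
    let R : AddSubmonoid ℕ :=
      { carrier := {n | 0 < (P ^ n) i i}
        zero_mem' := by simp
        add_mem' := fun {a b} ha hb => hmul a b i i i ha hb }
    obtain ⟨n, hn⟩ := Nat.exists_mem_closure_of_ge (s := (R : Set ℕ))
    have h1 : Nat.setGcd (R : Set ℕ) = 1 :=
      hap i _ fun k _ hk => Nat.setGcd_dvd_of_mem hk
    refine ⟨n, fun k hk => ?_⟩
    have := hn k hk (h1 ▸ one_dvd k)
    rwa [AddSubmonoid.closure_eq] at this
  choose n hn using hret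
  rw [Matrix.isIrreducible_iff_exists_pow_pos hP.1] at hirr
  choose k hk0 hk using hirr
  -- One exponent for all pairs: go from `i` to `j` in `k i j` steps and spend the rest, which is at
  -- least `n j`, on a loop at `j`. The final `1` ensures a positive exponent.
  refine ⟨∑ j, n j + ∑ i, ∑ j, k i j + 1, by omega, fun i j => ?_⟩
  have h1 : n j ≤ ∑ j, n j := Finset.single_le_sum (fun _ _ => Nat.zero_le _) (Finset.mem_univ j)
  have h2 : k i j ≤ ∑ i, ∑ j, k i j :=
    (Finset.single_le_sum (f := fun j => k i j) (fun _ _ => Nat.zero_le _) (Finset.mem_univ j)).trans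
      (Finset.single_le_sum (f := fun i => ∑ j, k i j) (fun _ _ => Nat.zero_le _) (Finset.mem_univ i))
  have h3 : ∑ j, n j + ∑ i, ∑ j, k i j + 1 = k i j + (∑ j, n j + ∑ i, ∑ j, k i j + 1 - k i j) := by
    omega
  rw [h3]
  exact hmul _ _ i j j (hk i j) (hn j _ (by omega))

theorem vecMul_dirac [DecidableEq S] (K : Matrix S S ℝ) (i j : S) :
    Matrix.vecMul (fun s => if s = i then 1 else 0) K j = K i j := by
  simp [Matrix.vecMul, dotProduct]

theorem dirac_mem_stdSimplex [DecidableEq S] (i : S) :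
    (fun s => if s = i then (1 : ℝ) else 0) ∈ stdSimplex ℝ S :=
  ⟨fun s => by positivity, by simp⟩

variable [Nonempty S]

theorem span_mulVec_le {Q : Matrix S S ℝ} (hQ : IsStoch Q) (x : S → ℝ) :
    spanSeminorm (Q.mulVec x) ≤ spanSeminorm x :=
  span_le_iff.2 fun i j => sub_le_sub (mulVec_le_of_le hQ (le_iSup_fin x) i)
    (le_mulVec_of_le hQ (iInf_fin_le x) j)

/-- Every row gives weight at least `ε` to a state where `x` is minimal, which lowers every average
by `ε` times the span below the maximum, while no average falls below the minimum. -/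
theorem span_mulVec_le_of_pos {Q : Matrix S S ℝ} (hQ : IsStoch Q) {ε : ℝ}
    (h : ∀ i j, ε ≤ Q i j) (x : S → ℝ) :
    spanSeminorm (Q.mulVec x) ≤ (1 - ε) * spanSeminorm x := by
  classical
  obtain ⟨k, hk⟩ := exists_iInf_eq x
  refine span_le_iff.2 fun i j => ?_
  have h1 := le_mulVec_of_le hQ (iInf_fin_le x) j
  have h2 : Q.mulVec x i ≤ (⨆ s, x s) - ε * spanSeminorm x := by
    have h3 : ∀ s, Q i s * x s ≤ Q i s * (⨆ s, x s) - if s = k then ε * spanSeminorm x else 0 := by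
      intro s
      split_ifs with hs
      · subst hs
        rw [hk]
        have := h i s
        have h0 := span_nonneg x
        have : ε * spanSeminorm x ≤ Q i s * spanSeminorm x := by gcongr
        unfold spanSeminorm at *
        linarith
      · rw [sub_zero]
        exact mul_le_mul_of_nonneg_left (le_iSup_fin x s) (hQ.1 i s)
    calc Q.mulVec x i = ∑ s, Q i s * x s := rfl
      _ ≤ _ := Finset.sum_le_sum fun s _ => h3 s
      _ = _ := by
        rw [Finset.sum_sub_distrib, ← Finset.sum_mul, hQ.2]; simp
  unfold spanSeminorm at *
  linarith

/-! ### Scrambling families -/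

/-- All products of `m` members of the family have entries bounded below. -/
def Scrambling [DecidableEq S] (F : Set (Matrix S S ℝ)) : Prop :=
  ∃ m : ℕ, 1 ≤ m ∧ ∃ ε : ℝ, 0 < ε ∧ ∀ l : List (Matrix S S ℝ), l.length = m → (∀ Q ∈ l, Q ∈ F) →
    ∀ i j, ε ≤ l.prod i j

theorem exists_pos_le_of_finite (f : S → S → ℝ) (h : ∀ i j, 0 < f i j) :
    ∃ ε : ℝ, 0 < ε ∧ ∀ i j, ε ≤ f i j := by
  obtain ⟨z, hz⟩ := Finite.exists_min fun z : S × S => f z.1 z.2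
  exact ⟨_, h z.1 z.2, fun i j => hz (i, j)⟩

/-- Entrywise domination multiplies along products of nonnegative matrices: a product of `m` members
dominates `c ^ m * P ^ m`. -/
theorem scrambling_dominatingFamily [DecidableEq S] {P : Matrix S S ℝ} (hP : IsStoch P) {c : ℝ}
    (hc : 0 < c) {m : ℕ} (hm : 1 ≤ m) (h : ∀ i j, 0 < (P ^ m) i j) :
    Scrambling (dominatingFamily P c) := by
  have key : ∀ l : List (Matrix S S ℝ), (∀ Q ∈ l, Q ∈ dominatingFamily P c) →
      ∀ i j, c ^ l.length * (P ^ l.length) i j ≤ l.prod i j := by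
    intro l
    induction l with
    | nil => intro _ i j; simp
    | cons Q l ih =>
      intro hl i j
      have hQ := hl Q (by simp)
      have hl' : ∀ R ∈ l, R ∈ dominatingFamily P c := fun R hR => hl R (by simp [hR])
      rw [List.prod_cons, List.length_cons, pow_succ', pow_succ', Matrix.mul_apply, Matrix.mul_apply,
        Finset.mul_sum]
      refine Finset.sum_le_sum fun k _ => ?_
      calc c * c ^ l.length * (P i k * (P ^ l.length) k j)
          = (c * P i k) * (c ^ l.length * (P ^ l.length) k j) := by ring
        _ ≤ Q i k * l.prod k j := by
          refine mul_le_mul (hQ.2 i k) (ih hl' k j) ?_ (hQ.1.1 i k)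
          exact mul_nonneg (pow_nonneg hc.le _) ((hP.pow _).1 k j)
  obtain ⟨ε, hε, hle⟩ := exists_pos_le_of_finite _ h
  refine ⟨m, hm, c ^ m * ε, by positivity, fun l hlen hl i j => ?_⟩
  refine le_trans ?_ (key l hl i j)
  rw [hlen]
  have := hle i j
  gcongr

/-- Replacing the factors one at a time shows that a product of `m` members is within `2 m δ` of `P
^ m` in `ℓ¹`, row by row. Row differences sum to zero, so a single entry moves by at most half of
this, `m δ`, and stays positive. -/
theorem scrambling_tvFamily [DecidableEq S] {P : Matrix S S ℝ} (hP : IsStoch P) {δ : ℝ} {m : ℕ}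
    (hm : 1 ≤ m) (h : ∀ i j, δ < (P ^ m) i j / m) : Scrambling (tvFamily P δ) := by
  have key : ∀ l : List (Matrix S S ℝ), (∀ Q ∈ l, Q ∈ tvFamily P δ) →
      ∀ i, ∑ j, |l.prod i j - (P ^ l.length) i j| ≤ 2 * (l.length * δ) := by
    intro l
    induction l with
    | nil => intro _ i; simp
    | cons Q l ih =>
      intro hl i
      have hQ := hl Q (by simp)
      have hl' : ∀ R ∈ l, R ∈ tvFamily P δ := fun R hR => hl R (by simp [hR])
      have hs : IsStoch l.prod := isStoch_list_prod fun R hR => (hl' R hR).1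
      rw [List.prod_cons, List.length_cons, pow_succ']
      have h1 : ∀ j, |(Q * l.prod) i j - (P * P ^ l.length) i j| ≤
          ∑ k, (|Q i k - P i k| * l.prod k j + P i k * |l.prod k j - (P ^ l.length) k j|) := by
        intro j
        rw [Matrix.mul_apply, Matrix.mul_apply, ← Finset.sum_sub_distrib]
        refine (Finset.abs_sum_le_sum_abs _ _).trans (Finset.sum_le_sum fun k _ => ?_)
        have : Q i k * l.prod k j - P i k * (P ^ l.length) k j =
          (Q i k - P i k) * l.prod k j + P i k * (l.prod k j - (P ^ l.length) k j) := by ring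
        rw [this]
        refine (abs_add_le _ _).trans ?_
        rw [abs_mul, abs_mul, abs_of_nonneg (hs.1 k j), abs_of_nonneg (hP.1 i k)]
      refine (Finset.sum_le_sum fun j _ => h1 j).trans ?_
      rw [Finset.sum_comm]
      have h2 : ∀ k, ∑ j, (|Q i k - P i k| * l.prod k j +
          P i k * |l.prod k j - (P ^ l.length) k j|) ≤
          |Q i k - P i k| + P i k * (2 * (l.length * δ)) := by
        intro k
        rw [Finset.sum_add_distrib, ← Finset.mul_sum, ← Finset.mul_sum, hs.2, mul_one]
        have := mul_le_mul_of_nonneg_left (ih hl' k) (hP.1 i k)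
        linarith
      refine (Finset.sum_le_sum fun k _ => h2 k).trans ?_
      rw [Finset.sum_add_distrib, ← Finset.sum_mul, hP.2]
      have := hQ.2 i
      push_cast; linarith
  have hm0 : (0 : ℝ) < m := by exact_mod_cast hm
  obtain ⟨ε, hε, hle⟩ := exists_pos_le_of_finite (fun i j => (P ^ m) i j - m * δ) fun i j => by
    have := (lt_div_iff₀ hm0).1 (h i j); linarith
  refine ⟨m, hm, ε, hε, fun l hlen hl i j => ?_⟩
  have hs : IsStoch l.prod := isStoch_list_prod fun R hR => (hl R hR).1
  have h1 := key l hl i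
  rw [hlen] at h1
  have h2 : ∑ k, (l.prod i k - (P ^ m) i k) = 0 := by
    rw [Finset.sum_sub_distrib, hs.2, (hP.pow m).2, sub_self]
  rw [← Finset.add_sum_erase _ _ (Finset.mem_univ j)] at h1 h2
  have h3 := Finset.abs_sum_le_sum_abs (fun k => l.prod i k - (P ^ m) i k) (Finset.univ.erase j)
  have h4 : l.prod i j - (P ^ m) i j =
      -∑ k ∈ Finset.univ.erase j, (l.prod i k - (P ^ m) i k) := by linarith
  have h5 : |l.prod i j - (P ^ m) i j| ≤ m * δ := by
    have : |l.prod i j - (P ^ m) i j| ≤ ∑ k ∈ Finset.univ.erase j, |l.prod i k - (P ^ m) i k| := by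
      rw [h4, abs_neg]; exact h3
    linarith
  have := (abs_le.1 h5).1
  have := hle i j
  linarith

/-- Products of members of a scrambling family contract the span geometrically. -/
theorem Scrambling.exists_span_le [DecidableEq S] {F : Set (Matrix S S ℝ)} (hF : Scrambling F)
    (hs : ∀ Q ∈ F, IsStoch Q) : ∃ C γ : ℝ, 0 < C ∧ 0 < γ ∧ γ < 1 ∧ ∀ l : List (Matrix S S ℝ),
      (∀ Q ∈ l, Q ∈ F) → ∀ x, spanSeminorm (l.prod.mulVec x) ≤ C * γ ^ l.length * spanSeminorm x := by
  obtain ⟨m, hm, ε, hε, h⟩ := hF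
  -- Each block of `m` factors contracts the span by `ρ`, where the cap at `1 / 2` keeps `ρ`
  -- positive. The rate per factor is `ρ ^ (1 / m)`, and the constant `ρ⁻¹` pays for an incomplete
  -- block.
  set ρ : ℝ := 1 - min ε (1 / 2) with hρ
  have hρ0 : 0 < ρ := by have := min_le_right ε (1 / 2 : ℝ); linarith
  have hρ1 : ρ < 1 := by have : 0 < min ε (1 / 2 : ℝ) := lt_min hε (by norm_num); linarith
  have hm0 : (m : ℝ) ≠ 0 := by positivity
  have hγ0 : 0 < ρ ^ (1 / (m : ℝ)) := Real.rpow_pos_of_pos hρ0 _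
  have hγ1 : ρ ^ (1 / (m : ℝ)) < 1 := Real.rpow_lt_one hρ0.le hρ1 (by positivity)
  have hγm : (ρ ^ (1 / (m : ℝ))) ^ m = ρ := by
    rw [← Real.rpow_natCast, ← Real.rpow_mul hρ0.le, one_div_mul_cancel hm0, Real.rpow_one]
  set γ := ρ ^ (1 / (m : ℝ))
  refine ⟨ρ⁻¹, γ, by positivity, hγ0, hγ1, ?_⟩
  have key : ∀ n, ∀ l : List (Matrix S S ℝ), l.length ≤ n → (∀ Q ∈ l, Q ∈ F) → ∀ x,
      spanSeminorm (l.prod.mulVec x) ≤ ρ⁻¹ * γ ^ l.length * spanSeminorm x := by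
    intro n
    induction n with
    | zero =>
      intro l hl _ x
      obtain rfl := List.length_eq_zero_iff.1 (Nat.le_zero.1 hl)
      simp only [List.prod_nil, Matrix.one_mulVec, List.length_nil, pow_zero, mul_one]
      exact le_mul_of_one_le_left (span_nonneg x) ((one_le_inv₀ hρ0).2 hρ1.le)
    | succ n ih =>
      intro l hl hlF x
      have h0 := span_nonneg x
      rcases lt_or_ge l.length m with hlt | hge
      · refine (span_mulVec_le (isStoch_list_prod fun Q hQ => hs Q (hlF Q hQ)) x).trans ?_
        refine le_mul_of_one_le_left h0 ?_
        rw [inv_mul_eq_div, one_le_div hρ0, ← hγm]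
        exact pow_le_pow_of_le_one hγ0.le hγ1.le hlt.le
      · have hlen : (l.take m).length = m := by simp [hge]
        have hF1 : ∀ Q ∈ l.take m, Q ∈ F := fun Q hQ => hlF Q (List.mem_of_mem_take hQ)
        have hF2 : ∀ Q ∈ l.drop m, Q ∈ F := fun Q hQ => hlF Q (List.mem_of_mem_drop hQ)
        have h1 := span_mulVec_le_of_pos
          (isStoch_list_prod fun Q hQ => hs Q (hF1 Q hQ)) (ε := min ε (1 / 2))
          (fun i j => (min_le_left _ _).trans (h _ hlen hF1 i j)) ((l.drop m).prod.mulVec x)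
        have h2 := ih (l.drop m) (by rw [List.length_drop]; omega) hF2 x
        rw [← List.prod_take_mul_prod_drop l m, ← Matrix.mulVec_mulVec]
        refine h1.trans ((mul_le_mul_of_nonneg_left h2 hρ0.le).trans_eq ?_)
        rw [List.length_drop]
        have h3 : γ ^ l.length = ρ * γ ^ (l.length - m) := by
          rw [← hγm, ← pow_add]; congr 1; omega
        rw [h3]; ring
  exact fun l => key _ l le_rfl

/-- A semi-norm contracted by every member of a scrambling family. -/
theorem Scrambling.exists_seminorm [DecidableEq S] {F : Set (Matrix S S ℝ)} (hF : Scrambling F)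
    (hs : ∀ Q ∈ F, IsStoch Q) : ∃ (N : Seminorm ℝ (S → ℝ)) (γ : ℝ), 0 < γ ∧ γ < 1 ∧
      (∀ x, spanSeminorm x ≤ N x) ∧ (∀ c : ℝ, N (fun _ => c) = 0) ∧
      ∀ Q ∈ F, ∀ x, N (Q.mulVec x) ≤ γ * N x := by
  obtain ⟨C, γ, hC, hγ0, hγ1, h⟩ := hF.exists_span_le hs
  let I := {l : List (Matrix S S ℝ) // ∀ Q ∈ l, Q ∈ F}
  -- The semi-norm is the supremum of these rescaled spans over all finite products. It is finite by
  -- the geometric bound and dominates the span through the empty product; applying `Q` first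
  -- appends `Q` to the product and gains one factor `γ`.
  let f : I → (S → ℝ) → ℝ := fun l x => (γ ^ l.1.length)⁻¹ * spanSeminorm (l.1.prod.mulVec x)
  have hf : ∀ l x, f l x ≤ C * spanSeminorm x := by
    intro l x
    have h1 := h l.1 l.2 x
    have hp : 0 < γ ^ l.1.length := by positivity
    show (γ ^ l.1.length)⁻¹ * _ ≤ _
    rw [inv_mul_le_iff₀ hp]
    linarith
  have hb : ∀ x, BddAbove (Set.range fun l => f l x) := fun x => ⟨_, by
    rintro _ ⟨l, rfl⟩; exact hf l x⟩
  have : Nonempty I := ⟨⟨[], by simp⟩⟩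
  have hsm : ∀ (a : ℝ) l x, f l (a • x) = |a| * f l x := by
    intro a l x
    simp only [f, Matrix.mulVec_smul]
    rw [← spanS_apply, ← spanS_apply, map_smul_eq_mul, Real.norm_eq_abs]; ring
  let N : Seminorm ℝ (S → ℝ) := Seminorm.of (fun x => ⨆ l, f l x)
    (fun x y => ciSup_le fun l => by
      have h1 : f l (x + y) ≤ f l x + f l y := by
        simp only [f, Matrix.mulVec_add, ← mul_add]
        refine mul_le_mul_of_nonneg_left ?_ (by positivity)
        exact map_add_le_add (spanS S) _ _
      have h2 := le_ciSup (hb x) l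
      have h3 := le_ciSup (hb y) l
      linarith)
    (fun a x => by
      simp only [hsm, Real.norm_eq_abs]
      exact (Real.mul_iSup_of_nonneg (abs_nonneg a) _).symm)
  have hN : ∀ x, N x = ⨆ l, f l x := fun x => rfl
  refine ⟨N, γ, hγ0, hγ1, fun x => ?_, fun c => ?_, fun Q hQ x => ?_⟩
  · rw [hN]
    refine le_trans ?_ (le_ciSup (hb x) ⟨[], by simp⟩)
    simp [f]
  · refine le_antisymm ?_ (apply_nonneg N _)
    rw [hN]
    exact ciSup_le fun l => (hf l _).trans (by rw [span_const, mul_zero])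
  · rw [hN, hN]
    refine ciSup_le fun l => ?_
    have hl : ∀ R ∈ l.1 ++ [Q], R ∈ F := by
      intro R hR
      rcases List.mem_append.1 hR with h | h
      · exact l.2 R h
      · rw [List.mem_singleton.1 h]; exact hQ
    have h1 := le_ciSup (hb x) ⟨l.1 ++ [Q], hl⟩
    have h2 : f l (Q.mulVec x) = γ * f ⟨l.1 ++ [Q], hl⟩ x := by
      simp only [f, List.prod_append, List.prod_singleton, List.length_append, List.length_singleton,
        Matrix.mulVec_mulVec, pow_succ, mul_inv]
      field_simp
    rw [h2]
    exact mul_le_mul_of_nonneg_left h1 hγ0.le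

/-! ### Mixing -/

/-- Geometric span contraction gives convergence to an invariant law. -/
theorem exists_invariant_of_span_le [DecidableEq S] {K : Matrix S S ℝ} (hK : IsStoch K) {C γ : ℝ}
    (hC : 0 < C) (hγ0 : 0 < γ) (hγ1 : γ < 1)
    (h : ∀ (k : ℕ) x, spanSeminorm ((K ^ k).mulVec x) ≤ C * γ ^ k * spanSeminorm x) :
    ∃ ν ∈ stdSimplex ℝ S, Matrix.vecMul ν K = ν ∧ ∀ (t : ℕ), ∀ μ ∈ stdSimplex ℝ S,
      ∑ s, |Matrix.vecMul μ (K ^ t) s - ν s| ≤ Fintype.card S * (C * γ ^ t) := by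
  obtain ⟨i₀⟩ := ‹Nonempty S›
  -- Applied to the indicator of `j`, the span bound says that each column of `K ^ k` is nearly
  -- constant.
  have hcol : ∀ (k : ℕ) (i i' j : S), |(K ^ k) i j - (K ^ k) i' j| ≤ C * γ ^ k := by
    intro k i i' j
    have hle : spanSeminorm (fun s => if s = j then (1 : ℝ) else 0) ≤ 1 :=
      span_le_iff.2 fun a b => by split_ifs <;> norm_num
    have h1 := h k (fun s => if s = j then 1 else 0)
    have h2 := (abs_sub_le_span ((K ^ k).mulVec fun s => if s = j then (1 : ℝ) else 0) i i').trans h1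
    simp only [Matrix.mulVec, dotProduct, mul_ite, mul_one, mul_zero, Finset.sum_ite_eq',
      Finset.mem_univ, if_true] at h2
    exact h2.trans (mul_le_of_le_one_right (by positivity) hle)
  -- Row `i₀` of `K ^ (k + t)` is an average of rows of `K ^ t`. The bound is uniform in `k`: with
  -- `t` fixed and `k → ∞` it becomes the rate of convergence to the limit law.
  have havg : ∀ (t k : ℕ) (μ : S → ℝ), μ ∈ stdSimplex ℝ S → ∀ j,
      |Matrix.vecMul μ (K ^ t) j - (K ^ (k + t)) i₀ j| ≤ C * γ ^ t := by
    intro t k μ hμ j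
    have h1 : ∀ i, |(K ^ t) i j - (K ^ (k + t)) i₀ j| ≤ C * γ ^ t := by
      intro i
      have h2 : (K ^ t) i j - (K ^ (k + t)) i₀ j =
          ∑ s, (K ^ k) i₀ s * ((K ^ t) i j - (K ^ t) s j) := by
        simp only [mul_sub, Finset.sum_sub_distrib, ← Finset.sum_mul, (hK.pow k).2, one_mul]
        rw [pow_add, Matrix.mul_apply]
      rw [h2]
      refine (Finset.abs_sum_le_sum_abs _ _).trans ?_
      calc ∑ s, |(K ^ k) i₀ s * ((K ^ t) i j - (K ^ t) s j)|
          ≤ ∑ s, (K ^ k) i₀ s * (C * γ ^ t) := by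
            refine Finset.sum_le_sum fun s _ => ?_
            rw [abs_mul, abs_of_nonneg ((hK.pow k).1 i₀ s)]
            exact mul_le_mul_of_nonneg_left (hcol t i s j) ((hK.pow k).1 i₀ s)
        _ = C * γ ^ t := by rw [← Finset.sum_mul, (hK.pow k).2, one_mul]
    have h2 : Matrix.vecMul μ (K ^ t) j - (K ^ (k + t)) i₀ j =
        ∑ i, μ i * ((K ^ t) i j - (K ^ (k + t)) i₀ j) := by
      simp only [mul_sub, Finset.sum_sub_distrib, ← Finset.sum_mul, hμ.2, one_mul]
      rfl
    rw [h2]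
    refine (Finset.abs_sum_le_sum_abs _ _).trans ?_
    calc ∑ i, |μ i * ((K ^ t) i j - (K ^ (k + t)) i₀ j)| ≤ ∑ i, μ i * (C * γ ^ t) := by
          refine Finset.sum_le_sum fun i _ => ?_
          rw [abs_mul, abs_of_nonneg (hμ.1 i)]
          exact mul_le_mul_of_nonneg_left (h1 i) (hμ.1 i)
      _ = C * γ ^ t := by rw [← Finset.sum_mul, hμ.2, one_mul]
  have hlim : ∀ j, ∃ a, Tendsto (fun n => (K ^ n) i₀ j) atTop (𝓝 a) := by
    intro j
    refine cauchySeq_tendsto_of_complete (cauchySeq_of_le_geometric γ C hγ1 fun n => ?_)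
    have h1 := havg n 1 _ (dirac_mem_stdSimplex i₀) j
    rw [vecMul_dirac] at h1
    rwa [Real.dist_eq, add_comm n 1]
  choose ν hν using hlim
  refine ⟨ν, ⟨fun j => ge_of_tendsto' (hν j) fun n => (hK.pow n).1 i₀ j, ?_⟩, ?_, ?_⟩
  · refine tendsto_nhds_unique (tendsto_finsetSum Finset.univ fun j _ => hν j) ?_
    simp only [(hK.pow _).2, tendsto_const_nhds]
  · funext j
    have h1 : Tendsto (fun n => ∑ s, (K ^ n) i₀ s * K s j) atTop (𝓝 (∑ s, ν s * K s j)) :=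
      tendsto_finsetSum Finset.univ fun s _ => (hν s).mul_const _
    have h2 : Tendsto (fun n => (K ^ (n + 1)) i₀ j) atTop (𝓝 (ν j)) :=
      (hν j).comp (tendsto_add_atTop_nat 1)
    refine tendsto_nhds_unique h1 ?_
    simpa only [pow_succ, Matrix.mul_apply] using h2
  · intro t μ hμ
    have h1 : ∀ s ∈ Finset.univ, |Matrix.vecMul μ (K ^ t) s - ν s| ≤ C * γ ^ t := by
      intro s _
      have h2 : Tendsto (fun k => (K ^ (k + t)) i₀ s) atTop (𝓝 (ν s)) :=
        (hν s).comp (tendsto_add_atTop_nat t)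
      exact le_of_tendsto' ((tendsto_const_nhds.sub h2).abs) fun k => havg t k μ hμ s
    calc _ ≤ _ := Finset.sum_le_card_nsmul _ _ _ h1
      _ = _ := by rw [nsmul_eq_mul, Finset.card_univ]

/-- Any two rows of `Q` are within `ℓ¹` distance `1`. Pairing their difference with `x` centred at
its mid-range, where it is at most half the span in absolute value, gives the factor `1 / 2`. -/
theorem span_mulVec_le_half [DecidableEq S] {Q : Matrix S S ℝ} (hQ : IsStoch Q) {ν : S → ℝ}
    (h : ∀ μ ∈ stdSimplex ℝ S, ∑ s, |Matrix.vecMul μ Q s - ν s| ≤ 1 / 2) (x : S → ℝ) :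
    spanSeminorm (Q.mulVec x) ≤ 1 / 2 * spanSeminorm x := by
  refine span_le_iff.2 fun i j => ?_
  have h1 : ∀ i, ∑ s, |Q i s - ν s| ≤ 1 / 2 := fun i => by
    have := h _ (dirac_mem_stdSimplex i)
    simpa only [vecMul_dirac] using this
  have h2 : ∑ s, |Q i s - Q j s| ≤ 1 := by
    calc ∑ s, |Q i s - Q j s| ≤ ∑ s, (|Q i s - ν s| + |Q j s - ν s|) :=
          Finset.sum_le_sum fun s _ => by
            have := abs_sub_le (Q i s) (ν s) (Q j s)
            rwa [abs_sub_comm (ν s)] at this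
      _ ≤ 1 := by rw [Finset.sum_add_distrib]; linarith [h1 i, h1 j]
  set c : ℝ := ((⨆ s, x s) + ⨅ s, x s) / 2 with hc
  have h3 : ∀ s, |x s - c| ≤ spanSeminorm x / 2 := fun s => by
    have h4 := le_iSup_fin x s
    have h5 := iInf_fin_le x s
    rw [abs_le, spanSeminorm, hc]
    constructor <;> linarith
  have h4 : Q.mulVec x i - Q.mulVec x j = ∑ s, (Q i s - Q j s) * (x s - c) := by
    simp only [mul_sub, sub_mul, Finset.sum_sub_distrib, ← Finset.sum_mul, hQ.2]
    simp only [Matrix.mulVec, dotProduct]; ring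
  rw [h4]
  refine (le_abs_self _).trans ((Finset.abs_sum_le_sum_abs _ _).trans ?_)
  calc ∑ s, |(Q i s - Q j s) * (x s - c)| ≤ ∑ s, |Q i s - Q j s| * (spanSeminorm x / 2) :=
        Finset.sum_le_sum fun s _ => by
          rw [abs_mul]; exact mul_le_mul_of_nonneg_left (h3 s) (abs_nonneg _)
    _ ≤ 1 / 2 * spanSeminorm x := by
        rw [← Finset.sum_mul]
        have := span_nonneg x
        nlinarith

end Stochastic

/-! ### Robust Bellman operators -/

section Bellman

variable {S : Type u} {A : Type v} [Fintype S] [Fintype A]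

theorem isStoch_policyMatrix (π : S → PMF A) (P : S → A → PMF S) : IsStoch (policyMatrix π P) := by
  refine ⟨fun i j => ?_, fun i => ?_⟩
  · simp only [policyMatrix, Matrix.of_apply]; positivity
  · simp only [policyMatrix, Matrix.of_apply]
    rw [Finset.sum_comm]
    simp only [← Finset.mul_sum, sum_toReal, mul_one]

theorem policyMatrix_mulVec (π : S → PMF A) (P : S → A → PMF S) (x : S → ℝ) (s : S) :
    (policyMatrix π P).mulVec x s = ∑ a, (π s a).toReal * ev (P s a) x := by
  simp only [Matrix.mulVec, dotProduct, policyMatrix, Matrix.of_apply, Finset.sum_mul, ev,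
    Finset.mul_sum, mul_assoc]
  exact Finset.sum_comm

theorem robustBellman_sub_const (M : RobustMDP S A) (π : S → PMF A) (g : ℝ) (V : S → ℝ) (s : S) :
    robustBellman M π g V s = robustBellman M π 0 V s - g := by
  simp only [robustBellman, sub_zero]
  have : ∀ a, (π s a).toReal * (M.reward s a - g + supportFn M.model (M.nominal s a) V) =
      (π s a).toReal * (M.reward s a + supportFn M.model (M.nominal s a) V) - (π s a).toReal * g :=
    fun a => by ring
  simp only [this, Finset.sum_sub_distrib, ← Finset.sum_mul, sum_toReal, one_mul]

theorem robustBellman_eq (M : RobustMDP S A) (π : S → PMF A) (V : S → ℝ) (s : S) :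
    robustBellman M π 0 V s =
      policyReward M π s + ∑ a, (π s a).toReal * supportFn M.model (M.nominal s a) V := by
  simp only [robustBellman, sub_zero, mul_add, Finset.sum_add_distrib, policyReward]

variable [DecidableEq S]

theorem admissible_of_radiusCondition {M : RobustMDP S A} {π : S → PMF A}
    (h : RadiusCondition M π) : Admissible M.model := by
  unfold RadiusCondition at h
  unfold Admissible
  cases hM : M.model <;> rw [hM] at h
  · exact h
  · exact h.1
  · exact ⟨h.1, h.2.1⟩

theorem tvFamily_of_tvDist_le {M : RobustMDP S A} (π : S → PMF A) {δ : ℝ}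
    (h : ∀ p q, q ∈ M.model.ball p → tvDist q p ≤ δ) {P : S → A → PMF S}
    (hP : P ∈ uncertaintySet M) : policyMatrix π P ∈ tvFamily (policyMatrix π M.nominal) δ := by
  refine ⟨isStoch_policyMatrix π P, fun i => ?_⟩
  have h1 : ∀ j, |policyMatrix π P i j - policyMatrix π M.nominal i j| ≤
      ∑ a, (π i a).toReal * |(P i a j).toReal - (M.nominal i a j).toReal| := by
    intro j
    simp only [policyMatrix, Matrix.of_apply, ← Finset.sum_sub_distrib, ← mul_sub]
    refine (Finset.abs_sum_le_sum_abs _ _).trans_eq (Finset.sum_congr rfl fun a _ => ?_)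
    rw [abs_mul, abs_of_nonneg ENNReal.toReal_nonneg]
  refine (Finset.sum_le_sum fun j _ => h1 j).trans ?_
  rw [Finset.sum_comm]
  simp only [← Finset.mul_sum]
  exact ev_le_of_forall_le (P := π i) fun a => by
    have := h _ _ (hP i a)
    unfold tvDist at this; linarith

variable [Nonempty S]

/-- Rectangularity: minimisers chosen separately for each state-action pair form one admissible
kernel. -/
theorem exists_minimizing_kernel (M : RobustMDP S A) (π : S → PMF A) (hU : Admissible M.model)
    (V : S → ℝ) : ∃ P ∈ uncertaintySet M,
      (∀ s, robustBellman M π 0 V s = policyReward M π s + (policyMatrix π P).mulVec V s) := by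
  choose P hP using fun s a => exists_isMinimizer hU (M.nominal s a) V
  refine ⟨P, fun s a => (hP s a).1, fun s => ?_⟩
  rw [robustBellman_eq, policyMatrix_mulVec]
  simp only [(hP _ _).supportFn_eq]

theorem robustBellman_le_of_mem (M : RobustMDP S A) (π : S → PMF A) (hU : Admissible M.model)
    {P : S → A → PMF S} (hP : P ∈ uncertaintySet M) (V : S → ℝ) (s : S) :
    robustBellman M π 0 V s ≤ policyReward M π s + (policyMatrix π P).mulVec V s := by
  rw [robustBellman_eq, policyMatrix_mulVec]
  gcongr with a _
  exact supportFn_le hU (hP s a) V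

/-- Differences of values of the robust Bellman operator are images under a member of the family. -/
theorem exists_robustBellman_sub_eq (M : RobustMDP S A) (π : S → PMF A) (hU : Admissible M.model)
    {F : Set (Matrix S S ℝ)} (hF : ∀ P ∈ uncertaintySet M, policyMatrix π P ∈ F) (hc : RowConvex F)
    (V₁ V₂ : S → ℝ) :
    ∃ Q ∈ F, robustBellman M π 0 V₁ - robustBellman M π 0 V₂ = Q.mulVec (V₁ - V₂) := by
  obtain ⟨P₁, hP₁, h₁⟩ := exists_minimizing_kernel M π hU V₁
  obtain ⟨P₂, hP₂, h₂⟩ := exists_minimizing_kernel M π hU V₂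
  -- The minimiser for one value function is a competitor for the other. Hence at each state the
  -- difference lies between the images of `V₁ - V₂` under the two kernels and is a convex
  -- combination of them, with weights depending on the state. This is why row-wise convexity of the
  -- family is required.
  have key : ∀ s, ∃ θ : ℝ, (0 ≤ θ ∧ θ ≤ 1) ∧
      robustBellman M π 0 V₁ s - robustBellman M π 0 V₂ s =
        θ * (policyMatrix π P₁).mulVec (V₁ - V₂) s +
          (1 - θ) * (policyMatrix π P₂).mulVec (V₁ - V₂) s := by
    intro s
    have h3 := robustBellman_le_of_mem M π hU hP₂ V₁ s
    have h4 := robustBellman_le_of_mem M π hU hP₁ V₂ s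
    have h5 := h₁ s
    have h6 := h₂ s
    simp only [Matrix.mulVec_sub, Pi.sub_apply]
    have hmem : robustBellman M π 0 V₁ s - robustBellman M π 0 V₂ s ∈
        Set.Icc ((policyMatrix π P₁).mulVec V₁ s - (policyMatrix π P₁).mulVec V₂ s)
          ((policyMatrix π P₂).mulVec V₁ s - (policyMatrix π P₂).mulVec V₂ s) :=
      ⟨by linarith, by linarith⟩
    rw [← segment_eq_Icc (hmem.1.trans hmem.2)] at hmem
    obtain ⟨a, b, ha, hb, hab, h⟩ := hmem
    refine ⟨a, ⟨ha, by linarith⟩, ?_⟩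
    rw [← h, ← hab, add_sub_cancel_left]; rfl
  choose θ hθ hθ2 using key
  refine ⟨_, hc _ (hF P₁ hP₁) _ (hF P₂ hP₂) θ hθ, funext fun s => ?_⟩
  rw [Pi.sub_apply, hθ2]
  simp only [Matrix.mulVec, dotProduct, Matrix.of_apply, add_mul, Finset.sum_add_distrib,
    Finset.mul_sum, mul_assoc]

/-! ### The uncertainty set gives a scrambling family -/

/-- Moving mass costs at least `D ^ l` per unit, with `D` the least distance between distinct
points. So at most `(δ / D) ^ l ≤ δ / D < b` of the mass moves; the middle inequality uses `δ / D ≤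
1` and `l ≥ 1`. -/
theorem tvDist_le_of_mem_wasserstein (d : MetricSpace S) {l δ b : ℝ} (hl : 1 ≤ l) (hδ : 0 ≤ δ)
    (hb0 : 0 < b) (hb1 : b ≤ 1) (h : ∀ x y : S, x ≠ y → δ < d.dist x y * b) :
    ∃ δ', δ' < b ∧ ∀ p q : PMF S, q ∈ (UncertaintyModel.wasserstein d l δ).ball p →
      tvDist q p ≤ δ' := by
  obtain ⟨D, hD0, hDδ, hDd⟩ : ∃ D : ℝ, 0 < D ∧ δ < D * b ∧ ∀ x y : S, x ≠ y → D ≤ d.dist x y := by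
    by_cases hn : ∃ z : S × S, z.1 ≠ z.2
    · obtain ⟨z₀, hz₀⟩ := hn
      have : Nonempty {z : S × S // z.1 ≠ z.2} := ⟨⟨z₀, hz₀⟩⟩
      obtain ⟨z, hz⟩ := Finite.exists_min fun z : {z : S × S // z.1 ≠ z.2} => d.dist z.1.1 z.1.2
      exact ⟨_, dist_pos.2 z.2, h _ _ z.2, fun x y hxy => hz ⟨(x, y), hxy⟩⟩
    -- With a single state there is no distance to minimise, and any `D` with `δ < D * b` serves.
    · refine ⟨(δ + 1) / b, by positivity, ?_, fun x y hxy => absurd ⟨(x, y), hxy⟩ hn⟩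
      rw [div_mul_cancel₀ _ hb0.ne']; linarith
  refine ⟨δ / D, by rw [div_lt_iff₀ hD0]; linarith, fun p q hq => ?_⟩
  obtain ⟨c, h1, h2, h3⟩ := ((isTransportBall_wasserstein d hl hδ).2.2.2 p q).1 hq
  have hx0 : 0 ≤ δ / D := by positivity
  have hx1 : δ / D ≤ 1 := by rw [div_le_one hD0]; nlinarith
  have h4 : planCost (fun x y => if x = y then 0 else 1) c ≤ (δ / D) ^ l := by
    rw [Real.div_rpow hδ hD0.le, le_div_iff₀ (Real.rpow_pos_of_pos hD0 l)]
    refine le_trans ?_ h3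
    simp only [planCost, Finset.sum_mul]
    refine Finset.sum_le_sum fun x _ => Finset.sum_le_sum fun y _ => ?_
    rw [mul_assoc]
    refine mul_le_mul_of_nonneg_left ?_ (h1.1 x y)
    split_ifs with hxy
    · rw [zero_mul]; exact Real.rpow_nonneg dist_nonneg l
    · rw [one_mul]; exact Real.rpow_le_rpow hD0.le (hDd x y hxy) (by linarith)
  have h5 : (δ / D) ^ l ≤ δ / D := by
    rcases eq_or_lt_of_le hx0 with h0 | h0
    · rw [← h0, Real.zero_rpow (by linarith)]
    · exact (Real.rpow_le_rpow_of_exponent_ge h0 hx1 hl).trans_eq (Real.rpow_one _)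
  exact ((isTransportBall_tv hx0).2.2.2 p q).2 ⟨c, h1, h2, h4.trans h5⟩

/-- Here the size of the radius matters. Contamination keeps the fraction `1 - δ` of every nominal
transition probability, so positivity of a power of the nominal chain survives. Total variation and
Wasserstein balls lie in total variation balls too small to cancel an entry of the `m`-th power. -/
theorem exists_scrambling_family {M : RobustMDP S A} {π : S → PMF A} (he : NominalErgodic M π)
    (hr : RadiusCondition M π) : ∃ F : Set (Matrix S S ℝ),
      (∀ P ∈ uncertaintySet M, policyMatrix π P ∈ F) ∧ (∀ Q ∈ F, IsStoch Q) ∧ RowConvex F ∧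
        Scrambling F := by
  have hP := isStoch_policyMatrix π M.nominal
  unfold RadiusCondition at hr
  cases hM : M.model with
  | contamination δ =>
    rw [hM] at hr
    obtain ⟨m, hm, hpos⟩ := exists_pow_pos_of_ergodic hP he.1 he.2
    refine ⟨dominatingFamily (policyMatrix π M.nominal) (1 - δ), fun P hPU => ?_, fun Q hQ => hQ.1,
      rowConvex_dominatingFamily _ _, scrambling_dominatingFamily hP (by linarith [hr.2]) hm hpos⟩
    refine ⟨isStoch_policyMatrix π P, fun i j => ?_⟩
    simp only [policyMatrix, Matrix.of_apply, Finset.mul_sum]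
    refine Finset.sum_le_sum fun a _ => ?_
    have h1 := hPU i a
    rw [hM] at h1
    obtain ⟨q', hq'⟩ := h1
    rw [hq' j, mul_left_comm]
    refine mul_le_mul_of_nonneg_left ?_ ENNReal.toReal_nonneg
    have := mul_nonneg hr.1 (ENNReal.toReal_nonneg (a := q' j))
    linarith
  | tv δ =>
    rw [hM] at hr
    obtain ⟨h0, m, hm, h⟩ := hr
    refine ⟨tvFamily (policyMatrix π M.nominal) δ, fun P hPU => ?_, fun Q hQ => hQ.1,
      rowConvex_tvFamily _ _, scrambling_tvFamily hP hm fun i j => (h i j).2⟩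
    exact tvFamily_of_tvDist_le π (fun p q hq => by rw [hM] at hq; exact hq) hPU
  | wasserstein d l δ =>
    rw [hM] at hr
    obtain ⟨hl, h0, m, hm, h⟩ := hr
    have hm0 : (0 : ℝ) < m := by exact_mod_cast hm
    obtain ⟨z, hz⟩ := Finite.exists_min fun z : S × S => (policyMatrix π M.nominal ^ m) z.1 z.2
    have hb1 : (policyMatrix π M.nominal ^ m) z.1 z.2 / m ≤ 1 := by
      have h1 : (policyMatrix π M.nominal ^ m) z.1 z.2 ≤ 1 := by
        rw [← (hP.pow m).2 z.1]
        exact Finset.single_le_sum (f := fun j => (policyMatrix π M.nominal ^ m) z.1 j)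
          (fun j _ => (hP.pow m).1 _ j) (Finset.mem_univ _)
      rw [div_le_one hm0]
      exact h1.trans (by exact_mod_cast hm)
    obtain ⟨δ', h1, h2⟩ := tvDist_le_of_mem_wasserstein d hl h0
      (div_pos (h z.1 z.2).1 hm0) hb1 fun x y hxy => by
        have := (h z.1 z.2).2 x y hxy
        rwa [mul_div_assoc] at this
    refine ⟨tvFamily (policyMatrix π M.nominal) δ', fun P hPU => ?_, fun Q hQ => hQ.1,
      rowConvex_tvFamily _ _, scrambling_tvFamily hP hm fun i j =>
        h1.trans_le (by have := hz (i, j); gcongr)⟩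
    exact tvFamily_of_tvDist_le π (fun p q hq => by rw [hM] at hq; exact h2 p q hq) hPU

theorem exists_contractionSeminorm {M : RobustMDP S A} {π : S → PMF A} (he : NominalErgodic M π)
    (hr : RadiusCondition M π) : ∃ (N : Seminorm ℝ (S → ℝ)) (γ : ℝ),
      IsContractionSeminorm M π N γ ∧ ∀ x, spanSeminorm x ≤ N x := by
  obtain ⟨F, hF, hs, hc, hsc⟩ := exists_scrambling_family he hr
  obtain ⟨N, γ, h0, h1, hsp, hconst, hN⟩ := hsc.exists_seminorm hs
  refine ⟨N, γ, ⟨h0, h1, fun x => ⟨fun h => ?_, ?_⟩, fun V₁ V₂ g => ?_⟩, hsp⟩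
  · exact span_eq_zero_iff.1 (le_antisymm (h ▸ hsp x) (span_nonneg x))
  · rintro ⟨c, rfl⟩; exact hconst c
  · have h2 : robustBellman M π g V₁ - robustBellman M π g V₂ =
        robustBellman M π 0 V₁ - robustBellman M π 0 V₂ := by
      funext s
      simp only [Pi.sub_apply, robustBellman_sub_const M π g]; ring
    obtain ⟨Q, hQ, h3⟩ := exists_robustBellman_sub_eq M π (admissible_of_radiusCondition hr) hF hc
      V₁ V₂
    rw [h2, h3]
    exact hN Q hQ _

/-! ### Mixing times -/

/-- The infimum and supremum defining the mixing times carry information only for nonempty,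
respectively bounded, sets. The contraction rate is uniform over the family, so one time `t₀` is
admissible for every kernel, which provides both. -/
theorem mixingTime_spec {M : RobustMDP S A} {π : S → PMF A} (he : NominalErgodic M π)
    (hr : RadiusCondition M π) {P : S → A → PMF S} (hP : P ∈ uncertaintySet M) :
    1 ≤ mixingTime (policyMatrix π P) ∧ mixingTime (policyMatrix π P) ≤ tMix M π ∧
      ∀ x, spanSeminorm ((policyMatrix π P ^ mixingTime (policyMatrix π P)).mulVec x) ≤
        1 / 2 * spanSeminorm x := by
  obtain ⟨F, hF, hs, hc, hsc⟩ := exists_scrambling_family he hr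
  obtain ⟨C, γ, hC, hγ0, hγ1, h⟩ := hsc.exists_span_le hs
  obtain ⟨t₀, ht₀, ht₁⟩ : ∃ t : ℕ, 1 ≤ t ∧ Fintype.card S * (C * γ ^ t) ≤ 1 / 2 := by
    have h1 : Tendsto (fun t : ℕ => (Fintype.card S : ℝ) * (C * γ ^ t)) atTop (𝓝 0) := by
      simpa using ((tendsto_pow_atTop_nhds_zero_of_lt_one hγ0.le hγ1).const_mul C).const_mul
        (Fintype.card S : ℝ)
    obtain ⟨t, ht, ht'⟩ := ((eventually_ge_atTop 1).and
      (h1.eventually_le_const (show (0 : ℝ) < 1 / 2 by norm_num))).exists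
    exact ⟨t, ht, ht'⟩
  have key : ∀ P ∈ uncertaintySet M, t₀ ∈ {t | 1 ≤ t ∧ ∃ ν ∈ stdSimplex ℝ S,
      Matrix.vecMul ν (policyMatrix π P) = ν ∧ ∀ μ₀ ∈ stdSimplex ℝ S,
        ∑ s, |Matrix.vecMul μ₀ (policyMatrix π P ^ t) s - ν s| ≤ 1 / 2} := by
    intro P hP
    obtain ⟨ν, h1, h2, h3⟩ := exists_invariant_of_span_le (isStoch_policyMatrix π P) hC hγ0 hγ1
      fun k x => by
        have := h (List.replicate k (policyMatrix π P))
          (fun Q hQ => (List.eq_of_mem_replicate hQ) ▸ hF P hP) x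
        rwa [List.prod_replicate, List.length_replicate] at this
    exact ⟨ht₀, ν, h1, h2, fun μ hμ => (h3 t₀ μ hμ).trans ht₁⟩
  have hbdd : BddAbove {n | ∃ P ∈ uncertaintySet M, n = mixingTime (policyMatrix π P)} := by
    refine ⟨t₀, ?_⟩
    rintro _ ⟨P, hP, rfl⟩
    exact Nat.sInf_le (key P hP)
  obtain ⟨h1, ν, h2, h3, h4⟩ := Nat.sInf_mem ⟨t₀, key P hP⟩
  exact ⟨h1, le_csSup hbdd ⟨P, hP, rfl⟩,
    span_mulVec_le_half ((isStoch_policyMatrix π P).pow _) h4⟩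

theorem one_le_tMix {M : RobustMDP S A} {π : S → PMF A} (he : NominalErgodic M π)
    (hr : RadiusCondition M π) : 1 ≤ tMix M π := by
  obtain ⟨P, hP, -⟩ := exists_minimizing_kernel M π (admissible_of_radiusCondition hr) 0
  obtain ⟨h1, h2, -⟩ := mixingTime_spec he hr hP
  exact h1.trans h2

/-! ### The Bellman equation -/

/-- The kernel that is minimal for `V₂` is a competitor for `V₁`, and a stochastic matrix does not
raise an upper bound. Used in both orders, this is sup-norm nonexpansiveness. -/
theorem abs_robustBellman_sub_le (M : RobustMDP S A) (π : S → PMF A) (hU : Admissible M.model)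
    {V₁ V₂ : S → ℝ} {c : ℝ} (h : ∀ s, V₁ s - V₂ s ≤ c) (s : S) :
    robustBellman M π 0 V₁ s - robustBellman M π 0 V₂ s ≤ c := by
  obtain ⟨P, hP, h2⟩ := exists_minimizing_kernel M π hU V₂
  have h1 := robustBellman_le_of_mem M π hU hP V₁ s
  have h3 := mulVec_le_of_le (isStoch_policyMatrix π P) (x := V₁ - V₂) h s
  rw [Matrix.mulVec_sub, Pi.sub_apply] at h3
  linarith [h2 s]

/-- Fixed-point iteration for the operator normalised to vanish at `s₀`. Anchored vectors are
bounded coordinatewise by their span, so the iterates are Cauchy in the sup norm and not only modulo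
constants; the value subtracted at `s₀` becomes `g`. -/
theorem exists_bellman_solution (M : RobustMDP S A) (π : S → PMF A) (hU : Admissible M.model)
    (q : Seminorm ℝ (S → ℝ)) {γ : ℝ} (hγ0 : 0 ≤ γ) (hγ1 : γ < 1) (hq : ∀ x, spanSeminorm x ≤ q x)
    (hc : ∀ c : ℝ, q (fun _ => c) = 0)
    (hT : ∀ V₁ V₂, q (robustBellman M π 0 V₁ - robustBellman M π 0 V₂) ≤ γ * q (V₁ - V₂)) :
    ∃ (V : S → ℝ) (g : ℝ), ∀ s, robustBellman M π 0 V s = V s + g := by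
  obtain ⟨s₀⟩ := ‹Nonempty S›
  let f : (S → ℝ) → S → ℝ := fun V s => robustBellman M π 0 V s - robustBellman M π 0 V s₀
  have hf : ∀ V₁ V₂, q (f V₁ - f V₂) ≤ γ * q (V₁ - V₂) := by
    intro V₁ V₂
    refine le_trans (le_of_eq ?_) (hT V₁ V₂)
    exact seminorm_congr_of_const q hc (c := robustBellman M π 0 V₂ s₀ - robustBellman M π 0 V₁ s₀)
      fun i => by simp only [f, Pi.sub_apply]; ring
  let x : ℕ → S → ℝ := fun n => f^[n] 0
  have hxs : ∀ n, x n s₀ = 0 := by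
    intro n
    cases n with
    | zero => rfl
    | succ n => simp only [x, Function.iterate_succ_apply', f, sub_self]
  have hstep : ∀ n, q (x n - x (n + 1)) ≤ q (x 0 - x 1) * γ ^ n := by
    intro n
    induction n with
    | zero => simp
    | succ n ih =>
      have h1 := hf (x n) (x (n + 1))
      have h2 : ∀ k, f (x k) = x (k + 1) := fun k => (Function.iterate_succ_apply' f k 0).symm
      rw [h2, h2] at h1
      calc _ ≤ _ := h1
        _ ≤ γ * (q (x 0 - x 1) * γ ^ n) := mul_le_mul_of_nonneg_left ih hγ0
        _ = _ := by ring
  have hcau : CauchySeq x := by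
    refine cauchySeq_of_le_geometric γ (q (x 0 - x 1)) hγ1 fun n => ?_
    refine le_trans ?_ ((hq _).trans (hstep n))
    refine (dist_pi_le_iff (span_nonneg _)).2 fun s => ?_
    have := abs_sub_le_span (x n - x (n + 1)) s s₀
    simpa [hxs, Real.dist_eq] using this
  obtain ⟨V, hV⟩ := cauchySeq_tendsto_of_complete hcau
  have hcont : Continuous (robustBellman M π 0) := by
    have : LipschitzWith 1 (robustBellman M π 0) := by
      refine LipschitzWith.of_dist_le_mul fun V₁ V₂ => ?_
      rw [NNReal.coe_one, one_mul]
      refine (dist_pi_le_iff dist_nonneg).2 fun s => ?_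
      rw [Real.dist_eq, abs_le]
      have hd : ∀ s, |V₁ s - V₂ s| ≤ dist V₁ V₂ := fun s => dist_le_pi_dist V₁ V₂ s
      have h1 := abs_robustBellman_sub_le M π hU (fun s => (le_abs_self _).trans (hd s)) s
      have h2 := abs_robustBellman_sub_le M π hU (V₁ := V₂) (V₂ := V₁) (c := dist V₁ V₂)
        (fun s => by linarith [neg_abs_le (V₁ s - V₂ s), hd s]) s
      constructor <;> linarith
    exact this.continuous
  have hfc : Continuous f := by
    refine continuous_pi fun s => ?_
    exact ((continuous_apply s).comp hcont).sub ((continuous_apply s₀).comp hcont)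
  have h1 : Tendsto (fun n => x (n + 1)) atTop (𝓝 (f V)) := by
    have := (hfc.tendsto V).comp hV
    refine this.congr fun n => ?_
    exact (Function.iterate_succ_apply' f n 0).symm
  have h2 : f V = V := tendsto_nhds_unique h1 (hV.comp (tendsto_add_atTop_nat 1))
  refine ⟨V, robustBellman M π 0 V s₀, fun s => ?_⟩
  have := congrFun h2 s
  simp only [f] at this
  linarith

/-- A solution of the robust Bellman equation gives the robust average reward. -/
theorem isRobustAverageReward_of_bellman {M : RobustMDP S A} {π : S → PMF A}
    (hU : Admissible M.model) {V : S → ℝ} {g : ℝ} (h : ∀ s, robustBellman M π 0 V s = V s + g) :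
    IsRobustAverageReward M π g := by
  have hsum : ∀ (K : Matrix S S ℝ) (s : S) (T : ℕ),
      ∑ t ∈ Finset.range T, ((K ^ t).mulVec V s - (K ^ (t + 1)).mulVec V s) =
        V s - (K ^ T).mulVec V s := by
    intro K s T
    rw [Finset.sum_range_sub' fun t => (K ^ t).mulVec V s]; simp
  have hdiff : ∀ (K : Matrix S S ℝ), IsStoch K → ∀ (s : S) (T : ℕ),
      |V s - (K ^ T).mulVec V s| ≤ spanSeminorm V := by
    intro K hK s T
    have h1 := mulVec_le_of_le (hK.pow T) (le_iSup_fin V) s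
    have h2 := le_mulVec_of_le (hK.pow T) (iInf_fin_le V) s
    have h3 := le_iSup_fin V s
    have h4 := iInf_fin_le V s
    rw [abs_le, spanSeminorm]; constructor <;> linarith
  have hlim : ∀ a : ℝ, Tendsto (fun T : ℕ => g + (1 / (T : ℝ)) * a) atTop (𝓝 g) := by
    intro a
    simpa using (tendsto_one_div_atTop_nhds_zero_nat.mul_const a).const_add g
  have hpow : ∀ (K : Matrix S S ℝ), IsStoch K → ∀ (s : S) (t : ℕ),
      (K ^ t).mulVec (V + (fun _ => g) - K.mulVec V) s =
        g + ((K ^ t).mulVec V s - (K ^ (t + 1)).mulVec V s) := by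
    intro K hK s t
    rw [Matrix.mulVec_sub, Matrix.mulVec_add, mulVec_const (hK.pow t), Matrix.mulVec_mulVec, pow_succ]
    simp only [Pi.sub_apply, Pi.add_apply]; ring
  intro s
  constructor
  -- Attainment: for the kernel that is minimal for `V`, the reward is exactly `V + g - K V`, and
  -- the sum over time telescopes up to a bounded remainder.
  · obtain ⟨P, hP, h1⟩ := exists_minimizing_kernel M π hU V
    have hK := isStoch_policyMatrix π P
    refine ⟨P, hP, ?_⟩
    have hr : policyReward M π = V + (fun _ => g) - (policyMatrix π P).mulVec V := by
      funext s'
      simp only [Pi.sub_apply, Pi.add_apply]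
      linarith [h1 s', h s']
    refine tendsto_of_tendsto_of_tendsto_of_le_of_le' (hlim (-spanSeminorm V)) (hlim (spanSeminorm V))
      ?_ ?_
    all_goals
      filter_upwards [eventually_gt_atTop 0] with T hT
      have hT0 : (0 : ℝ) < T := by exact_mod_cast hT
      have h2 : averageRewardUpTo M π P s T =
          g + (1 / (T : ℝ)) * (V s - (policyMatrix π P ^ T).mulVec V s) := by
        rw [averageRewardUpTo, hr, ← hsum]
        simp only [hpow _ hK, Finset.sum_add_distrib, Finset.sum_const, Finset.card_range, nsmul_eq_mul]
        field_simp
      have h3 := abs_le.1 (hdiff _ hK s T)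
      rw [h2]
      gcongr
      first | exact h3.1 | exact h3.2
  -- Lower bound: for any admissible kernel the reward is at least `V + g - K V`, an inequality
  -- preserved by the powers of `K`.
  · rintro x ⟨P, hP, hx⟩
    have hK := isStoch_policyMatrix π P
    refine le_of_tendsto_of_tendsto (hlim (-spanSeminorm V)) hx ?_
    filter_upwards [eventually_gt_atTop 0] with T hT
    have hT0 : (0 : ℝ) < T := by exact_mod_cast hT
    have h2 : g + (1 / (T : ℝ)) * (V s - (policyMatrix π P ^ T).mulVec V s) ≤
        averageRewardUpTo M π P s T := by
      have h4 : T * g + (V s - (policyMatrix π P ^ T).mulVec V s) ≤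
          ∑ t ∈ Finset.range T, ((policyMatrix π P ^ t).mulVec (policyReward M π)) s := by
        have h5 : (T : ℝ) * g = ∑ _t ∈ Finset.range T, g := by
          rw [Finset.sum_const, Finset.card_range, nsmul_eq_mul]
        rw [← hsum, h5, ← Finset.sum_add_distrib]
        refine Finset.sum_le_sum fun t _ => ?_
        rw [← hpow _ hK]
        refine mulVec_mono (hK.pow t) (fun s' => ?_) s
        simp only [Pi.sub_apply, Pi.add_apply]
        linarith [robustBellman_le_of_mem M π hU hP V s', h s']
      rw [averageRewardUpTo]
      calc _ = (1 / (T : ℝ)) * (T * g + (V s - (policyMatrix π P ^ T).mulVec V s)) := by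
            field_simp
        _ ≤ _ := by gcongr
    refine le_trans ?_ h2
    have h3 := abs_le.1 (hdiff _ hK s T)
    gcongr
    exact h3.1

/-- The span of the relative value function is at most a multiple of the mixing time. -/
theorem span_bellman_solution_le {M : RobustMDP S A} {π : S → PMF A} (he : NominalErgodic M π)
    (hr : RadiusCondition M π) {V : S → ℝ} {g R : ℝ} (h : ∀ s, robustBellman M π 0 V s = V s + g)
    (hR : ∀ s a, |M.reward s a| ≤ R) : spanSeminorm V ≤ 4 * R * tMix M π := by
  obtain ⟨P, hP, h1⟩ := exists_minimizing_kernel M π (admissible_of_radiusCondition hr) V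
  have hK := isStoch_policyMatrix π P
  obtain ⟨h2, h3, h4⟩ := mixingTime_spec he hr hP
  set K := policyMatrix π P
  have hrew : spanSeminorm (policyReward M π) ≤ 2 * R := by
    refine span_le_two_mul fun s => ?_
    exact (abs_ev_le (P := π s) (M.reward s)).trans (ev_le_of_forall_le (hR s))
  -- `V - K V` is the reward up to a constant, so each step adds at most `2 R`. At the mixing time
  -- `K ^ k V` has at most half the span of `V`, and solving for the span turns `2 R` into `4 R`.
  have hstep : ∀ k : ℕ, spanSeminorm (V - (K ^ k).mulVec V) ≤ k * (2 * R) := by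
    intro k
    induction k with
    | zero => simp [← spanS_apply]
    | succ k ih =>
      have h5 : V - (K ^ (k + 1)).mulVec V =
          (V - (K ^ k).mulVec V) + (K ^ k).mulVec (V - K.mulVec V) := by
        rw [Matrix.mulVec_sub, Matrix.mulVec_mulVec, ← pow_succ]; abel
      have h6 : spanSeminorm (V - K.mulVec V) = spanSeminorm (policyReward M π) := by
        refine seminorm_congr_of_const (spanS S) (fun c => span_const c) (c := -g) fun s => ?_
        simp only [Pi.sub_apply]; linarith [h1 s, h s]
      have h7 := map_add_le_add (spanS S) (V - (K ^ k).mulVec V) ((K ^ k).mulVec (V - K.mulVec V))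
      have h8 := span_mulVec_le (hK.pow k) (V - K.mulVec V)
      simp only [spanS_apply] at h7
      rw [h5]; push_cast; linarith
  have h5 := hstep (mixingTime K)
  have h6 := h4 V
  have h7 := map_add_le_add (spanS S) (V - (K ^ mixingTime K).mulVec V) ((K ^ mixingTime K).mulVec V)
  rw [sub_add_cancel] at h7
  simp only [spanS_apply] at h7
  have hR0 : 0 ≤ 2 * R := (span_nonneg _).trans hrew
  have h8 : (mixingTime K : ℝ) * (2 * R) ≤ tMix M π * (2 * R) := by
    gcongr
  linarith

end Bellman

/-! ### Infimal convolution of semi-norms -/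

section Moreau

variable {E : Type*} [AddCommGroup E] [Module ℝ E]

/-- Square root of (twice) the Moreau envelope of `½ N²` built from the semi-norm `s`. -/
def moreau (N s : Seminorm ℝ E) (lam : ℝ) (x : E) : ℝ := ⨅ z, √(N z ^ 2 + lam * s (x - z) ^ 2)

theorem bddBelow_moreau (N s : Seminorm ℝ E) (lam : ℝ) (x : E) :
    BddBelow (Set.range fun z => √(N z ^ 2 + lam * s (x - z) ^ 2)) :=
  ⟨0, by rintro _ ⟨z, rfl⟩; exact Real.sqrt_nonneg _⟩

theorem moreau_le (N s : Seminorm ℝ E) (lam : ℝ) (x z : E) :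
    moreau N s lam x ≤ √(N z ^ 2 + lam * s (x - z) ^ 2) := ciInf_le (bddBelow_moreau N s lam x) z

theorem moreau_nonneg (N s : Seminorm ℝ E) (lam : ℝ) (x : E) : 0 ≤ moreau N s lam x :=
  le_ciInf fun _ => Real.sqrt_nonneg _

theorem le_mul_moreau {N s : Seminorm ℝ E} {lam : ℝ} {x : E} {a c : ℝ} (hc : 0 ≤ c)
    (h : ∀ z, a ≤ c * √(N z ^ 2 + lam * s (x - z) ^ 2)) : a ≤ c * moreau N s lam x := by
  rw [moreau, Real.mul_iInf_of_nonneg hc]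
  exact le_ciInf h

/-- Minkowski's inequality for a weighted Euclidean norm on the plane, with the cross term bounded
by Cauchy–Schwarz. -/
theorem sqrt_add_le {a₁ a₂ b₁ b₂ c : ℝ} (hc : 0 ≤ c) :
    √((a₁ + a₂) ^ 2 + c * (b₁ + b₂) ^ 2) ≤ √(a₁ ^ 2 + c * b₁ ^ 2) + √(a₂ ^ 2 + c * b₂ ^ 2) := by
  have h1 : 0 ≤ a₁ ^ 2 + c * b₁ ^ 2 := by positivity
  have h2 : 0 ≤ a₂ ^ 2 + c * b₂ ^ 2 := by positivity
  have h3 : a₁ * a₂ + c * (b₁ * b₂) ≤ √(a₁ ^ 2 + c * b₁ ^ 2) * √(a₂ ^ 2 + c * b₂ ^ 2) := by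
    rw [← Real.sqrt_mul h1]
    refine Real.le_sqrt_of_sq_le ?_
    nlinarith [mul_nonneg hc (sq_nonneg (a₁ * b₂ - a₂ * b₁))]
  refine (Real.sqrt_le_left (by positivity)).2 ?_
  have h4 := Real.sq_sqrt h1
  have h5 := Real.sq_sqrt h2
  nlinarith

/-- The Moreau envelope as a semi-norm. -/
def moreauS (N s : Seminorm ℝ E) {lam : ℝ} (hlam : 0 ≤ lam) : Seminorm ℝ E :=
  Seminorm.ofSMulLE (moreau N s lam)
    (le_antisymm ((moreau_le N s lam 0 0).trans_eq (by simp)) (moreau_nonneg N s lam 0))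
    (fun x y => by
      rw [← one_mul (moreau N s lam y), ← sub_le_iff_le_add']
      refine le_mul_moreau zero_le_one fun z₂ => ?_
      rw [one_mul, sub_le_iff_le_add', ← sub_le_iff_le_add, ← one_mul (moreau N s lam x)]
      refine le_mul_moreau zero_le_one fun z₁ => ?_
      rw [one_mul, sub_le_iff_le_add]
      refine (moreau_le N s lam (x + y) (z₁ + z₂)).trans ((Real.sqrt_le_sqrt ?_).trans
        (sqrt_add_le hlam))
      have h1 := map_add_le_add N z₁ z₂
      have h2 := map_add_le_add s (x - z₁) (y - z₂)
      rw [show x + y - (z₁ + z₂) = x - z₁ + (y - z₂) by abel]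
      gcongr)
    (fun r x => by
      refine le_mul_moreau (norm_nonneg r) fun z => ?_
      refine (moreau_le N s lam (r • x) (r • z)).trans_eq ?_
      rw [← smul_sub, map_smul_eq_mul, map_smul_eq_mul, ← Real.sqrt_sq (norm_nonneg r),
        ← Real.sqrt_mul (sq_nonneg _), Real.sqrt_sq (norm_nonneg r)]
      congr 1; ring)

/-- Cauchy–Schwarz applied to `N z + u * s (x - z)`, with weights `1` and `μ * u ^ 2`. -/
theorem le_sqrt_mul_moreau {N s : Seminorm ℝ E} {μ u : ℝ} (hμ : 0 < μ)
    (hu : ∀ x, N x ≤ u * s x) (x : E) : N x ≤ √(1 + μ * u ^ 2) * moreau N s (1 / μ) x := by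
  refine le_mul_moreau (Real.sqrt_nonneg _) fun z => ?_
  have h1 : N x ≤ N z + u * s (x - z) := by
    calc N x = N (z + (x - z)) := by rw [add_sub_cancel]
      _ ≤ N z + N (x - z) := map_add_le_add N _ _
      _ ≤ _ := by gcongr; exact hu _
  rw [← Real.sqrt_mul (by positivity)]
  refine h1.trans (Real.le_sqrt_of_sq_le ?_)
  have : (1 + μ * u ^ 2) * (N z ^ 2 + 1 / μ * s (x - z) ^ 2) - (N z + u * s (x - z)) ^ 2 =
      μ * (u * N z - s (x - z) / μ) ^ 2 := by
    field_simp; ring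
  have h2 : 0 ≤ μ * (u * N z - s (x - z) / μ) ^ 2 := by positivity
  linarith

theorem sqrt_mul_moreau_le {N s : Seminorm ℝ E} {μ l : ℝ} (hμ : 0 < μ) (hl : 0 < l)
    (hs : ∀ x, l * s x ≤ N x) (x : E) : √(1 + μ * l ^ 2) * moreau N s (1 / μ) x ≤ N x := by
  have hc : 0 < 1 + μ * l ^ 2 := by positivity
  -- The test point `θ • x` is the best multiple of `x` in the extreme case `N = l * s`.
  set θ := 1 / (1 + μ * l ^ 2)
  have hθ : 0 ≤ θ := by positivity
  have hθ' : 0 ≤ 1 - θ := by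
    rw [sub_nonneg, div_le_one hc]; nlinarith [mul_pos hμ (pow_pos hl 2)]
  have h1 := moreau_le N s (1 / μ) x (θ • x)
  have h2 : x - θ • x = (1 - θ) • x := by rw [sub_smul, one_smul]
  rw [h2, map_smul_eq_mul, map_smul_eq_mul, Real.norm_of_nonneg hθ, Real.norm_of_nonneg hθ'] at h1
  calc √(1 + μ * l ^ 2) * moreau N s (1 / μ) x
      ≤ √(1 + μ * l ^ 2) * √((θ * N x) ^ 2 + 1 / μ * ((1 - θ) * s x) ^ 2) := by gcongr
    _ = √((1 + μ * l ^ 2) * ((θ * N x) ^ 2 + 1 / μ * ((1 - θ) * s x) ^ 2)) := by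
        rw [Real.sqrt_mul hc.le]
    _ ≤ √(N x ^ 2) := by
        refine Real.sqrt_le_sqrt ?_
        have h3 : (l * s x) ^ 2 ≤ N x ^ 2 := by
          have := hs x
          have h0 := apply_nonneg s x
          gcongr
        have h4 : (1 + μ * l ^ 2) * ((θ * N x) ^ 2 + 1 / μ * ((1 - θ) * s x) ^ 2) =
            (N x ^ 2 + μ * l ^ 2 * (l * s x) ^ 2) / (1 + μ * l ^ 2) := by
          simp only [θ]; field_simp; ring
        rw [h4, div_le_iff₀ hc]
        have : μ * l ^ 2 * (l * s x) ^ 2 ≤ μ * l ^ 2 * N x ^ 2 := by gcongr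
        linarith
    _ = N x := Real.sqrt_sq (apply_nonneg N x)

/-- A single test point `z` serves for `x`, `x + y` and `x - y`. The terms `N z ^ 2` then match, and
only the smoothness of `s` is used. -/
theorem moreau_smooth {N s : Seminorm ℝ E} {lam L : ℝ} (hlam : 0 ≤ lam)
    (h : ∀ x y, s (x + y) ^ 2 + s (x - y) ^ 2 ≤ 2 * s x ^ 2 + 2 * L * s y ^ 2) (x y : E) :
    moreau N s lam (x + y) ^ 2 + moreau N s lam (x - y) ^ 2 ≤
      2 * moreau N s lam x ^ 2 + 2 * (L * lam) * s y ^ 2 := by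
  have hsq : ∀ x z, moreau N s lam x ^ 2 ≤ N z ^ 2 + lam * s (x - z) ^ 2 := fun x z =>
    (pow_le_pow_left₀ (moreau_nonneg N s lam x) (moreau_le N s lam x z) 2).trans_eq
      (Real.sq_sqrt (by positivity))
  set A := (moreau N s lam (x + y) ^ 2 + moreau N s lam (x - y) ^ 2) / 2 - L * lam * s y ^ 2 with hA
  have h1 : ∀ z, A ≤ N z ^ 2 + lam * s (x - z) ^ 2 := by
    intro z
    have h2 := hsq (x + y) z
    have h3 := hsq (x - y) z
    have h4 := h (x - z) y
    rw [show x + y - z = x - z + y by abel] at h2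
    rw [show x - y - z = x - z - y by abel] at h3
    have h5 := mul_le_mul_of_nonneg_left h4 hlam
    rw [hA]; linarith
  have h2 : √A ≤ 1 * moreau N s lam x := le_mul_moreau zero_le_one fun z => by
    rw [one_mul]; exact Real.sqrt_le_sqrt (h1 z)
  rw [one_mul, Real.sqrt_le_left (moreau_nonneg _ _ _ _)] at h2
  rw [hA] at h2; linarith

/-! ### Smooth semi-norms and random perturbations -/

/-- A semi-norm whose square is `L`-smooth with respect to the semi-norm itself. -/
def IsSmooth (q : Seminorm ℝ E) (L : ℝ) : Prop :=
  ∀ x y, q (x + y) ^ 2 + q (x - y) ^ 2 ≤ 2 * q x ^ 2 + 2 * L * q y ^ 2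

/-- A type-2 inequality with signs chosen greedily: smoothness bounds the mean over the two signs of
the next vector, so the better sign adds at most `L * q (x i) ^ 2`. -/
theorem IsSmooth.exists_signs {q : Seminorm ℝ E} {L : ℝ} (hq : IsSmooth q L)
    {ι : Type*} [DecidableEq ι] (I : Finset ι) (x : ι → E) : ∃ ε : ι → ℝ, (∀ i, ε i = 1 ∨ ε i = -1) ∧
      q (∑ i ∈ I, ε i • x i) ^ 2 ≤ L * ∑ i ∈ I, q (x i) ^ 2 := by
  induction I using Finset.induction_on with
  | empty => exact ⟨fun _ => 1, fun _ => Or.inl rfl, by simp⟩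
  | insert i I hi ih =>
    obtain ⟨ε, h1, h2⟩ := ih
    have h3 := hq (∑ i ∈ I, ε i • x i) (x i)
    obtain ⟨σ, hσ, h4⟩ : ∃ σ : ℝ, (σ = 1 ∨ σ = -1) ∧
        q (∑ i ∈ I, ε i • x i + σ • x i) ^ 2 ≤ q (∑ i ∈ I, ε i • x i) ^ 2 + L * q (x i) ^ 2 := by
      rcases le_total (q (∑ i ∈ I, ε i • x i + x i) ^ 2) (q (∑ i ∈ I, ε i • x i - x i) ^ 2) with h | h
      · exact ⟨1, Or.inl rfl, by rw [one_smul]; linarith⟩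
      · exact ⟨-1, Or.inr rfl, by rw [neg_one_smul, ← sub_eq_add_neg]; linarith⟩
    refine ⟨Function.update ε i σ, fun j => ?_, ?_⟩
    · rcases eq_or_ne j i with rfl | hj
      · rw [Function.update_self]; exact hσ
      · rw [Function.update_of_ne hj]; exact h1 j
    · rw [Finset.sum_insert hi, Finset.sum_insert hi, Function.update_self]
      have h5 : ∑ j ∈ I, Function.update ε i σ j • x j = ∑ j ∈ I, ε j • x j :=
        Finset.sum_congr rfl fun j hj => by
          rw [Function.update_of_ne (ne_of_mem_of_not_mem hj hi)]
      rw [h5, add_comm (σ • x i)]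
      linarith

end Moreau

section Smooth

variable {S : Type u}

theorem seminorm_ev_le {Ω : Type*} [Fintype Ω] (P : PMF Ω) (q : Seminorm ℝ (S → ℝ))
    (z : Ω → S → ℝ) : q (fun s => ev P fun ω => z ω s) ≤ ev P fun ω => q (z ω) := by
  have h1 : (fun s => ev P fun ω => z ω s) = ∑ ω, (P ω).toReal • z ω := by
    funext s; simp [ev]
  rw [h1]
  refine (Finset.le_sum_of_subadditive q (map_zero q).le (map_add_le_add q) _ _).trans_eq ?_
  refine Finset.sum_congr rfl fun ω _ => ?_
  rw [map_smul_eq_mul, Real.norm_of_nonneg ENNReal.toReal_nonneg]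

theorem ev_comm {Ω Ω' : Type*} [Fintype Ω] [Fintype Ω'] (P : PMF Ω) (P' : PMF Ω') (f : Ω → Ω' → ℝ) :
    ev P (fun ω => ev P' (f ω)) = ev P' fun ω' => ev P fun ω => f ω ω' := by
  simp only [ev, Finset.mul_sum]
  rw [Finset.sum_comm]
  exact Finset.sum_congr rfl fun _ _ => Finset.sum_congr rfl fun _ _ => by ring

/-- Centred noise increases the square of a smooth semi-norm by at most its second moment. -/
theorem IsSmooth.ev_sq_le {q : Seminorm ℝ (S → ℝ)} {L : ℝ} (hL : 0 ≤ L) (hq : IsSmooth q L)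
    {Ω : Type*} [Fintype Ω] (P : PMF Ω) (y : S → ℝ) (w : Ω → S → ℝ)
    (hw : ∀ s, ev P (fun ω => w ω s) = 0) :
    ev P (fun ω => q (y + w ω) ^ 2) ≤ q y ^ 2 + 4 * L * ev P fun ω => q (w ω) ^ 2 := by
  -- Smoothness needs a pair of opposite perturbations. By Jensen, the centred noise may be replaced
  -- by its difference with an independent copy, which is symmetric; the factor `4` comes from
  -- splitting that difference.
  have h1 : ∀ ω, q (y + w ω) ^ 2 ≤ ev P fun ω' => q (y + (w ω - w ω')) ^ 2 := by
    intro ω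
    have h2 : y + w ω = fun s => ev P fun ω' => (y + (w ω - w ω')) s := by
      funext s
      simp only [Pi.add_apply, Pi.sub_apply]
      rw [ev_add, ev_sub, ev_const, ev_const, hw]; ring
    calc q (y + w ω) ^ 2 ≤ (ev P fun ω' => q (y + (w ω - w ω'))) ^ 2 := by
          have h3 := seminorm_ev_le P q fun ω' => y + (w ω - w ω')
          rw [← h2] at h3
          have := apply_nonneg q (y + w ω)
          gcongr
      _ ≤ _ := sq_ev_le _
  have h2 : ∀ ω ω', q (y + (w ω - w ω')) ^ 2 + q (y + (w ω' - w ω)) ^ 2 ≤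
      2 * q y ^ 2 + (4 * L * q (w ω) ^ 2 + 4 * L * q (w ω') ^ 2) := by
    intro ω ω'
    have h3 := hq y (w ω - w ω')
    rw [show y - (w ω - w ω') = y + (w ω' - w ω) by abel] at h3
    have h4 : q (w ω - w ω') ^ 2 ≤ 2 * q (w ω) ^ 2 + 2 * q (w ω') ^ 2 := by
      have h5 := map_sub_le_add q (w ω) (w ω')
      have h6 := apply_nonneg q (w ω - w ω')
      nlinarith [sq_nonneg (q (w ω) - q (w ω'))]
    have h5 := mul_le_mul_of_nonneg_left h4 (by positivity : 0 ≤ 2 * L)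
    linarith
  have h3 : ev P (fun ω => ev P fun ω' => q (y + (w ω - w ω')) ^ 2 + q (y + (w ω' - w ω)) ^ 2) ≤
      2 * q y ^ 2 + (4 * L * ev P (fun ω => q (w ω) ^ 2) + 4 * L * ev P fun ω => q (w ω) ^ 2) := by
    refine (ev_mono fun ω => ev_mono fun ω' => h2 ω ω').trans_eq ?_
    simp only [ev_add, ev_const, ev_mul_left]
  simp only [ev_add] at h3
  rw [ev_comm P P fun ω ω' => q (y + (w ω' - w ω)) ^ 2] at h3
  have h4 := ev_mono (P := P) h1
  linarith

variable [Fintype S] [Nonempty S]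

/-- A smooth semi-norm comparable to the span exists only in bounded dimension: the span semi-norm
contains long sequences of sign vectors. -/
theorem IsSmooth.card_le {q : Seminorm ℝ (S → ℝ)} {L D : ℝ} (hL : 0 ≤ L) (hD : 0 ≤ D)
    (hq : IsSmooth q L) (h1 : ∀ x, spanSeminorm x ≤ q x) (h2 : ∀ x, q x ≤ D * spanSeminorm x) :
    Fintype.card S ≤ 2 ^ (⌊L * D ^ 2⌋₊ + 1) := by
  classical
  set m := Nat.log 2 (Fintype.card S) with hm
  have hcard : 2 ^ m ≤ Fintype.card S := Nat.pow_log_le_self 2 Fintype.card_ne_zero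
  refine (Nat.lt_pow_succ_log_self one_lt_two (Fintype.card S)).le.trans
    (Nat.pow_le_pow_right (by norm_num) (Nat.succ_le_succ (Nat.le_floor ?_)))
  rw [← hm]
  obtain ⟨e⟩ : Nonempty ((Fin m → Bool) ↪ S) :=
    Function.Embedding.nonempty_of_card_le (by simpa using hcard)
  -- The coordinate functions of a sign cube of dimension `m` embedded in the state space.
  let x : Fin m → S → ℝ := fun i => Function.extend e (fun b => if b i then 1 else -1) 0
  have hx : ∀ i b, x i (e b) = if b i then 1 else -1 := fun i b => e.injective.extend_apply _ _ _
  have hx1 : ∀ i s, |x i s| ≤ 1 := by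
    intro i s
    by_cases hs : ∃ b, e b = s
    · obtain ⟨b, rfl⟩ := hs
      rw [hx]; split_ifs <;> norm_num
    · simp only [x, Function.extend_apply' _ _ _ hs]; norm_num
  obtain ⟨ε, hε, h3⟩ := hq.exists_signs Finset.univ x
  have hε2 : ∀ i, ε i * (if ε i = 1 then 1 else -1) = 1 := by
    intro i
    rcases hε i with h | h <;> rw [h] <;> norm_num
  -- Every signed sum of these vectors attains `m` at the vertex with the same signs and `-m` at the
  -- opposite one, so its span is at least `2 m`. For the good signs, smoothness bounds it by `2 D
  -- √(L m)`; hence `m ≤ L * D ^ 2`.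
  have h4 : 2 * (m : ℝ) ≤ q (∑ i, ε i • x i) := by
    refine le_trans ?_ (h1 _)
    refine le_trans (le_of_eq ?_) (sub_le_span _ (e fun i => decide (ε i = 1))
      (e fun i => !decide (ε i = 1)))
    simp only [Finset.sum_apply, Pi.smul_apply, smul_eq_mul, hx]
    have h5 : ∀ i, ε i * (if decide (ε i = 1) = true then (1 : ℝ) else -1) = 1 := by
      intro i; simpa using hε2 i
    have h6 : ∀ i, ε i * (if (!decide (ε i = 1)) = true then (1 : ℝ) else -1) = -1 := by
      intro i
      rcases hε i with h | h <;> rw [h] <;> norm_num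
    simp only [h5, h6, Finset.sum_const, Finset.card_univ, Fintype.card_fin, nsmul_eq_mul]
    ring
  have h5 : ∑ i, q (x i) ^ 2 ≤ m * (D * 2) ^ 2 := by
    calc ∑ i, q (x i) ^ 2 ≤ ∑ _i : Fin m, (D * 2) ^ 2 := by
          refine Finset.sum_le_sum fun i _ => ?_
          have h6 := (h2 (x i)).trans (mul_le_mul_of_nonneg_left (span_le_two_mul (hx1 i)) hD)
          rw [mul_one] at h6
          have := apply_nonneg q (x i)
          gcongr
      _ = _ := by simp
  have h6 : (2 * (m : ℝ)) ^ 2 ≤ L * (m * (D * 2) ^ 2) := by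
    calc (2 * (m : ℝ)) ^ 2 ≤ q (∑ i, ε i • x i) ^ 2 := by gcongr
      _ ≤ _ := h3
      _ ≤ _ := by gcongr
  rcases Nat.eq_zero_or_pos m with h0 | h0
  · rw [h0]; push_cast; positivity
  · have hm0 : (0 : ℝ) < m := by exact_mod_cast h0
    have : (m : ℝ) * m ≤ (L * D ^ 2) * m := by nlinarith
    exact le_of_mul_le_mul_right this hm0

end Smooth

/-! ### The constants of contraction semi-norms -/

section Constants

variable {S : Type u} [Fintype S]

/-- Enlarging `B` in the condition on `α₂` is legitimate only because `α₂` is nonnegative, which `0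
< 1 - γ ≤ B α₂` with `B ≥ 0` forces. -/
theorem ConstantsAtMost.mono {N : Seminorm ℝ (S → ℝ)} {γ B B' : ℝ} (hγ1 : γ < 1)
    (hB : 0 ≤ B) (hBB : B ≤ B') (hC : ConstantsAtMost N γ B) : ConstantsAtMost N γ B' := by
  obtain ⟨s, cP, CP, l, u, L, μ, hcP, hl, hμ, hN, hs, hL, hB1, hB2, hB3⟩ := hC
  have hα : 0 ≤ 1 - γ * √((1 + μ * u ^ 2) / (1 + μ * l ^ 2)) := by
    by_contra hneg
    push Not at hneg
    nlinarith
  exact ⟨s, cP, CP, l, u, L, μ, hcP, hl, hμ, hN, hs, hL, hB1.trans (by gcongr),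
    hB2.trans (by gcongr), hB3.trans (by gcongr)⟩

variable [Nonempty S]

theorem exists_le_span (N : Seminorm ℝ (S → ℝ)) (h : ∀ c : ℝ, N (fun _ => c) = 0) :
    ∃ C, 0 ≤ C ∧ ∀ x, N x ≤ C * spanSeminorm x := by
  classical
  obtain ⟨s₀⟩ := ‹Nonempty S›
  refine ⟨∑ i, N (Pi.single i 1), Finset.sum_nonneg fun i _ => apply_nonneg N _, fun x => ?_⟩
  have h1 : N x = N (∑ i, (x i - x s₀) • Pi.single i (1 : ℝ)) := by
    refine seminorm_congr_of_const N h (c := x s₀) fun i => ?_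
    simp [Finset.sum_apply, Pi.single_apply]
  rw [h1, Finset.sum_mul]
  refine (Finset.le_sum_of_subadditive N (map_zero N).le (map_add_le_add N) _ _).trans ?_
  refine Finset.sum_le_sum fun i _ => ?_
  rw [map_smul_eq_mul, mul_comm]
  exact mul_le_mul_of_nonneg_left (abs_sub_le_span x i s₀) (apply_nonneg N _)

theorem continuous_of_le_span (N : Seminorm ℝ (S → ℝ)) {C : ℝ} (hC : 0 ≤ C)
    (h : ∀ x, N x ≤ C * spanSeminorm x) : Continuous N := by
  have h1 : LipschitzWith (C * 2).toNNReal N := by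
    refine LipschitzWith.of_dist_le_mul fun x y => ?_
    rw [Real.dist_eq, Real.coe_toNNReal _ (by positivity), dist_eq_norm]
    refine (abs_sub_map_le_sub N x y).trans ((h _).trans ?_)
    rw [mul_assoc]
    exact mul_le_mul_of_nonneg_left (span_le_two_mul fun i => norm_le_pi_norm (x - y) i) hC
  exact h1.continuous

/-- On the compact set of vectors anchored at `s₀` with span one, `N` is continuous and positive, so
it has a positive minimum; homogeneity does the rest. The set is empty when there is only one state.
-/
theorem exists_span_le (N : Seminorm ℝ (S → ℝ))
    (h : ∀ x, N x = 0 ↔ ∃ c : ℝ, x = fun _ => c) :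
    ∃ c, 0 < c ∧ ∀ x, c * spanSeminorm x ≤ N x := by
  obtain ⟨s₀⟩ := ‹Nonempty S›
  have hc : ∀ c : ℝ, N (fun _ => c) = 0 := fun c => (h _).2 ⟨c, rfl⟩
  obtain ⟨C, hC, hle⟩ := exists_le_span N hc
  have hN := continuous_of_le_span N hC hle
  have hsp : Continuous (spanS S) := continuous_of_le_span (spanS S) zero_le_one fun x => by
    rw [one_mul, spanS_apply]
  set K : Set (S → ℝ) := {x | x s₀ = 0} ∩ {x | spanS S x = 1} with hK
  have hKc : IsCompact K := by
    refine Metric.isCompact_of_isClosed_isBounded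
      ((isClosed_eq (continuous_apply s₀) continuous_const).inter
        (isClosed_eq hsp continuous_const)) ?_
    refine (Metric.isBounded_Icc (fun _ => (-1 : ℝ)) (fun _ => 1)).subset ?_
    rintro x ⟨h0, h1⟩
    have h2 : ∀ s, |x s| ≤ 1 := fun s => by
      have := abs_sub_le_span x s s₀
      rwa [show x s₀ = 0 from h0, sub_zero, ← spanS_apply, show spanS S x = 1 from h1] at this
    exact ⟨fun s => (abs_le.1 (h2 s)).1, fun s => (abs_le.1 (h2 s)).2⟩
  have hnorm : ∀ x, spanSeminorm x ≠ 0 →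
      (spanSeminorm x)⁻¹ • (x - fun _ => x s₀) ∈ K ∧
        N ((spanSeminorm x)⁻¹ • (x - fun _ => x s₀)) = (spanSeminorm x)⁻¹ * N x := by
    intro x hx
    have h3 : N (x - fun _ => x s₀) = N x :=
      seminorm_congr_of_const N hc (c := -x s₀) fun i => by simp [sub_eq_add_neg]
    have h4 : spanS S (x - fun _ => x s₀) = spanS S x :=
      seminorm_congr_of_const (spanS S) span_const (c := -x s₀) fun i => by simp [sub_eq_add_neg]
    have h0 : 0 ≤ (spanSeminorm x)⁻¹ := inv_nonneg.2 (span_nonneg x)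
    refine ⟨⟨by simp, ?_⟩, ?_⟩
    · show spanS S _ = 1
      rw [map_smul_eq_mul, h4, Real.norm_of_nonneg h0, spanS_apply, inv_mul_cancel₀ hx]
    · rw [map_smul_eq_mul, h3, Real.norm_of_nonneg h0]
  rcases K.eq_empty_or_nonempty with hE | hE
  · refine ⟨1, one_pos, fun x => ?_⟩
    by_cases hx : spanSeminorm x = 0
    · rw [hx, mul_zero]; exact apply_nonneg N x
    · exact absurd (hE ▸ (hnorm x hx).1) (Set.notMem_empty _)
  · obtain ⟨y, hy, hmin⟩ := hKc.exists_isMinOn hE hN.continuousOn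
    have hy0 : 0 < N y := by
      refine lt_of_le_of_ne (apply_nonneg N y) fun h0 => ?_
      have h1 := span_eq_zero_iff.2 ((h y).1 h0.symm)
      have h2 : spanSeminorm y = 1 := hy.2
      linarith
    refine ⟨N y, hy0, fun x => ?_⟩
    by_cases hx : spanSeminorm x = 0
    · rw [hx, mul_zero]; exact apply_nonneg N x
    · obtain ⟨h1, h2⟩ := hnorm x hx
      have h3 : N y ≤ _ := hmin h1
      rw [h2] at h3
      have h4 : 0 < spanSeminorm x := lt_of_le_of_ne (span_nonneg x) (Ne.symm hx)
      rw [inv_mul_eq_div, le_div_iff₀ h4] at h3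
      exact h3

/-- The Euclidean norm of all differences of coordinates. -/
def diffSeminorm (S : Type u) [Fintype S] : Seminorm ℝ (S → ℝ) :=
  (normSeminorm ℝ (EuclideanSpace ℝ (S × S))).comp
    ((WithLp.linearEquiv 2 ℝ (S × S → ℝ)).symm.toLinearMap ∘ₗ
      (LinearMap.pi fun z : S × S =>
        LinearMap.proj (R := ℝ) (φ := fun _ : S => ℝ) z.1 - LinearMap.proj z.2 :
          (S → ℝ) →ₗ[ℝ] S × S → ℝ))

theorem diffSeminorm_sq {S : Type u} [Fintype S] (x : S → ℝ) :
    diffSeminorm S x ^ 2 = ∑ z : S × S, (x z.1 - x z.2) ^ 2 := by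
  simp [diffSeminorm, EuclideanSpace.norm_sq_eq]

theorem span_le_diffSeminorm (x : S → ℝ) : spanSeminorm x ≤ diffSeminorm S x := by
  refine span_le_iff.2 fun i j => abs_le_of_sq_le_sq' ?_ (apply_nonneg _ x) |>.2
  rw [diffSeminorm_sq]
  exact Finset.single_le_sum (f := fun z : S × S => (x z.1 - x z.2) ^ 2)
    (fun z _ => sq_nonneg _) (Finset.mem_univ (i, j))

theorem diffSeminorm_le (x : S → ℝ) : diffSeminorm S x ≤ Fintype.card S * spanSeminorm x := by
  have h0 := span_nonneg x
  refine abs_le_of_sq_le_sq' ?_ (by positivity) |>.2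
  rw [diffSeminorm_sq]
  calc ∑ z : S × S, (x z.1 - x z.2) ^ 2 ≤ ∑ _z : S × S, spanSeminorm x ^ 2 :=
        Finset.sum_le_sum fun z _ => sq_le_sq' (by linarith [sub_le_span x z.2 z.1])
          (sub_le_span x z.1 z.2)
    _ = _ := by simp; ring

/-- The Euclidean norm of coordinate differences is comparable to the span and, by the parallelogram
identity, smooth with `L = 1`. Once `μ` is small enough for `α₂ > 0`, `B` is the largest of the
three required ratios. -/
theorem exists_constantsAtMost (N : Seminorm ℝ (S → ℝ))
    (h : ∀ x, N x = 0 ↔ ∃ c : ℝ, x = fun _ => c) {γ : ℝ} (hγ0 : 0 < γ) (hγ1 : γ < 1) :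
    ∃ B, ConstantsAtMost N γ B := by
  obtain ⟨C, hC, hN1⟩ := exists_le_span N fun c => (h _).2 ⟨c, rfl⟩
  obtain ⟨c, hc, hN2⟩ := exists_span_le N h
  have hS : (0 : ℝ) < Fintype.card S := by exact_mod_cast Fintype.card_pos
  set l := c / Fintype.card S with hl
  have hl0 : 0 < l := by positivity
  -- Chosen so that `γ ^ 2 * (1 + μ * C ^ 2) < 1`, which makes `α₂` positive whatever `l` is.
  set μ := (1 - γ ^ 2) / (2 * (γ ^ 2 * C ^ 2 + 1)) with hμ
  have hγ2 : 0 < 1 - γ ^ 2 := by nlinarith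
  have hμ0 : 0 < μ := by positivity
  have hμ1 : γ ^ 2 * (μ * C ^ 2) < 1 - γ ^ 2 := by
    have h1 : γ ^ 2 * (μ * C ^ 2) = (1 - γ ^ 2) * (γ ^ 2 * C ^ 2 / (2 * (γ ^ 2 * C ^ 2 + 1))) := by
      rw [hμ]; field_simp
    rw [h1]
    refine mul_lt_of_lt_one_right hγ2 ?_
    rw [div_lt_one (by positivity)]
    have : 0 ≤ γ ^ 2 * C ^ 2 := by positivity
    linarith
  have hα : 0 < 1 - γ * √((1 + μ * C ^ 2) / (1 + μ * l ^ 2)) := by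
    have h1 : γ * √((1 + μ * C ^ 2) / (1 + μ * l ^ 2)) < 1 := by
      rw [← Real.sqrt_sq hγ0.le, ← Real.sqrt_mul (sq_nonneg γ), Real.sqrt_lt' one_pos, one_pow,
        ← mul_div_assoc, div_lt_one (by positivity)]
      have : 0 < μ * l ^ 2 := by positivity
      linarith
    linarith
  set α := 1 - γ * √((1 + μ * C ^ 2) / (1 + μ * l ^ 2))
  refine ⟨max (C / c) (max ((1 - γ) / α) ((1 + μ * C ^ 2) * (1 / μ) / l ^ 2)),
    diffSeminorm S, c, C, l, C, 1, μ, hc, hl0, hμ0, fun x => ⟨hN2 x, hN1 x⟩, fun x => ⟨?_, ?_⟩,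
    fun x y => ?_, ?_, ?_, ?_⟩
  · refine le_trans ?_ (hN2 x)
    rw [hl, div_mul_eq_mul_div, div_le_iff₀ hS]
    have := mul_le_mul_of_nonneg_left (diffSeminorm_le x) hc.le
    linarith
  · exact (hN1 x).trans (mul_le_mul_of_nonneg_left (span_le_diffSeminorm x) hC)
  · rw [diffSeminorm_sq, diffSeminorm_sq, diffSeminorm_sq, diffSeminorm_sq, Finset.mul_sum,
      Finset.mul_sum, ← Finset.sum_add_distrib, ← Finset.sum_add_distrib]
    refine Finset.sum_le_sum fun z _ => le_of_eq ?_
    simp only [Pi.add_apply, Pi.sub_apply]; ring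
  · rw [← div_le_iff₀ hc]; exact le_max_left _ _
  · rw [← div_le_iff₀ hα]; exact (le_max_left _ _).trans (le_max_right _ _)
  · rw [← div_le_iff₀ (by positivity)]; exact (le_max_right _ _).trans (le_max_right _ _)

/-- A smooth semi-norm, comparable to the span, in which every `γ`-contraction for `N` is still a
contraction. -/
theorem exists_smooth_seminorm {N : Seminorm ℝ (S → ℝ)} {γ B : ℝ} (hγ0 : 0 < γ) (hγ1 : γ < 1)
    (h : ∀ x, N x = 0 ↔ ∃ c : ℝ, x = fun _ => c) (hB : 1 ≤ B) (hC : ConstantsAtMost N γ B) :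
    ∃ (q : Seminorm ℝ (S → ℝ)) (γ' : ℝ), 0 ≤ γ' ∧ γ' < 1 ∧ 1 - γ ≤ B * (1 - γ') ∧
      (∀ x, spanSeminorm x ≤ q x) ∧ (∀ x, q x ≤ B ^ 2 * spanSeminorm x) ∧ IsSmooth q B ∧
      ∀ x y, N x ≤ γ * N y → q x ≤ γ' * q y := by
  obtain ⟨s, cP, CP, l, u, L, μ, hcP, hl, hμ, hN, hs, hL, hB1, hB2, hB3⟩ := hC
  have hB0 : 0 < B := by linarith
  -- If `N` vanishes, all spans vanish and the zero semi-norm works. Otherwise a vector with `N y₀ >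
  -- 0` yields `1 ≤ L` and `l ≤ u`.
  by_cases hz : ∀ x, N x = 0
  · have hsp : ∀ x, spanSeminorm x = 0 := fun x => span_eq_zero_iff.2 ((h x).1 (hz x))
    refine ⟨0, γ, hγ0.le, hγ1, le_mul_of_one_le_left (by linarith) hB, fun x => ?_, fun x => ?_,
      fun x y => by simp, fun x y _ => by simp⟩
    · rw [hsp]; simp
    · rw [hsp]; simp
  push Not at hz
  obtain ⟨y₀, hy₀⟩ := hz
  have hNy : 0 < N y₀ := lt_of_le_of_ne (apply_nonneg N y₀) (Ne.symm hy₀)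
  have hsy : 0 < s y₀ := by
    refine lt_of_le_of_ne (apply_nonneg s y₀) fun h0 => ?_
    have := (hs y₀).2
    rw [← h0, mul_zero] at this; linarith
  have hL1 : 1 ≤ L := by
    have h1 := hL 0 y₀
    rw [zero_add, zero_sub, map_neg_eq_map, map_zero] at h1
    have h2 : 0 < s y₀ ^ 2 := by positivity
    nlinarith
  have hlu : l ≤ u := le_of_mul_le_mul_right ((hs y₀).1.trans (hs y₀).2) hsy
  have hu : 0 < u := hl.trans_le hlu
  have hcl : 0 < 1 + μ * l ^ 2 := by positivity
  have hcu : 0 < 1 + μ * u ^ 2 := by positivity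
  have hlu2 : 1 + μ * l ^ 2 ≤ 1 + μ * u ^ 2 := by gcongr
  -- The third bound also controls the ratio `u / l`, because `(1 + μ * u ^ 2) * (L / μ) ≥ u ^ 2 *
  -- L`.
  have huB : u ^ 2 ≤ B * l ^ 2 := by
    refine le_trans ?_ hB3
    have h1 : (1 + μ * u ^ 2) * (L / μ) = L / μ + u ^ 2 * L := by field_simp
    have h2 : 0 ≤ L / μ := by positivity
    nlinarith [pow_pos hu 2]
  set p := moreauS N s (one_div_pos.2 hμ).le with hp
  have hp1 : ∀ x, N x ≤ √(1 + μ * u ^ 2) * p x := le_sqrt_mul_moreau hμ fun x => (hs x).2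
  have hp2 : ∀ x, √(1 + μ * l ^ 2) * p x ≤ N x := sqrt_mul_moreau_le hμ hl fun x => (hs x).1
  have hscl : 0 < √(1 + μ * l ^ 2) := Real.sqrt_pos.2 hcl
  have hscu : 0 < √(1 + μ * u ^ 2) := Real.sqrt_pos.2 hcu
  set γ' := γ * √((1 + μ * u ^ 2) / (1 + μ * l ^ 2)) with hγ'
  have hα : 0 < 1 - γ' := by
    by_contra hneg
    push Not at hneg
    nlinarith
  -- Normalisation of the envelope that makes it dominate the span; smoothness and contraction do
  -- not depend on scaling.
  set κ := √(1 + μ * u ^ 2) / cP with hκ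
  have hκ0 : 0 < κ := by positivity
  have hq : ∀ x, (κ.toNNReal • p) x = κ * p x := fun x => by
    rw [smul_apply, NNReal.smul_def, Real.coe_toNNReal _ hκ0.le, smul_eq_mul]
  refine ⟨κ.toNNReal • p, γ', by positivity, by linarith, hB2, fun x => ?_, fun x => ?_,
    fun x y => ?_, fun x y hxy => ?_⟩
  · rw [hq, hκ, div_mul_eq_mul_div, le_div_iff₀ hcP]
    linarith [(hN x).1, hp1 x]
  · have h0 := span_nonneg x
    have h1 : √(1 + μ * u ^ 2) ≤ B * √(1 + μ * l ^ 2) := by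
      rw [← Real.sqrt_sq hB0.le, ← Real.sqrt_mul (sq_nonneg B)]
      refine Real.sqrt_le_sqrt ?_
      have h2 : u ^ 2 ≤ B ^ 2 * l ^ 2 := huB.trans (by gcongr; nlinarith)
      have h3 : 1 ≤ B ^ 2 := by nlinarith
      nlinarith [mul_le_mul_of_nonneg_left h2 hμ.le]
    rw [hq, hκ, div_mul_eq_mul_div, div_le_iff₀ hcP]
    have hpx := apply_nonneg p x
    calc √(1 + μ * u ^ 2) * p x ≤ B * √(1 + μ * l ^ 2) * p x := by gcongr
      _ ≤ B * N x := by rw [mul_assoc]; exact mul_le_mul_of_nonneg_left (hp2 x) hB0.le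
      _ ≤ B * (CP * spanSeminorm x) := by gcongr; exact (hN x).2
      _ ≤ B * (B * cP * spanSeminorm x) := by gcongr
      _ = _ := by ring
  · simp only [hq]
    have h1 := moreau_smooth (one_div_pos.2 hμ).le hL x y (N := N)
    have h2 : (l * s y) ^ 2 ≤ (1 + μ * u ^ 2) * p y ^ 2 := by
      have h3 := (hs y).1.trans (hp1 y)
      have h4 := apply_nonneg s y
      calc (l * s y) ^ 2 ≤ (√(1 + μ * u ^ 2) * p y) ^ 2 := by gcongr
        _ = _ := by rw [mul_pow, Real.sq_sqrt hcu.le]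
    have h3 : L * (1 / μ) * s y ^ 2 ≤ B * p y ^ 2 := by
      have h4 : 0 < l ^ 2 := by positivity
      refine le_of_mul_le_mul_left ?_ h4
      calc l ^ 2 * (L * (1 / μ) * s y ^ 2) = L / μ * (l * s y) ^ 2 := by ring
        _ ≤ L / μ * ((1 + μ * u ^ 2) * p y ^ 2) := by gcongr
        _ = (1 + μ * u ^ 2) * (L / μ) * p y ^ 2 := by ring
        _ ≤ B * l ^ 2 * p y ^ 2 := by gcongr
        _ = _ := by ring
    have h5 : p (x + y) ^ 2 + p (x - y) ^ 2 ≤ 2 * p x ^ 2 + 2 * B * p y ^ 2 := by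
      have h6 : p (x + y) ^ 2 + p (x - y) ^ 2 ≤ 2 * p x ^ 2 + 2 * (L * (1 / μ)) * s y ^ 2 := h1
      linarith
    have h6 := mul_le_mul_of_nonneg_left h5 (sq_nonneg κ)
    linarith [h6]
  · rw [hq, hq]
    have h1 : p x ≤ γ' * p y := by
      refine le_of_mul_le_mul_left ?_ hscl
      calc √(1 + μ * l ^ 2) * p x ≤ γ * N y := (hp2 x).trans hxy
        _ ≤ γ * (√(1 + μ * u ^ 2) * p y) := by gcongr; exact hp1 y
        _ = _ := by
          rw [hγ', Real.sqrt_div hcu.le]; field_simp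
    calc κ * p x ≤ κ * (γ' * p y) := by gcongr
      _ = _ := by ring

end Constants

/-! ### Samplers -/

section Sampler

variable {S : Type u} {A : Type v} [Fintype S] [Fintype A]

/-- Every round of estimates is realised on a finite probability space, with conditional bias at
most `b` and conditional variance at most `σ2`, relative to the span of the value function. -/
def HasSampler (M : RobustMDP S A) (Nmax : ℕ) (b σ2 : ℝ) : Prop :=
  ∀ V : S → ℝ, ∃ (Ω : Type (max u v)) (_ : Fintype Ω) (P : PMF Ω) (X : Ω → S × A → ℝ × ℕ),
    sampleRound M Nmax V = P.map X ∧ ∀ sa : S × A,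
      ⨅ s, V s ≤ ev P (fun ω => (X ω sa).1) ∧ ev P (fun ω => (X ω sa).1) ≤ ⨆ s, V s ∧
      |ev P (fun ω => (X ω sa).1) - supportFn M.model (M.nominal sa.1 sa.2) V| ≤
        b * spanSeminorm V ∧
      ev P (fun ω => ((X ω sa).1 - ev P fun ω => (X ω sa).1) ^ 2) ≤ σ2 * spanSeminorm V ^ 2

theorem hasSampler_of_estimator {M : RobustMDP S A} {Nmax : ℕ} {b σ2 : ℝ}
    (h : ∀ V : S → ℝ, ∃ (Ω : Type u) (_ : Fintype Ω), ∀ p : PMF S, ∃ (P : PMF Ω) (Y : Ω → ℝ × ℕ),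
      supportEstimator M.model Nmax V p = P.map Y ∧
      ⨅ s, V s ≤ ev P (fun ω => (Y ω).1) ∧ ev P (fun ω => (Y ω).1) ≤ ⨆ s, V s ∧
      |ev P (fun ω => (Y ω).1) - supportFn M.model p V| ≤ b * spanSeminorm V ∧
      ev P (fun ω => ((Y ω).1 - ev P fun ω => (Y ω).1) ^ 2) ≤ σ2 * spanSeminorm V ^ 2) :
    HasSampler M Nmax b σ2 := by
  classical
  intro V
  obtain ⟨Ω, hΩ, hV⟩ := h V
  choose P Y h1 h2 using fun sa : S × A => hV (M.nominal sa.1 sa.2)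
  refine ⟨S × A → Ω, inferInstance, indepProduct P, fun ω sa => Y sa (ω sa), ?_, fun sa => ?_⟩
  · simp only [sampleRound, h1]
    exact indepProduct_map P Y
  · rw [ev_indepProduct_apply P sa fun x => (Y sa x).1,
      ev_indepProduct_apply P sa fun x => ((Y sa x).1 - ev (P sa) fun ω => (Y sa ω).1) ^ 2]
    exact h2 sa

theorem expect_roundCount (M : RobustMDP S A) (Nmax : ℕ) (V : S → ℝ) :
    expect (sampleRound M Nmax V) (fun d => (roundCount d : ℝ≥0∞)) =
      ∑ sa : S × A, expect (supportEstimator M.model Nmax V (M.nominal sa.1 sa.2))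
        fun y => (y.2 : ℝ≥0∞) := by
  simp only [roundCount, Nat.cast_sum]
  rw [expect_sum]
  exact Finset.sum_congr rfl fun sa _ =>
    expect_indepProduct_apply (α := ℝ × ℕ) _ sa fun y => (y.2 : ℝ≥0∞)

theorem ev_sub_le_span {Ω : Type*} [Fintype Ω] {P : PMF Ω} {f : Ω → ℝ} {V : S → ℝ}
    (h1 : ∀ ω, ⨅ s, V s ≤ f ω) (h2 : ∀ ω, f ω ≤ ⨆ s, V s) :
    ev P (fun ω => (f ω - ev P f) ^ 2) ≤ spanSeminorm V ^ 2 := by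
  refine ev_le_of_forall_le fun ω => ?_
  have h3 := le_ev_of_forall_le (P := P) h1
  have h4 := ev_le_of_forall_le (P := P) h2
  refine sq_le_sq' ?_ ?_ <;> rw [spanSeminorm] <;> linarith [h1 ω, h2 ω]

/-- The contamination support function is affine in the nominal law, so one sample is unbiased; its
values lie in the range of `V`, whence the variance bound. -/
theorem hasSampler_contamination [Nonempty S] {M : RobustMDP S A} {δ : ℝ}
    (hM : M.model = .contamination δ) (h0 : 0 ≤ δ) (h1 : δ < 1) (Nmax : ℕ) :
    HasSampler M Nmax 0 1 := by
  refine hasSampler_of_estimator fun V => ⟨S, inferInstance, fun p =>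
    ⟨p, fun x => ((1 - δ) * V x + δ * ⨅ y, V y, 1), by rw [hM]; rfl, ?_⟩⟩
  have hl : ∀ x, ⨅ s, V s ≤ (1 - δ) * V x + δ * ⨅ y, V y := fun x => by
    have := iInf_fin_le V x
    nlinarith
  have hu : ∀ x, (1 - δ) * V x + δ * ⨅ y, V y ≤ ⨆ s, V s := fun x => by
    have h2 := iInf_fin_le V x
    have h3 := le_iSup_fin V x
    nlinarith
  refine ⟨le_ev_of_forall_le hl, ev_le_of_forall_le hu, ?_, ?_⟩
  · rw [hM, supportFn_contamination h0 h1, ev_add, ev_mul_left, ev_const]; simp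
  · rw [one_mul]; exact ev_sub_le_span hl hu

theorem expect_roundCount_contamination {M : RobustMDP S A} {δ : ℝ}
    (hM : M.model = .contamination δ) (Nmax : ℕ) (V : S → ℝ) :
    expect (sampleRound M Nmax V) (fun d => (roundCount d : ℝ≥0∞)) =
      ENNReal.ofReal (Fintype.card S * Fintype.card A * 1) := by
  rw [expect_roundCount, hM]
  simp only [supportEstimator, expect_map, Nat.cast_one, expect_const]
  rw [mul_one, ENNReal.ofReal_mul (Nat.cast_nonneg _)]
  simp

end Sampler

/-! ### Empirical distributions -/

section Empirical

variable {S : Type u} [Fintype S]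

theorem ev_sum_sq {Ω : Type*} [Fintype Ω] (p : PMF Ω) (n : ℕ) {f : Ω → ℝ} (hf : ev p f = 0) :
    ev (indepProduct fun _ : Fin n => p) (fun X => (∑ i, f (X i)) ^ 2) =
      n * ev p fun x => f x ^ 2 := by
  classical
  simp only [sq, Finset.sum_mul_sum, ev_sum]
  have h : ∀ i j : Fin n, ev (indepProduct fun _ : Fin n => p) (fun X => f (X i) * f (X j)) =
      if i = j then ev p fun x => f x * f x else 0 := by
    intro i j
    split_ifs with hij
    · subst hij
      exact ev_indepProduct_apply (fun _ : Fin n => p) i fun x => f x * f x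
    · rw [ev_indepProduct_mul (fun _ : Fin n => p) hij, hf, zero_mul]
  simp [h]

theorem toReal_empirical [DecidableEq S] {n : ℕ} [NeZero n] (X : Fin n → S) (x : S) :
    ((empirical X) x).toReal = (1 / n) * ∑ i, if X i = x then 1 else 0 := by
  rw [empirical, toReal_map, ev, Finset.mul_sum]
  simp [PMF.uniformOfFintype_apply]

/-- Cauchy–Schwarz over the states costs a factor `card S`. Each coordinate is an average of centred
indicators with variance at most `p x / n`, and these sum to `1 / n`. -/
theorem ev_tvDist_empirical_sq_le (p : PMF S) (n : ℕ) [NeZero n] :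
    ev (indepProduct fun _ : Fin n => p) (fun X => tvDist (empirical X) p ^ 2) ≤
      Fintype.card S / (4 * n) := by
  classical
  have hn : (0 : ℝ) < n := by exact_mod_cast Nat.pos_of_ne_zero (NeZero.ne n)
  have h1 : ∀ X : Fin n → S, tvDist (empirical X) p ^ 2 ≤
      1 / 4 * (Fintype.card S * ∑ x, ((1 / n) * ∑ i, ((if X i = x then 1 else 0) - (p x).toReal)) ^ 2) := by
    intro X
    have h2 : ∀ x, ((empirical X) x).toReal - (p x).toReal =
        (1 / n) * ∑ i, ((if X i = x then 1 else 0) - (p x).toReal) := by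
      intro x
      rw [toReal_empirical, Finset.sum_sub_distrib, mul_sub]
      simp only [Finset.sum_const, Finset.card_univ, Fintype.card_fin, nsmul_eq_mul]
      field_simp
    rw [tvDist, mul_pow]
    have h3 := sq_sum_le_card_mul_sum_sq (s := Finset.univ)
      (f := fun x => |((empirical X) x).toReal - (p x).toReal|)
    simp only [sq_abs, Finset.card_univ, h2] at h3 ⊢
    linarith
  have h4 : ∀ x, ev p (fun y => (if y = x then (1 : ℝ) else 0) - (p x).toReal) = 0 := by
    intro x
    rw [ev_sub, ev_const]
    simp [ev]
  have h5 : ∀ x, ev p (fun y => ((if y = x then (1 : ℝ) else 0) - (p x).toReal) ^ 2) ≤ (p x).toReal := by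
    intro x
    have h6 := ev_sq_sub (P := p) (fun y => if y = x then (1 : ℝ) else 0) 0
    have h7 : ev p (fun y => if y = x then (1 : ℝ) else 0) = (p x).toReal := by simp [ev]
    have h8 : ev p (fun y => ((if y = x then (1 : ℝ) else 0) - 0) ^ 2) = (p x).toReal := by
      simp [ev]
    rw [h7, h8] at h6
    nlinarith [sq_nonneg ((p x).toReal)]
  refine (ev_mono h1).trans ?_
  rw [ev_mul_left, ev_mul_left, ev_sum]
  have h6 : ∀ x, ev (indepProduct fun _ : Fin n => p)
      (fun X => ((1 / n : ℝ) * ∑ i, ((if X i = x then 1 else 0) - (p x).toReal)) ^ 2) ≤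
      1 / n * (p x).toReal := by
    intro x
    simp only [mul_pow]
    rw [ev_mul_left, ev_sum_sq p n (h4 x)]
    have := h5 x
    calc (1 / (n : ℝ)) ^ 2 * (n * ev p fun y => ((if y = x then (1 : ℝ) else 0) - (p x).toReal) ^ 2)
        ≤ (1 / (n : ℝ)) ^ 2 * (n * (p x).toReal) := by gcongr
      _ = _ := by field_simp
  have h7 : ∑ x, ev (indepProduct fun _ : Fin n => p)
      (fun X => ((1 / n : ℝ) * ∑ i, ((if X i = x then 1 else 0) - (p x).toReal)) ^ 2) ≤ 1 / n := by
    refine (Finset.sum_le_sum fun x _ => h6 x).trans_eq ?_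
    rw [← Finset.mul_sum, sum_toReal, mul_one]
  calc _ ≤ 1 / 4 * ((Fintype.card S : ℝ) * (1 / n)) := by gcongr
    _ = _ := by field_simp

variable [Nonempty S] {U : UncertaintyModel S} {w : S → S → ℝ} {κ : ℝ}

theorem ev_supportFn_empirical_sq_le (hU : IsTransportBall U w κ) (p : PMF S) (V : S → ℝ) (n : ℕ)
    [NeZero n] :
    ev (indepProduct fun _ : Fin n => p)
      (fun X => (supportFn U (empirical X) V - supportFn U p V) ^ 2) ≤
      Fintype.card S / (4 * n) * spanSeminorm V ^ 2 := by
  calc _ ≤ ev (indepProduct fun _ : Fin n => p)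
        (fun X => tvDist (empirical X) p ^ 2 * spanSeminorm V ^ 2) := by
        refine ev_mono fun X => ?_
        rw [← mul_pow, ← sq_abs]
        have := abs_supportFn_sub_le hU p (empirical X) V
        gcongr
    _ ≤ _ := by
        rw [ev_mul_right]
        have := ev_tvDist_empirical_sq_le p n
        gcongr

end Empirical

/-! ### The truncated geometric law -/

section Geometric

/-- The truncated geometric law on its range. -/
def truncGeomFin (Nmax : ℕ) : PMF (Fin (Nmax + 1)) :=
  (truncGeom Nmax).map fun n => ⟨min n Nmax, by omega⟩

theorem truncGeomFin_map (Nmax : ℕ) : (truncGeomFin Nmax).map Fin.val = truncGeom Nmax := by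
  rw [truncGeomFin, truncGeom, PMF.map_comp, PMF.map_comp]
  congr 1; ext n; simp

theorem truncGeomFin_apply (Nmax : ℕ) (i : Fin (Nmax + 1)) :
    truncGeomFin Nmax i = truncGeom Nmax i := by
  classical
  rw [← truncGeomFin_map, PMF.map_apply, tsum_eq_single i]
  · simp
  · intro j hj
    rw [if_neg fun h => hj (Fin.ext h).symm]

theorem truncGeom_toReal_of_lt {Nmax n : ℕ} (h : n < Nmax) :
    (truncGeom Nmax n).toReal = (1 / 2) ^ (n + 1) := by
  classical
  have h1 : truncGeom Nmax n =
      (ProbabilityTheory.geometricMeasure ⟨1 / 2, by norm_num, by norm_num⟩).toPMF n := by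
    rw [truncGeom, PMF.map_apply, tsum_eq_single n]
    · rw [if_pos (by omega)]
    · intro k hk
      rw [if_neg (by omega)]
  rw [h1, MeasureTheory.Measure.toPMF_apply, ProbabilityTheory.geometricMeasure_singleton,
    ENNReal.toReal_ofReal]
  · rw [pow_succ]; norm_num
  · exact ProbabilityTheory.geometricMeasure_nonneg _ _
  · intro h0
    have := congrArg Subtype.val h0
    norm_num at this

/-- The truncation level carries the whole geometric tail, twice the untruncated weight; its value
follows from the total mass. -/
theorem truncGeom_toReal_self (Nmax : ℕ) : (truncGeom Nmax Nmax).toReal = (1 / 2) ^ Nmax := by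
  have h1 := sum_toReal (truncGeomFin Nmax)
  rw [Fin.sum_univ_castSucc] at h1
  have h2 : ∀ i : Fin Nmax, (truncGeomFin Nmax i.castSucc).toReal = (1 / 2) ^ ((i : ℕ) + 1) := by
    intro i
    rw [truncGeomFin_apply]
    exact truncGeom_toReal_of_lt i.2
  rw [Finset.sum_congr rfl fun i _ => h2 i, truncGeomFin_apply] at h1
  have h3 : ∀ n : ℕ, ∑ i : Fin n, (1 / 2 : ℝ) ^ ((i : ℕ) + 1) = 1 - (1 / 2) ^ n := by
    intro n
    induction n with
    | zero => simp
    | succ n ih =>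
      rw [Fin.sum_univ_castSucc]
      simp only [Fin.val_castSucc, Fin.val_last]
      rw [ih, pow_succ]; ring
  rw [h3, Fin.val_last] at h1
  linarith

theorem le_truncGeom_toReal (Nmax : ℕ) (i : Fin (Nmax + 1)) :
    (1 / 2) ^ ((i : ℕ) + 1) ≤ (truncGeom Nmax i).toReal := by
  rcases Nat.lt_succ_iff_lt_or_eq.1 i.2 with h | h
  · rw [truncGeom_toReal_of_lt h]
  · rw [h, truncGeom_toReal_self, pow_succ]
    have : (0 : ℝ) < (1 / 2) ^ Nmax := by positivity
    linarith

/-- Each level below the truncation contributes exactly `1` to the expected sample size, and the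
truncation level contributes `2`. -/
theorem ev_truncGeomFin_pow (Nmax : ℕ) :
    ev (truncGeomFin Nmax) (fun i => (2 : ℝ) ^ ((i : ℕ) + 1)) = Nmax + 2 := by
  simp only [ev, truncGeomFin_apply]
  rw [Fin.sum_univ_castSucc]
  have h2 : ∀ i : Fin Nmax, (truncGeom Nmax (i.castSucc : ℕ)).toReal * 2 ^ ((i.castSucc : ℕ) + 1) = 1 := by
    intro i
    rw [Fin.val_castSucc, truncGeom_toReal_of_lt i.2, ← mul_pow]; norm_num
  rw [Finset.sum_congr rfl fun i _ => h2 i, Fin.val_last, truncGeom_toReal_self, pow_succ, ← mul_assoc,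
    ← mul_pow]
  simp

end Geometric

/-! ### The multi-level Monte Carlo estimator -/

section MLMC

variable {S : Type u} [Fintype S]

/-- The sample space of the multi-level estimator: a level and the samples drawn at it. -/
abbrev MlmcSpace (S : Type u) (Nmax : ℕ) : Type u :=
  Σ i : Fin (Nmax + 1), (Fin (2 ^ ((i : ℕ) + 1)) → S)

/-- The law of the level and of the samples. -/
def mlmcLaw (Nmax : ℕ) (p : PMF S) : PMF (MlmcSpace S Nmax) :=
  (truncGeomFin Nmax).bind fun i =>
    (indepProduct fun _ : Fin (2 ^ ((i : ℕ) + 1)) => p).map (Sigma.mk i)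

/-- The estimator as a function on its sample space. -/
def mlmcOut (U : UncertaintyModel S) (Nmax : ℕ) (V : S → ℝ) (x : MlmcSpace S Nmax) : ℝ × ℕ :=
  (mlmcValue U Nmax V x.1 x.2, 2 ^ ((x.1 : ℕ) + 1))

theorem mlmcEstimator_eq_map (U : UncertaintyModel S) (Nmax : ℕ) (V : S → ℝ) (p : PMF S) :
    mlmcEstimator U Nmax V p = (mlmcLaw Nmax p).map (mlmcOut U Nmax V) := by
  rw [mlmcEstimator, mlmcLaw, ← truncGeomFin_map, PMF.bind_map, PMF.map_bind]
  congr 1; ext1 i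
  rw [PMF.map_comp]; rfl

theorem ev_mlmcLaw [DecidableEq S] (Nmax : ℕ) (p : PMF S) (f : MlmcSpace S Nmax → ℝ) :
    ev (mlmcLaw Nmax p) f = ev (truncGeomFin Nmax) fun i =>
      ev (indepProduct fun _ : Fin (2 ^ ((i : ℕ) + 1)) => p) fun X => f ⟨i, X⟩ := by
  simp only [mlmcLaw, ev_bind, ev_map]

/-- Mean of the plug-in estimate of the support function from `2 ^ k` samples. -/
def plugInMean (U : UncertaintyModel S) (V : S → ℝ) (p : PMF S) (k : ℕ) : ℝ :=
  ev (indepProduct fun _ : Fin (2 ^ k) => p) fun X => supportFn U (empirical X) V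

theorem plugInMean_zero (U : UncertaintyModel S) (V : S → ℝ) (p : PMF S) :
    plugInMean U V p 0 = ev p fun x => supportFn U (PMF.pure x) V := by
  have h1 : ∀ X : Fin (2 ^ 0) → S, empirical X = PMF.pure (X 0) := by
    intro X
    rw [empirical, show X = Function.const _ (X 0) from funext fun i => by
      rw [Function.const_apply]; congr 1; exact Subsingleton.elim (α := Fin 1) _ _, PMF.map_const]
    rfl
  simp only [plugInMean, h1]
  exact ev_indepProduct_apply (fun _ : Fin (2 ^ 0) => p) 0 fun x => supportFn U (PMF.pure x) V

theorem injective_even (n : ℕ) :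
    Function.Injective fun i : Fin (2 ^ n) => (⟨2 * i, two_mul_lt i⟩ : Fin (2 ^ (n + 1))) := by
  intro i j h
  have := congrArg Fin.val h
  exact Fin.ext (by simpa using this)

theorem injective_odd (n : ℕ) :
    Function.Injective fun i : Fin (2 ^ n) => (⟨2 * i + 1, two_mul_add_one_lt i⟩ : Fin (2 ^ (n + 1))) := by
  intro i j h
  have := congrArg Fin.val h
  exact Fin.ext (by simpa using this)

theorem ev_even (p : PMF S) (n : ℕ) (f : (Fin (2 ^ n) → S) → ℝ) :
    ev (indepProduct fun _ : Fin (2 ^ (n + 1)) => p) (fun X => f fun i => X ⟨2 * i, two_mul_lt i⟩) =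
      ev (indepProduct fun _ : Fin (2 ^ n) => p) f := by
  classical
  exact ev_indepProduct_comp p _ (injective_even n) f

theorem ev_odd (p : PMF S) (n : ℕ) (f : (Fin (2 ^ n) → S) → ℝ) :
    ev (indepProduct fun _ : Fin (2 ^ (n + 1)) => p)
      (fun X => f fun i => X ⟨2 * i + 1, two_mul_add_one_lt i⟩) =
      ev (indepProduct fun _ : Fin (2 ^ n) => p) f := by
  classical
  exact ev_indepProduct_comp p _ (injective_odd n) f

/-- The level corrections telescope. -/
theorem ev_mlmcOut (U : UncertaintyModel S) (Nmax : ℕ) (V : S → ℝ) (p : PMF S) :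
    ev (mlmcLaw Nmax p) (fun x => (mlmcOut U Nmax V x).1) = plugInMean U V p (Nmax + 1) := by
  classical
  rw [ev_mlmcLaw]
  -- Both halves of the sample at level `i` are independent samples of size `2 ^ i`, so the mean
  -- correction is a difference of consecutive plug-in means. Averaging over the level cancels the
  -- division by its probability.
  have h1 : ∀ i : Fin (Nmax + 1), ev (indepProduct fun _ : Fin (2 ^ ((i : ℕ) + 1)) => p)
      (fun X => (mlmcOut U Nmax V ⟨i, X⟩).1) = plugInMean U V p 0 +
        (plugInMean U V p (i + 1) - plugInMean U V p i) / (truncGeom Nmax i).toReal := by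
    intro i
    simp only [mlmcOut, mlmcValue, div_eq_mul_inv]
    rw [ev_add, ev_mul_right, ev_sub, ev_mul_left, ev_add,
      ev_odd p i fun X => supportFn U (empirical X) V, ev_even p i fun X => supportFn U (empirical X) V,
      ev_indepProduct_apply (fun _ : Fin (2 ^ ((i : ℕ) + 1)) => p) 0 fun x => supportFn U (PMF.pure x) V,
      ← plugInMean_zero]
    simp only [plugInMean]; ring
  simp only [h1]
  rw [ev_add, ev_const]
  have h2 : ev (truncGeomFin Nmax) (fun i =>
      (plugInMean U V p (i + 1) - plugInMean U V p i) / (truncGeom Nmax i).toReal) =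
      ∑ i : Fin (Nmax + 1), (plugInMean U V p (i + 1) - plugInMean U V p i) := by
    refine Finset.sum_congr rfl fun i _ => ?_
    have h3 := le_truncGeom_toReal Nmax i
    have h4 : (truncGeom Nmax i).toReal ≠ 0 := by
      have : (0 : ℝ) < (1 / 2) ^ ((i : ℕ) + 1) := by positivity
      linarith
    rw [truncGeomFin_apply, mul_div_cancel₀ _ h4]
  rw [h2, Fin.sum_univ_eq_sum_range (fun i => plugInMean U V p (i + 1) - plugInMean U V p i),
    Finset.sum_range_sub]
  ring

variable [Nonempty S] {U : UncertaintyModel S} {w : S → S → ℝ} {κ : ℝ}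

theorem abs_plugInMean_sub_le (hU : IsTransportBall U w κ) (V : S → ℝ) (p : PMF S) (k : ℕ) :
    |plugInMean U V p (k + 1) - supportFn U p V| ≤
      √(Fintype.card S) * √((1 / 2) ^ k) * spanSeminorm V := by
  have h1 : plugInMean U V p (k + 1) - supportFn U p V =
      ev (indepProduct fun _ : Fin (2 ^ (k + 1)) => p)
        fun X => supportFn U (empirical X) V - supportFn U p V := by
    rw [ev_sub, ev_const]; rfl
  have h2 := (sq_ev_le _).trans (ev_supportFn_empirical_sq_le hU p V (2 ^ (k + 1)))
  rw [← h1] at h2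
  have h0 := span_nonneg V
  refine abs_le_of_sq_le_sq (h2.trans ?_) (by positivity)
  rw [mul_pow, mul_pow, Real.sq_sqrt (by positivity), Real.sq_sqrt (by positivity)]
  gcongr
  push_cast
  rw [div_pow, one_pow, mul_one_div]
  gcongr
  rw [pow_succ]
  have : (0 : ℝ) < 2 ^ k := by positivity
  linarith

/-- At level `i` the squared correction has mean of order `card S * 2 ^ (-i)` times the squared
span. It is divided by the squared probability of the level and weighted by that probability, which
is at least `2 ^ (-(i + 1))`. Each level thus contributes a bounded amount, and the total is linear
in the number of levels. -/
theorem ev_mlmcOut_sq_le (hU : IsTransportBall U w κ)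
    (hl : ∀ p : PMF S, ∀ V : S → ℝ, ⨅ s, V s ≤ supportFn U p V ∧ supportFn U p V ≤ ⨆ s, V s)
    (Nmax : ℕ) (V : S → ℝ) (p : PMF S) :
    ev (mlmcLaw Nmax p) (fun x => ((mlmcOut U Nmax V x).1 - supportFn U p V) ^ 2) ≤
      6 * Fintype.card S * (Nmax + 1) * spanSeminorm V ^ 2 := by
  classical
  set σ := supportFn U p V with hσ
  set R := spanSeminorm V with hR
  have hR0 : 0 ≤ R := span_nonneg V
  have hcard : (1 : ℝ) ≤ Fintype.card S := by exact_mod_cast Fintype.card_pos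
  rw [ev_mlmcLaw]
  have hlev : ∀ k : ℕ, ev (indepProduct fun _ : Fin (2 ^ k) => p)
      (fun X => (supportFn U (empirical X) V - σ) ^ 2) ≤ Fintype.card S * R ^ 2 * (1 / 2) ^ k / 4 := by
    intro k
    refine (ev_supportFn_empirical_sq_le hU p V (2 ^ k)).trans_eq ?_
    push_cast
    rw [div_pow, one_pow, ← hR]; field_simp
  have h1 : ∀ i : Fin (Nmax + 1), ev (indepProduct fun _ : Fin (2 ^ ((i : ℕ) + 1)) => p)
      (fun X => ((mlmcOut U Nmax V ⟨i, X⟩).1 - σ) ^ 2) ≤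
      2 * R ^ 2 + 2 * (Fintype.card S * R ^ 2 * (1 / 2) ^ (i : ℕ)) *
        ((truncGeom Nmax i).toReal ^ 2)⁻¹ := by
    intro i
    set G := (truncGeom Nmax i).toReal
    have h2 : ∀ X : Fin (2 ^ ((i : ℕ) + 1)) → S, ((mlmcOut U Nmax V ⟨i, X⟩).1 - σ) ^ 2 ≤
        2 * R ^ 2 + 2 * (2 * (supportFn U (empirical X) V - σ) ^ 2 +
          ((supportFn U (empirical fun j : Fin (2 ^ (i : ℕ)) =>
              X ⟨2 * j + 1, two_mul_add_one_lt j⟩) V - σ) ^ 2 +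
            (supportFn U (empirical fun j : Fin (2 ^ (i : ℕ)) => X ⟨2 * j, two_mul_lt j⟩) V - σ) ^ 2)) *
          (G ^ 2)⁻¹ := by
      intro X
      simp only [mlmcOut, mlmcValue]
      generalize supportFn U (empirical X) V = a
      generalize supportFn U (empirical fun j : Fin (2 ^ (i : ℕ)) =>
              X ⟨2 * j + 1, two_mul_add_one_lt j⟩) V = b
      generalize supportFn U (empirical fun j : Fin (2 ^ (i : ℕ)) => X ⟨2 * j, two_mul_lt j⟩) V = c
      have h3 : (supportFn U (PMF.pure (X 0)) V - σ) ^ 2 ≤ R ^ 2 := by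
        have h4 := hl (PMF.pure (X 0)) V
        have h5 := hl p V
        refine sq_le_sq' ?_ ?_ <;> rw [hR, spanSeminorm] <;> linarith [h4.1, h4.2, h5.1, h5.2]
      generalize supportFn U (PMF.pure (X 0)) V = e at h3
      -- The true value `σ` cancels in the level correction, so only the three plug-in errors
      -- remain.
      have h4 : ((a - 1 / 2 * (b + c)) / G) ^ 2 ≤
          (2 * (a - σ) ^ 2 + ((b - σ) ^ 2 + (c - σ) ^ 2)) * (G ^ 2)⁻¹ := by
        rw [div_pow, div_eq_mul_inv]
        refine mul_le_mul_of_nonneg_right ?_ (by positivity)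
        nlinarith [sq_nonneg (2 * (a - σ) + (b - σ) + (c - σ)), sq_nonneg (b - c)]
      nlinarith [sq_nonneg (e - σ - (a - 1 / 2 * (b + c)) / G)]
    refine (ev_mono h2).trans ?_
    simp only [mul_assoc]
    rw [ev_add, ev_const, ev_mul_left, ev_mul_right, ev_add, ev_mul_left, ev_add,
      ev_odd p i fun X => (supportFn U (empirical X) V - σ) ^ 2,
      ev_even p i fun X => (supportFn U (empirical X) V - σ) ^ 2]
    have h5 := hlev i
    have h6 := hlev ((i : ℕ) + 1)
    have h7 : 0 ≤ (Fintype.card S : ℝ) * R ^ 2 * (1 / 2) ^ (i : ℕ) := by positivity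
    have h11 : (Fintype.card S : ℝ) * R ^ 2 * (1 / 2) ^ ((i : ℕ) + 1) =
        Fintype.card S * R ^ 2 * (1 / 2) ^ (i : ℕ) / 2 := by rw [pow_succ (1 / 2 : ℝ)]; ring
    have h8 : 0 ≤ (G ^ 2)⁻¹ := by positivity
    have h9 : 2 * ev (indepProduct fun _ : Fin (2 ^ ((i : ℕ) + 1)) => p)
        (fun X => (supportFn U (empirical X) V - σ) ^ 2) +
        (ev (indepProduct fun _ : Fin (2 ^ (i : ℕ)) => p)
          (fun X => (supportFn U (empirical X) V - σ) ^ 2) +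
        ev (indepProduct fun _ : Fin (2 ^ (i : ℕ)) => p)
          (fun X => (supportFn U (empirical X) V - σ) ^ 2)) ≤
        (Fintype.card S : ℝ) * R ^ 2 * (1 / 2) ^ (i : ℕ) := by linarith
    have h10 := mul_le_mul_of_nonneg_right h9 h8
    linarith
  refine (ev_mono h1).trans ?_
  rw [ev_add, ev_const]
  have h2 : ev (truncGeomFin Nmax) (fun i => 2 * (Fintype.card S * R ^ 2 * (1 / 2) ^ (i : ℕ)) *
        ((truncGeom Nmax i).toReal ^ 2)⁻¹) ≤ ∑ _i : Fin (Nmax + 1), 4 * (Fintype.card S * R ^ 2) := by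
    refine Finset.sum_le_sum fun i _ => ?_
    rw [truncGeomFin_apply]
    have h3 := le_truncGeom_toReal Nmax i
    have h4 : (0 : ℝ) < (1 / 2) ^ ((i : ℕ) + 1) := by positivity
    have h5 : 0 < (truncGeom Nmax i).toReal := h4.trans_le h3
    set G := (truncGeom Nmax i).toReal
    have h6 : G * (2 * (Fintype.card S * R ^ 2 * (1 / 2) ^ (i : ℕ)) * (G ^ 2)⁻¹) =
        4 * (Fintype.card S * R ^ 2) * ((1 / 2) ^ ((i : ℕ) + 1) / G) := by
      rw [pow_succ (1 / 2 : ℝ)]; field_simp; ring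
    rw [h6]
    refine mul_le_of_le_one_right (by positivity) ?_
    rwa [div_le_one h5]
  simp only [Finset.sum_const, Finset.card_univ, Fintype.card_fin, nsmul_eq_mul] at h2
  push_cast at h2
  have h3 : R ^ 2 ≤ Fintype.card S * R ^ 2 := le_mul_of_one_le_left (sq_nonneg R) hcard
  have h4 : (0 : ℝ) ≤ Nmax := Nat.cast_nonneg _
  have h5 : (0 : ℝ) ≤ Nmax * (Fintype.card S * R ^ 2) := by positivity
  nlinarith

variable {A : Type v} [Fintype A]

/-- The mean of the estimator is an average of support functions and therefore lies in the range of
`V`, although individual values need not. This property is what the analysis without a bias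
condition relies on. -/
theorem hasSampler_mlmc {M : RobustMDP S A} (hU : IsTransportBall M.model w κ)
    (hA : Admissible M.model)
    (hM : ∀ Nmax V p, supportEstimator M.model Nmax V p = mlmcEstimator M.model Nmax V p) (Nmax : ℕ) :
    HasSampler M Nmax (√(Fintype.card S) * √((1 / 2) ^ Nmax)) (6 * Fintype.card S * (Nmax + 1)) := by
  classical
  have hl : ∀ p : PMF S, ∀ V : S → ℝ,
      ⨅ s, V s ≤ supportFn M.model p V ∧ supportFn M.model p V ≤ ⨆ s, V s :=
    fun p V => ⟨iInf_le_supportFn hA p V, supportFn_le_iSup hA p V⟩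
  refine hasSampler_of_estimator fun V => ⟨MlmcSpace S Nmax, inferInstance, fun p =>
    ⟨mlmcLaw Nmax p, mlmcOut M.model Nmax V, ?_, ?_, ?_, ?_, ?_⟩⟩
  · rw [hM, mlmcEstimator_eq_map]
  · rw [ev_mlmcOut]; exact le_ev_of_forall_le fun X => (hl _ V).1
  · rw [ev_mlmcOut]; exact ev_le_of_forall_le fun X => (hl _ V).2
  · rw [ev_mlmcOut]; exact abs_plugInMean_sub_le hU V p Nmax
  · exact (ev_variance_le _ _).trans (ev_mlmcOut_sq_le hU hl Nmax V p)

theorem expect_roundCount_mlmc {M : RobustMDP S A}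
    (hM : ∀ Nmax V p, supportEstimator M.model Nmax V p = mlmcEstimator M.model Nmax V p) (Nmax : ℕ)
    (V : S → ℝ) : expect (sampleRound M Nmax V) (fun d => (roundCount d : ℝ≥0∞)) =
      ENNReal.ofReal (Fintype.card S * Fintype.card A * (Nmax + 2)) := by
  rw [expect_roundCount]
  have h1 : ∀ sa : S × A, expect (supportEstimator M.model Nmax V (M.nominal sa.1 sa.2))
      (fun y => (y.2 : ℝ≥0∞)) = ENNReal.ofReal (Nmax + 2) := by
    intro sa
    rw [hM, mlmcEstimator, ← truncGeomFin_map, PMF.bind_map, expect_bind]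
    simp only [Function.comp_apply, expect_map, expect_const]
    rw [← ev_truncGeomFin_pow, ← expect_ofReal _ fun i => by positivity]
    congr 1; ext i
    rw [← ENNReal.ofReal_natCast]; push_cast; rfl
  rw [Finset.sum_congr rfl fun sa _ => h1 sa, ENNReal.ofReal_mul (by positivity)]
  simp [ENNReal.ofReal_mul]

end MLMC

/-! ### Estimates of the robust Bellman operator -/

section Rounds

variable {S : Type u} {A : Type v} [Fintype S] [Fintype A]

/-- Every round is realised on a finite probability space, with bounds on the range of the mean,
the bias and the variance of the estimate of the robust Bellman operator. -/
def HasBellmanSampler (M : RobustMDP S A) (π : S → PMF A) (Nmax : ℕ) (R b σ2 : ℝ) : Prop :=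
  ∀ V : S → ℝ, ∃ (Ω : Type (max u v)) (_ : Fintype Ω) (P : PMF Ω) (X : Ω → S × A → ℝ × ℕ)
    (m : S → ℝ), sampleRound M Nmax V = P.map X ∧ ∀ s : S,
      ev P (fun ω => bellmanEstimate M π 0 (X ω) s) = m s ∧
      (⨅ s, V s) - R ≤ m s ∧ m s ≤ (⨆ s, V s) + R ∧
      |m s - robustBellman M π 0 V s| ≤ b * spanSeminorm V ∧
      ev P (fun ω => (bellmanEstimate M π 0 (X ω) s - m s) ^ 2) ≤ σ2 * spanSeminorm V ^ 2

theorem HasSampler.hasBellmanSampler {M : RobustMDP S A} {Nmax : ℕ} {b σ2 R : ℝ}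
    (h : HasSampler M Nmax b σ2) (hR : ∀ s a, |M.reward s a| ≤ R) (π : S → PMF A) :
    HasBellmanSampler M π Nmax R b σ2 := by
  intro V
  obtain ⟨Ω, hΩ, P, X, h1, h2⟩ := h V
  have hest : ∀ (d : S × A → ℝ × ℕ) s, bellmanEstimate M π 0 d s =
      ev (π s) fun a => M.reward s a + (d (s, a)).1 := by
    intro d s; simp only [bellmanEstimate, sub_zero]; rfl
  have hm : ∀ s, ev P (fun ω => bellmanEstimate M π 0 (X ω) s) =
      ev (π s) fun a => M.reward s a + ev P fun ω => (X ω (s, a)).1 := by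
    intro s
    simp only [hest]
    rw [ev_comm]
    simp only [ev_add, ev_const]
  refine ⟨Ω, hΩ, P, X, fun s => ev (π s) fun a => M.reward s a + ev P fun ω => (X ω (s, a)).1, h1,
    fun s => ⟨hm s, ?_, ?_, ?_, ?_⟩⟩
  · refine le_ev_of_forall_le fun a => ?_
    linarith [(h2 (s, a)).1, (abs_le.1 (hR s a)).1]
  · refine ev_le_of_forall_le fun a => ?_
    linarith [(h2 (s, a)).2.1, (abs_le.1 (hR s a)).2]
  · have h3 : robustBellman M π 0 V s =
        ev (π s) fun a => M.reward s a + supportFn M.model (M.nominal s a) V := by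
      simp only [robustBellman, sub_zero]; rfl
    rw [h3, ← ev_sub]
    refine (abs_ev_le _).trans (ev_le_of_forall_le fun a => ?_)
    have h4 := (h2 (s, a)).2.2.1
    simpa using h4
  · simp only [hest, ← ev_sub]
    refine (ev_mono fun ω => sq_ev_le _).trans ?_
    rw [ev_comm]
    refine ev_le_of_forall_le fun a => ?_
    refine le_trans (le_of_eq ?_) (h2 (s, a)).2.2.2
    congr 1; funext ω; ring

/-! ### The second phase -/

/-- With step sizes `1 / (t + 1)`, the quantity `T * (g_T - c)` is a sum of centred independent
residuals, so each round adds at most `v` to the second moment. -/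
theorem expect_rewardPhase_sq_le (M : RobustMDP S A) (π : S → PMF A) (Nmax : ℕ) (V : S → ℝ)
    {c v : ℝ} (hv : 0 ≤ v)
    (h : ∀ x k : ℝ, expect (sampleRound M Nmax V)
      (fun d => ENNReal.ofReal ((x + k * (residualEstimate M π V d - c)) ^ 2)) ≤
        ENNReal.ofReal (x ^ 2 + k ^ 2 * v)) (T : ℕ) :
    expect (rewardPhase M π (fun t => 1 / ((t : ℝ) + 1)) Nmax V T)
      (fun z => ENNReal.ofReal ((T * (z.1 - c)) ^ 2)) ≤ ENNReal.ofReal (T * v) := by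
  induction T with
  | zero => simp [rewardPhase, expect_pure]
  | succ T ih =>
    rw [rewardPhase, expect_bind]
    have h1 : ∀ z : ℝ × ℕ, expect ((sampleRound M Nmax V).map fun d =>
        (z.1 + 1 / ((T : ℝ) + 1) * (residualEstimate M π V d - z.1), z.2 + roundCount d))
        (fun z => ENNReal.ofReal ((((T + 1 : ℕ) : ℝ) * (z.1 - c)) ^ 2)) ≤
        ENNReal.ofReal ((T * (z.1 - c)) ^ 2) + ENNReal.ofReal v := by
      intro z
      rw [expect_map, ← ENNReal.ofReal_add (by positivity) hv]
      refine le_trans (le_of_eq ?_) ((h (T * (z.1 - c)) 1).trans_eq (by ring_nf))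
      congr 1; funext d
      congr 2
      push_cast
      field_simp
      ring
    refine (expect_mono h1).trans ?_
    rw [expect_add, expect_const]
    refine (add_le_add_left ih _).trans_eq ?_
    rw [← ENNReal.ofReal_add (by positivity) hv]
    congr 1; push_cast; ring

/-! ### The first phase -/


/-- A discrete Gronwall argument: `F` is a time-dependent Lyapunov function and `y` a supersolution
of the scalar recursion. Both regimes of the first phase are instances. -/
theorem expect_valuePhase_le {M : RobustMDP S A} {π : S → PMF A} {s₀ : S} {η : ℕ → ℝ} {Nmax : ℕ}
    {V₀ : S → ℝ} {F : ℕ → (S → ℝ) → ℝ} {k c y : ℕ → ℝ} (hF : ∀ t V, 0 ≤ F t V)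
    (hk : ∀ t, 0 ≤ k t) (hc : ∀ t, 0 ≤ c t) (hy0 : F 0 V₀ ≤ y 0)
    (hy : ∀ t, k t * y t + c t ≤ y (t + 1))
    (h : ∀ t V, expect (sampleRound M Nmax V)
      (fun d => ENNReal.ofReal (F (t + 1) (valueUpdate M π s₀ (η t) 0 V d))) ≤
        ENNReal.ofReal (k t * F t V + c t)) (T : ℕ) :
    expect (valuePhase M π s₀ η Nmax V₀ T) (fun z => ENNReal.ofReal (F T z.1)) ≤
      ENNReal.ofReal (y T) := by
  have hyn : ∀ t, 0 ≤ y t := by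
    intro t
    induction t with
    | zero => exact (hF 0 V₀).trans hy0
    | succ t ih => exact le_trans (add_nonneg (mul_nonneg (hk t) ih) (hc t)) (hy t)
  induction T with
  | zero => rw [valuePhase, expect_pure]; exact ENNReal.ofReal_le_ofReal hy0
  | succ T ih =>
    rw [valuePhase, expect_bind]
    have h1 : ∀ z : (S → ℝ) × ℕ, expect ((sampleRound M Nmax z.1).map fun d =>
        (valueUpdate M π s₀ (η T) 0 z.1 d, z.2 + roundCount d))
        (fun z => ENNReal.ofReal (F (T + 1) z.1)) ≤
        ENNReal.ofReal (k T) * ENNReal.ofReal (F T z.1) + ENNReal.ofReal (c T) := by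
      intro z
      rw [expect_map, ← ENNReal.ofReal_mul (hk T),
        ← ENNReal.ofReal_add (mul_nonneg (hk T) (hF T z.1)) (hc T)]
      exact h T z.1
    refine (expect_mono h1).trans ?_
    rw [expect_add, expect_const, expect_mul_left]
    refine (add_le_add_left (mul_le_mul_right ih _) _).trans ?_
    rw [← ENNReal.ofReal_mul (hk T), ← ENNReal.ofReal_add (mul_nonneg (hk T) (hyn T)) (hc T)]
    exact ENNReal.ofReal_le_ofReal (hy T)

/-! ### Sample counts -/

theorem expectedSamples_le {M : RobustMDP S A} {π : S → PMF A} {s₀ : S} {η β : ℕ → ℝ} {Nmax : ℕ}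
    {V₀ : S → ℝ} {k : ℝ}
    (h : ∀ V, expect (sampleRound M Nmax V) (fun d => (roundCount d : ℝ≥0∞)) = ENNReal.ofReal k)
    (T : ℕ) : expectedSamples M π s₀ η β Nmax V₀ T ≤ ENNReal.ofReal (2 * T * k) := by
  have h1 : expect (valuePhase M π s₀ η Nmax V₀ T) (fun z => (z.2 : ℝ≥0∞)) = T * ENNReal.ofReal k := by
    induction T with
    | zero => simp [valuePhase, expect_pure]
    | succ T ih =>
      rw [valuePhase, expect_bind]
      simp only [expect_map, Nat.cast_add, expect_add, expect_const, h, ih]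
      push_cast; ring
  have h2 : ∀ V, expect (rewardPhase M π β Nmax V T) (fun z => (z.2 : ℝ≥0∞)) = T * ENNReal.ofReal k := by
    intro V
    clear h1
    induction T with
    | zero => simp [rewardPhase, expect_pure]
    | succ T ih =>
      rw [rewardPhase, expect_bind]
      simp only [expect_map, Nat.cast_add, expect_add, expect_const, h, ih]
      push_cast; ring
  rw [expectedSamples, robustTD, expect_bind]
  simp only [expect_map, Nat.cast_add, expect_add, expect_const, h1, h2]
  rw [mul_assoc, ENNReal.ofReal_mul (by norm_num), ENNReal.ofReal_mul (by positivity),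
    ENNReal.ofReal_natCast, ENNReal.ofReal_ofNat, two_mul]

/-! ### The estimation error -/

variable [DecidableEq S] [Nonempty S]

/-- For fixed `V` the averages fluctuate around the mean residual `c` at rate `√(σ2 / T)`. The
distance from `c` to `g` consists of the bias of the estimate and the Bellman residual of `V`,
bounded by the span of `V - V'`. -/
theorem HasBellmanSampler.expect_rewardPhase_le {M : RobustMDP S A} {π : S → PMF A} {Nmax : ℕ}
    {R b σ2 : ℝ} (hM : HasBellmanSampler M π Nmax R b σ2) (hU : Admissible M.model)
    (hσ : 0 ≤ σ2) {V' : S → ℝ} {g : ℝ}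
    (hV' : ∀ s, robustBellman M π 0 V' s = V' s + g) (V : S → ℝ) {T : ℕ} (hT : 1 ≤ T) :
    expect (rewardPhase M π (fun t => 1 / ((t : ℝ) + 1)) Nmax V T)
      (fun z => ENNReal.ofReal |z.1 - g|) ≤
      ENNReal.ofReal (spanSeminorm (V - V') + (b + √(σ2 / T)) * spanSeminorm V) := by
  obtain ⟨Ω, hΩ, P, X, m, h1, h2⟩ := hM V
  have hcard : (0 : ℝ) < Fintype.card S := by exact_mod_cast Fintype.card_pos
  set U := PMF.uniformOfFintype S
  have hU' : ∀ f : S → ℝ, ev U f = (1 / (Fintype.card S : ℝ)) * ∑ s, f s := by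
    intro f; simp [ev, U, Finset.mul_sum]
  set c := ev U fun s => m s - V s with hc
  have h0 := span_nonneg V
  have hres : ∀ ω, residualEstimate M π V (X ω) = ev U fun s => bellmanEstimate M π 0 (X ω) s - V s :=
    fun ω => by rw [residualEstimate, hU']
  have hmean : ev P (fun ω => residualEstimate M π V (X ω) - c) = 0 := by
    rw [ev_sub, ev_const]
    simp only [hres]
    rw [ev_comm, hc, ← ev_sub]
    simp only [ev_sub, ev_const, fun s => (h2 s).1]
    ring
  have hvar : ev P (fun ω => (residualEstimate M π V (X ω) - c) ^ 2) ≤ σ2 * spanSeminorm V ^ 2 := by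
    simp only [hres, hc, ← ev_sub]
    refine (ev_mono fun ω => sq_ev_le _).trans ?_
    rw [ev_comm]
    refine ev_le_of_forall_le fun s => ?_
    refine le_trans (le_of_eq ?_) (h2 s).2.2.2.2
    congr 1; funext ω; ring
  have h3 := expect_rewardPhase_sq_le M π Nmax V (c := c) (v := σ2 * spanSeminorm V ^ 2)
    (by positivity) (fun x k => by
      rw [h1, expect_map, expect_ofReal P fun ω => sq_nonneg _]
      refine ENNReal.ofReal_le_ofReal ?_
      have h4 : ∀ ω, (x + k * (residualEstimate M π V (X ω) - c)) ^ 2 =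
          x ^ 2 + 2 * x * k * (residualEstimate M π V (X ω) - c) +
            k ^ 2 * (residualEstimate M π V (X ω) - c) ^ 2 := fun ω => by ring
      simp only [h4]
      rw [ev_add, ev_add, ev_const, ev_mul_left, ev_mul_left, hmean]
      have := mul_le_mul_of_nonneg_left hvar (sq_nonneg k)
      linarith) T
  have hT0 : (0 : ℝ) < T := by exact_mod_cast hT
  have h4 : expect (rewardPhase M π (fun t => 1 / ((t : ℝ) + 1)) Nmax V T)
      (fun z => ENNReal.ofReal (|z.1 - c|)) ≤ ENNReal.ofReal (√(σ2 / T) * spanSeminorm V) := by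
    refine expect_le_of_sq (by positivity) ?_
    have h5 : (fun z : ℝ × ℕ => ENNReal.ofReal (|z.1 - c| ^ 2)) = fun z =>
        ENNReal.ofReal (1 / (T : ℝ) ^ 2) * ENNReal.ofReal ((T * (z.1 - c)) ^ 2) := by
      funext z
      rw [← ENNReal.ofReal_mul (by positivity), sq_abs]
      congr 1; field_simp
    rw [h5, expect_mul_left]
    refine (mul_le_mul_right h3 _).trans ?_
    rw [← ENNReal.ofReal_mul (by positivity)]
    refine ENNReal.ofReal_le_ofReal (le_of_eq ?_)
    rw [mul_pow, Real.sq_sqrt (by positivity)]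
    field_simp
  have h6 : |c - g| ≤ spanSeminorm (V - V') + b * spanSeminorm V := by
    rw [hc, ← ev_const (P := U) g, ← ev_sub]
    refine (abs_ev_le _).trans (ev_le_of_forall_le fun s => ?_)
    have h7 := (h2 s).2.2.2.1
    -- Both `T V - T V'` and `V - V'` take values between the minimum and the maximum of `V - V'`,
    -- so they differ by at most the span.
    have h8 : |robustBellman M π 0 V s - robustBellman M π 0 V' s - (V - V') s| ≤
        spanSeminorm (V - V') := by
      have h9 := abs_robustBellman_sub_le M π hU (V₁ := V) (V₂ := V')
        (fun s => le_iSup_fin (V - V') s) s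
      have h10 := abs_robustBellman_sub_le M π hU (V₁ := V') (V₂ := V) (c := -⨅ s, (V - V') s)
        (fun s => by have := iInf_fin_le (V - V') s; simp only [Pi.sub_apply] at this ⊢; linarith) s
      have h11 := le_iSup_fin (V - V') s
      have h12 := iInf_fin_le (V - V') s
      rw [abs_le, spanSeminorm]
      constructor <;> linarith
    have h9 : m s - V s - g = (m s - robustBellman M π 0 V s) +
        (robustBellman M π 0 V s - robustBellman M π 0 V' s - (V - V') s) := by
      rw [hV' s, Pi.sub_apply]; ring
    rw [h9]
    exact (abs_add_le _ _).trans (by linarith)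
  have h7 : ∀ z : ℝ × ℕ, ENNReal.ofReal |z.1 - g| ≤ ENNReal.ofReal |z.1 - c| +
      ENNReal.ofReal (spanSeminorm (V - V') + b * spanSeminorm V) := by
    intro z
    rw [← ENNReal.ofReal_add (abs_nonneg _) ((abs_nonneg _).trans h6)]
    refine ENNReal.ofReal_le_ofReal ?_
    have := abs_sub_le z.1 c g
    linarith
  refine (expect_mono h7).trans ?_
  rw [expect_add, expect_const]
  refine (add_le_add_left h4 _).trans_eq ?_
  rw [← ENNReal.ofReal_add (by positivity) ((abs_nonneg _).trans h6)]
  congr 1; ring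

theorem HasBellmanSampler.expectedError_le {M : RobustMDP S A} {π : S → PMF A} {Nmax : ℕ}
    {R b σ2 : ℝ} (hM : HasBellmanSampler M π Nmax R b σ2) (hU : Admissible M.model)
    (hb : 0 ≤ b) (hσ : 0 ≤ σ2) {V' : S → ℝ} {g : ℝ}
    (hV' : ∀ s, robustBellman M π 0 V' s = V' s + g) (s₀ : S) (η : ℕ → ℝ) (V₀ : S → ℝ) {T : ℕ}
    (hT : 1 ≤ T) {e₁ e₂ : ℝ} (he₁ : 0 ≤ e₁) (he₂ : 0 ≤ e₂)
    (h₁ : expect (valuePhase M π s₀ η Nmax V₀ T) (fun z => ENNReal.ofReal (spanSeminorm (z.1 - V')))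
      ≤ ENNReal.ofReal e₁)
    (h₂ : expect (valuePhase M π s₀ η Nmax V₀ T) (fun z => ENNReal.ofReal (spanSeminorm z.1))
      ≤ ENNReal.ofReal e₂) :
    expectedError M π s₀ η (fun t => 1 / ((t : ℝ) + 1)) Nmax V₀ T g ≤
      ENNReal.ofReal (e₁ + (b + √(σ2 / T)) * e₂) := by
  rw [expectedError, robustTD, expect_bind]
  simp only [expect_map]
  have hk : 0 ≤ b + √(σ2 / T) := by positivity
  have h3 : ∀ z : (S → ℝ) × ℕ, expect (rewardPhase M π (fun t => 1 / ((t : ℝ) + 1)) Nmax z.1 T)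
      (fun x => ENNReal.ofReal |x.1 - g|) ≤ ENNReal.ofReal (spanSeminorm (z.1 - V')) +
        ENNReal.ofReal (b + √(σ2 / T)) * ENNReal.ofReal (spanSeminorm z.1) := by
    intro z
    rw [← ENNReal.ofReal_mul hk, ← ENNReal.ofReal_add (span_nonneg _) (mul_nonneg hk (span_nonneg _))]
    exact hM.expect_rewardPhase_le hU hσ hV' z.1 hT
  refine (expect_mono h3).trans ?_
  rw [expect_add, expect_mul_left, ENNReal.ofReal_add he₁ (mul_nonneg hk he₂), ENNReal.ofReal_mul hk]
  gcongr

end Rounds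

/-! ### First phase: bias below the contraction gap -/

section SmallBias

variable {S : Type u} {A : Type v} [Fintype S] [Fintype A]

/-- A crude passage from coordinatewise variances to `q`; the factor `card S` is harmless because it
is bounded in terms of the problem constants later. -/
theorem ev_seminorm_sq_le [Nonempty S] {q : Seminorm ℝ (S → ℝ)} {D v : ℝ}
    (hq : ∀ x, q x ≤ D * spanSeminorm x) {Ω : Type*} [Fintype Ω] (P : PMF Ω)
    {w : Ω → S → ℝ} (hw : ∀ s, ev P (fun ω => w ω s ^ 2) ≤ v) :
    ev P (fun ω => q (w ω) ^ 2) ≤ 4 * D ^ 2 * Fintype.card S * v := by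
  have h1 : ∀ ω, q (w ω) ^ 2 ≤ 4 * D ^ 2 * ∑ s, w ω s ^ 2 := by
    intro ω
    have h2 : ∀ i, |w ω i| ≤ √(∑ s, w ω s ^ 2) := fun i =>
      Real.abs_le_sqrt (Finset.single_le_sum (fun s _ => sq_nonneg (w ω s)) (Finset.mem_univ i))
    have h3 := span_le_two_mul h2
    have h4 := Real.sq_sqrt (Finset.sum_nonneg fun s _ => sq_nonneg (w ω s) :
      0 ≤ ∑ s, w ω s ^ 2)
    calc q (w ω) ^ 2 ≤ (D * spanSeminorm (w ω)) ^ 2 := by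
          have := apply_nonneg q (w ω); have := hq (w ω); gcongr
      _ = D ^ 2 * spanSeminorm (w ω) ^ 2 := by ring
      _ ≤ D ^ 2 * (2 * √(∑ s, w ω s ^ 2)) ^ 2 := by
          have := span_nonneg (w ω); gcongr
      _ = 4 * D ^ 2 * ∑ s, w ω s ^ 2 := by rw [mul_pow, h4]; ring
  refine (ev_mono h1).trans ?_
  rw [ev_mul_left, ev_sum, mul_assoc _ (Fintype.card S : ℝ)]
  gcongr
  refine (Finset.sum_le_sum fun s _ => hw s).trans_eq ?_
  simp

variable [Nonempty S]

/-- One step of the first phase, for a bias that is small compared with the contraction. -/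
theorem HasBellmanSampler.expect_valueUpdate_sq_le {M : RobustMDP S A} {π : S → PMF A} {Nmax : ℕ}
    {R b σ2 : ℝ} (hM : HasBellmanSampler M π Nmax R b σ2) (hσ : 0 ≤ σ2) {V' : S → ℝ} {g : ℝ}
    (hV' : ∀ s, robustBellman M π 0 V' s = V' s + g) {q : Seminorm ℝ (S → ℝ)}
    {L D γ h β τ η : ℝ} (hL : 0 ≤ L) (hD : 0 ≤ D) (hq : IsSmooth q L)
    (hq1 : ∀ x, spanSeminorm x ≤ q x) (hq2 : ∀ x, q x ≤ D * spanSeminorm x)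
    (hT : ∀ V₁ V₂, q (robustBellman M π 0 V₁ - robustBellman M π 0 V₂) ≤ γ * q (V₁ - V₂))
    (hγ : γ = 1 - 2 * h) (hh : 0 ≤ h) (hbh : 2 * D * b ≤ h) (hβ : 2 * D * b * τ ≤ h * β)
    (hb : 0 ≤ b) (hτ : spanSeminorm V' ≤ τ)
    (hη0 : 0 ≤ η) (hη1 : η * h ≤ 1) (hη2 : η ≤ 1) (s₀ : S) (V : S → ℝ) :
    expect (sampleRound M Nmax V)
      (fun d => ENNReal.ofReal (q (valueUpdate M π s₀ η 0 V d - V') ^ 2)) ≤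
      ENNReal.ofReal ((1 - η * h + 32 * L * D ^ 2 * Fintype.card S * σ2 * η ^ 2) * q (V - V') ^ 2 +
        (η * h * β ^ 2 + 32 * L * D ^ 2 * Fintype.card S * σ2 * η ^ 2 * τ ^ 2)) := by
  obtain ⟨Ω, hΩ, P, X, m, h1, h2⟩ := hM V
  have hqc : ∀ c : ℝ, q (fun _ => c) = 0 := fun c =>
    le_antisymm ((hq2 _).trans_eq (by rw [span_const, mul_zero])) (apply_nonneg _ _)
  rw [h1, expect_map, expect_ofReal P fun ω => sq_nonneg _]
  refine ENNReal.ofReal_le_ofReal ?_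
  set x := V - V' with hx
  set y : S → ℝ := fun s => x s + η * (m s - V s) with hy
  set w : Ω → S → ℝ := fun ω s => η * (bellmanEstimate M π 0 (X ω) s - m s) with hw
  have h3 : ∀ ω, q (valueUpdate M π s₀ η 0 V (X ω) - V') = q (y + w ω) := fun ω =>
    seminorm_congr_of_const q hqc
      (c := -(V s₀ + η * (bellmanEstimate M π 0 (X ω) s₀ - V s₀))) fun s => by
        simp only [valueUpdate, hy, hw, hx, Pi.sub_apply, Pi.add_apply]; ring
  simp only [h3]
  have hx0 : 0 ≤ q x := apply_nonneg q x
  have hτ0 : 0 ≤ τ := (span_nonneg V').trans hτ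
  have hV : spanSeminorm V ≤ q x + τ := by
    have h4 := map_add_le_add (spanS S) x V'
    rw [hx, sub_add_cancel] at h4
    simp only [spanS_apply] at h4
    linarith [hq1 (V - V')]
  have hV0 := span_nonneg V
  -- The contraction provides a gap `2 h`. Half of it absorbs the part of the bias proportional to
  -- the current error; the part due to the span of `V'` is left as the drift towards `β`.
  have hqy : q y ≤ (1 - η * h) * q x + η * h * β := by
    have h4 : q (m - robustBellman M π 0 V) ≤ h * q x + h * β := by
      have h5 := span_le_two_mul (x := m - robustBellman M π 0 V) fun s => (h2 s).2.2.2.1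
      calc q (m - robustBellman M π 0 V) ≤ D * spanSeminorm (m - robustBellman M π 0 V) := hq2 _
        _ ≤ D * (2 * (b * spanSeminorm V)) := by gcongr
        _ = 2 * D * b * spanSeminorm V := by ring
        _ ≤ 2 * D * b * (q x + τ) := by gcongr
        _ ≤ h * q x + h * β := by nlinarith
    have h5 : q y = q ((1 - η) • x + (η • (robustBellman M π 0 V - robustBellman M π 0 V') +
        η • (m - robustBellman M π 0 V))) :=
      seminorm_congr_of_const q hqc (c := η * g) fun s => by
        simp only [hy, hx, Pi.sub_apply, Pi.add_apply, Pi.smul_apply, smul_eq_mul, hV' s]; ring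
    rw [h5]
    refine (map_add_le_add q _ _).trans ((add_le_add_right (map_add_le_add q _ _) _).trans ?_)
    rw [map_smul_eq_mul, map_smul_eq_mul, map_smul_eq_mul, Real.norm_of_nonneg hη0,
      Real.norm_of_nonneg (sub_nonneg.2 hη2)]
    have h6 := mul_le_mul_of_nonneg_left h4 hη0
    have h7 := mul_le_mul_of_nonneg_left (hT V V') hη0
    rw [← hx, hγ] at h7
    linarith
  -- Convexity of the square for the weights `1 - η h` and `η h`.
  have hqy2 : q y ^ 2 ≤ (1 - η * h) * q x ^ 2 + η * h * β ^ 2 := by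
    have h4 : q y ^ 2 ≤ ((1 - η * h) * q x + η * h * β) ^ 2 := by
      have := apply_nonneg q y; gcongr
    have h5 : 0 ≤ η * h := mul_nonneg hη0 hh
    nlinarith [mul_nonneg (mul_nonneg h5 (sub_nonneg.2 hη1)) (sq_nonneg (q x - β))]
  have hw0 : ∀ s, ev P (fun ω => w ω s) = 0 := by
    intro s
    simp only [hw]
    rw [ev_mul_left, ev_sub, ev_const, (h2 s).1]; ring
  have hw2 : ∀ s, ev P (fun ω => w ω s ^ 2) ≤ η ^ 2 * (σ2 * spanSeminorm V ^ 2) := by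
    intro s
    simp only [hw, mul_pow]
    rw [ev_mul_left]
    exact mul_le_mul_of_nonneg_left (h2 s).2.2.2.2 (sq_nonneg η)
  have h4 := hq.ev_sq_le hL P y w hw0
  have h5 := mul_le_mul_of_nonneg_left (ev_seminorm_sq_le hq2 P hw2) (by positivity : 0 ≤ 4 * L)
  -- The noise scales with the span of `V`, hence with the error itself plus `τ`; its multiplicative
  -- part is what the large offset in the step size has to control.
  have h6 : 4 * L * (4 * D ^ 2 * Fintype.card S * (η ^ 2 * (σ2 * spanSeminorm V ^ 2))) ≤
      4 * L * (4 * D ^ 2 * Fintype.card S * (η ^ 2 * (σ2 * (2 * (q x ^ 2 + τ ^ 2))))) := by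
    gcongr
    exact (pow_le_pow_left₀ hV0 hV 2).trans (by nlinarith [sq_nonneg (q x - τ)])
  linarith

/-- The first phase, for a bias that is small compared with the contraction. -/
theorem HasBellmanSampler.expect_valuePhase_sq_le {M : RobustMDP S A} {π : S → PMF A} {Nmax : ℕ}
    {R b σ2 : ℝ} (hM : HasBellmanSampler M π Nmax R b σ2) (hσ : 0 ≤ σ2) {V' : S → ℝ} {g : ℝ}
    (hV' : ∀ s, robustBellman M π 0 V' s = V' s + g) {q : Seminorm ℝ (S → ℝ)}
    {L D γ h β τ G H K : ℝ} (hL : 0 ≤ L) (hD : 0 ≤ D) (hq : IsSmooth q L)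
    (hq1 : ∀ x, spanSeminorm x ≤ q x) (hq2 : ∀ x, q x ≤ D * spanSeminorm x)
    (hT : ∀ V₁ V₂, q (robustBellman M π 0 V₁ - robustBellman M π 0 V₂) ≤ γ * q (V₁ - V₂))
    (hγ : γ = 1 - 2 * h) (hh : 0 < h) (hbh : 2 * D * b ≤ h) (hβ : 2 * D * b * τ ≤ h * β)
    (hb : 0 ≤ b) (hτ : spanSeminorm V' ≤ τ) (hh1 : h ≤ 1)
    (hG : G = 16 * (32 * L * D ^ 2 * Fintype.card S * σ2) * τ ^ 2 / h ^ 2)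
    (hK : K = 4 / h + 8 * (32 * L * D ^ 2 * Fintype.card S * σ2) / h ^ 2)
    (V₀ : S → ℝ) (hH : H = G + K * q (V₀ - V') ^ 2) (s₀ : S) (T : ℕ) :
    expect (valuePhase M π s₀ (fun t => 4 / h / ((t : ℝ) + K)) Nmax V₀ T)
      (fun z => ENNReal.ofReal (q (z.1 - V') ^ 2)) ≤
      ENNReal.ofReal (2 * β ^ 2 + H / (T + K)) := by
  set A' := 32 * L * D ^ 2 * Fintype.card S * σ2 with hA
  have hA0 : 0 ≤ A' := by positivity
  have hK4 : 4 / h ≤ K := by rw [hK]; exact le_add_of_nonneg_right (by positivity)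
  have hKA : 8 * A' / h ^ 2 ≤ K := by rw [hK]; exact le_add_of_nonneg_left (by positivity)
  have h4 : 4 ≤ 4 / h := by rw [le_div_iff₀ hh]; linarith
  have hK0 : 0 < K := by linarith
  have hG0 : 0 ≤ G := by rw [hG]; positivity
  have hGH : G ≤ H := by rw [hH]; exact le_add_of_nonneg_right (by positivity)
  -- Steps `(4 / h) / (t + K)` give a drift `4 / (t + K)`. Half of it dominates the multiplicative
  -- noise, because `K ≥ 8 A' / h ^ 2`, and the other half gives the factor `1 - 2 / (t + K)`. The
  -- supersolution has `2 β ^ 2` as its floor, and `H` is large enough for the initial error (`K * q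
  -- ^ 2`) and for the additive noise (`G`).
  refine expect_valuePhase_le (F := fun _ V => q (V - V') ^ 2) (k := fun t => 1 - 2 / (t + K))
    (c := fun t => 4 * β ^ 2 / (t + K) + G / (t + K) ^ 2) (y := fun t => 2 * β ^ 2 + H / (t + K))
    (fun _ _ => sq_nonneg _) (fun t => ?_) (fun t => by positivity) ?_ (fun t => ?_)
    (fun t V => ?_) T
  · have : (0 : ℝ) ≤ t := Nat.cast_nonneg _
    rw [sub_nonneg, div_le_one (by positivity)]
    linarith
  · simp only [Nat.cast_zero, zero_add]
    rw [hH, add_div, mul_div_cancel_left₀ _ hK0.ne']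
    have : 0 ≤ G / K := by positivity
    nlinarith [sq_nonneg β]
  · have ht : (0 : ℝ) ≤ t := Nat.cast_nonneg _
    push_cast
    set n : ℝ := t + K with hn
    have hn0 : 0 < n := by positivity
    rw [show (t : ℝ) + 1 + K = n + 1 by rw [hn]; ring]
    have h5 : (1 - 2 / n) * (2 * β ^ 2 + H / n) + (4 * β ^ 2 / n + G / n ^ 2) =
        2 * β ^ 2 + (H / n - (2 * H - G) / n ^ 2) := by field_simp; ring
    have h6 : H / n - H / n ^ 2 ≤ H / (n + 1) := by
      rw [div_sub_div _ _ hn0.ne' (by positivity), div_le_div_iff₀ (by positivity) (by positivity)]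
      nlinarith [mul_nonneg (hG0.trans hGH) hn0.le]
    have h7 : H / n ^ 2 ≤ (2 * H - G) / n ^ 2 := by gcongr; linarith
    linarith
  · have ht : (0 : ℝ) ≤ t := Nat.cast_nonneg _
    set n : ℝ := t + K with hn
    have hn0 : 0 < n := by positivity
    have hnK : K ≤ n := by rw [hn]; linarith
    have hηn : 4 / h / n ≤ 1 := by rw [div_le_one hn0]; linarith
    have h5 := hM.expect_valueUpdate_sq_le hσ hV' hL hD hq hq1 hq2 hT hγ hh.le hbh hβ hb hτ
      (η := 4 / h / n) (by positivity) (mul_le_one₀ hηn hh.le hh1) hηn s₀ V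
    rw [← hA] at h5
    refine h5.trans (ENNReal.ofReal_le_ofReal ?_)
    refine add_le_add (mul_le_mul_of_nonneg_right ?_ (sq_nonneg _)) (le_of_eq ?_)
    · have h6 : 4 / h / n * h = 4 / n := by field_simp
      have h7 : A' * (4 / h / n) ^ 2 = 2 * (8 * A' / h ^ 2) / n / n := by field_simp; ring
      have h8 : 2 * (8 * A' / h ^ 2) / n / n ≤ 2 / n := by
        gcongr
        rw [div_le_iff₀ hn0]; linarith
      rw [h6, h7]
      have h9 : 4 / n = 2 / n + 2 / n := by ring
      linarith
    · rw [hG]; field_simp; ring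

end SmallBias

/-! ### First phase: arbitrary bias -/

section LargeBias

variable {S : Type u} {A : Type v} [Fintype S] [Fintype A]

/-- A regularisation of the span semi-norm that measures a component `M` of the argument by its
Euclidean norm. -/
def spanEnvelope (lam : ℝ) (V : S → ℝ) : ℝ :=
  ⨅ M : S → ℝ, √(spanSeminorm (V - M) ^ 2 + lam * ∑ s, M s ^ 2)

theorem spanEnvelope_le (lam : ℝ) (V M : S → ℝ) :
    spanEnvelope lam V ≤ √(spanSeminorm (V - M) ^ 2 + lam * ∑ s, M s ^ 2) :=
  ciInf_le ⟨0, by rintro _ ⟨z, rfl⟩; exact Real.sqrt_nonneg _⟩ M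

theorem spanEnvelope_nonneg (lam : ℝ) (V : S → ℝ) : 0 ≤ spanEnvelope lam V :=
  le_ciInf fun _ => Real.sqrt_nonneg _

theorem le_mul_spanEnvelope {lam a c : ℝ} {V : S → ℝ} (hc : 0 ≤ c)
    (h : ∀ M, a ≤ c * √(spanSeminorm (V - M) ^ 2 + lam * ∑ s, M s ^ 2)) :
    a ≤ c * spanEnvelope lam V := by
  rw [spanEnvelope, Real.mul_iInf_of_nonneg hc]
  exact le_ciInf h

theorem sqrt_add_one_le {r : ℝ} (hr : 1 ≤ r) : √(r ^ 2 + 1) ≤ r * (1 + 1 / r ^ 2 / 2) := by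
  refine (Real.sqrt_le_left (by positivity)).2 ?_
  have h1 : (r * (1 + 1 / r ^ 2 / 2)) ^ 2 = r ^ 2 + 1 + (1 / r / 2) ^ 2 := by
    field_simp; ring
  rw [h1]
  linarith [sq_nonneg (1 / r / 2)]

/-- The span is not smooth: noise of size `η` could raise it by order `η` in each step, and the sum
would diverge too fast. So noise is stored in a component of Euclidean norm `m`, damped by `1 - η`
per step and charged with a weight of order `r`, while `u` is the span of the rest. With `η = r⁻²`
and `e = r⁻³`, the cross term `4 η u m` splits into `e u ^ 2` and a multiple of `r η m ^ 2` which
the damping pays for, and the noise costs weight times `η ^ 2`, again of order `e`. The growth per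
step is then summable, since `r ^ 2` is linear in time. -/
theorem envelope_drift_sq {r η e A l u m : ℝ} (hr : 1 ≤ r) (hη0 : 0 ≤ η) (hη1 : η ≤ 1)
    (he : e * r = η) (hl1 : l ≤ 16 * (r * (1 + η / 2)))
    (he2 : η ^ 2 * r = e) (hA : 0 ≤ A) :
    (u + 2 * (η * m)) ^ 2 + l * ((1 - η) ^ 2 * m ^ 2 + A * η ^ 2 * (u + 2 * m) ^ 2) ≤
      (1 + (1 + 64 * A) * e) * (u ^ 2 + 16 * r * m ^ 2) := by
  have hr0 : 0 < r := by linarith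
  have he0 : 0 ≤ e := he2 ▸ by positivity
  have heη : e ≤ η := he ▸ le_mul_of_one_le_right he0 hr
  have hl2 : l ≤ 32 * r := hl1.trans (by nlinarith)
  have h3 : (u + 2 * (η * m)) ^ 2 ≤ u ^ 2 + e * u ^ 2 + 4 * η * r * m ^ 2 + 4 * η ^ 2 * m ^ 2 := by
    have h5 : u ^ 2 + e * u ^ 2 + 4 * η * r * m ^ 2 + 4 * η ^ 2 * m ^ 2 - (u + 2 * (η * m)) ^ 2 =
        e * (u - 2 * r * m) ^ 2 := by rw [← he]; ring
    linarith [mul_nonneg he0 (sq_nonneg (u - 2 * r * m))]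
  have h4 : l * ((1 - η) ^ 2 * m ^ 2) ≤ 16 * r * m ^ 2 - 16 * r * η * m ^ 2 := by
    have h5 : l * (1 - η) ^ 2 ≤ 16 * (r * (1 + η / 2)) * (1 - η) ^ 2 :=
      mul_le_mul_of_nonneg_right hl1 (sq_nonneg _)
    have h6 : (1 + η / 2) * (1 - η) ^ 2 ≤ 1 - η := by
      have : 1 - η - (1 + η / 2) * (1 - η) ^ 2 = η * ((1 - η) * (1 + η)) / 2 := by ring
      linarith [mul_nonneg hη0 (mul_nonneg (sub_nonneg.2 hη1) (by linarith : 0 ≤ 1 + η))]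
    have h7 := mul_le_mul_of_nonneg_left h6 (by positivity : 0 ≤ 16 * r)
    have h8 := mul_le_mul_of_nonneg_right (h5.trans_eq (by ring) |>.trans h7) (sq_nonneg m)
    linarith
  have h5 : l * (A * η ^ 2 * (u + 2 * m) ^ 2) ≤ 64 * A * e * u ^ 2 + 256 * A * e * m ^ 2 := by
    have h7 : (u + 2 * m) ^ 2 ≤ 2 * u ^ 2 + 8 * m ^ 2 := by
      linarith [sq_nonneg (u - 2 * m)]
    calc l * (A * η ^ 2 * (u + 2 * m) ^ 2) ≤ 32 * r * (A * η ^ 2 * (2 * u ^ 2 + 8 * m ^ 2)) := by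
          gcongr
      _ = 64 * A * (η ^ 2 * r) * u ^ 2 + 256 * A * (η ^ 2 * r) * m ^ 2 := by ring
      _ = _ := by rw [he2]
  have h8 : 256 * A * e * m ^ 2 ≤ 64 * A * (16 * η) * m ^ 2 := by
    have h9 := mul_le_mul_of_nonneg_left heη (by positivity : 0 ≤ A * m ^ 2)
    have h10 : 0 ≤ A * m ^ 2 * η := by positivity
    linarith
  have h9 : 4 * η * r * m ^ 2 + 4 * η ^ 2 * m ^ 2 ≤ 16 * r * η * m ^ 2 := by
    have h10 : η * (η * m ^ 2) ≤ r * (η * m ^ 2) :=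
      mul_le_mul_of_nonneg_right (hη1.trans hr) (by positivity)
    have h11 : 0 ≤ r * (η * m ^ 2) := by positivity
    linarith
  have h10 : (1 + (1 + 64 * A) * e) * (u ^ 2 + 16 * r * m ^ 2) = u ^ 2 + 16 * r * m ^ 2 + e * u ^ 2 +
      64 * A * e * u ^ 2 + 16 * η * m ^ 2 + 64 * A * (16 * η) * m ^ 2 := by
    rw [← he]; ring
  have h11 : 0 ≤ 16 * η * m ^ 2 := by positivity
  rw [h10, mul_add]
  linarith

/-- Minkowski's inequality separates the reward contribution additively, so that it accumulates like
a harmonic sum and is not mixed with the multiplicative growth. -/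
theorem envelope_drift {r A R u m : ℝ} (hr : 1 ≤ r) (hA : 0 ≤ A) (hR : 0 ≤ R) :
    √((u + 2 * m / r ^ 2 + 2 * R / r ^ 2) ^ 2 + 16 * √(r ^ 2 + 1) *
      ((1 - 1 / r ^ 2) ^ 2 * m ^ 2 + A / (r ^ 2) ^ 2 * (u + 2 * m) ^ 2)) ≤
      (1 + (1 + 64 * A) / r ^ 3) * √(u ^ 2 + 16 * r * m ^ 2) + 2 * R / r ^ 2 := by
  have hr0 : 0 < r := by linarith
  have h1 := envelope_drift_sq (u := u) (m := m) (η := 1 / r ^ 2) (e := 1 / r ^ 3)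
    (l := 16 * √(r ^ 2 + 1)) hr (by positivity)
    ((div_le_one (by positivity)).2 (one_le_pow₀ hr)) (by field_simp)
    (by linarith [sqrt_add_one_le hr]) (by field_simp) hA
  rw [show 2 * (1 / r ^ 2 * m) = 2 * m / r ^ 2 by ring,
    show A * (1 / r ^ 2) ^ 2 = A / (r ^ 2) ^ 2 by ring, mul_one_div] at h1
  set Y := 16 * √(r ^ 2 + 1) * ((1 - 1 / r ^ 2) ^ 2 * m ^ 2 + A / (r ^ 2) ^ 2 * (u + 2 * m) ^ 2)
  have hY0 : 0 ≤ Y := by positivity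
  have h2 := sqrt_add_le (a₁ := u + 2 * m / r ^ 2) (a₂ := 2 * R / r ^ 2) (b₁ := √Y) (b₂ := 0)
    zero_le_one
  rw [add_zero, one_mul, Real.sq_sqrt hY0, zero_pow two_ne_zero, one_mul, add_zero,
    Real.sqrt_sq (by positivity)] at h2
  refine h2.trans (add_le_add_left ?_ _)
  set k := (1 + 64 * A) / r ^ 3 with hk
  have hk0 : 0 ≤ k := by positivity
  refine (Real.sqrt_le_left (by positivity)).2 ?_
  rw [mul_pow, Real.sq_sqrt (by positivity)]
  refine h1.trans (mul_le_mul_of_nonneg_right ?_ (by positivity))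
  exact le_self_pow₀ (by linarith) two_ne_zero

variable [Nonempty S]

theorem spanEnvelope_le_span (lam : ℝ) (V : S → ℝ) : spanEnvelope lam V ≤ spanSeminorm V := by
  refine (spanEnvelope_le lam V 0).trans_eq ?_
  simp [Real.sqrt_sq (span_nonneg V)]

theorem span_le_add_norm (V M : S → ℝ) :
    spanSeminorm V ≤ spanSeminorm (V - M) + 2 * √(∑ s, M s ^ 2) := by
  have h1 := map_add_le_add (spanS S) (V - M) M
  rw [sub_add_cancel] at h1
  have h2 : ∀ i, |M i| ≤ √(∑ s, M s ^ 2) := fun i =>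
    Real.abs_le_sqrt (Finset.single_le_sum (fun s _ => sq_nonneg (M s)) (Finset.mem_univ i))
  have h3 := span_le_two_mul h2
  simp only [spanS_apply] at h1
  linarith

theorem span_le_two_mul_envelope {lam : ℝ} (hlam : 16 ≤ lam) (V : S → ℝ) :
    spanSeminorm V ≤ 2 * spanEnvelope lam V := by
  refine le_mul_spanEnvelope (by norm_num) fun M => ?_
  have h0 := span_nonneg (V - M)
  have h1 : 0 ≤ ∑ s, M s ^ 2 := Finset.sum_nonneg fun s _ => sq_nonneg _
  refine (span_le_add_norm V M).trans ?_
  have h2 : spanSeminorm (V - M) ≤ √(spanSeminorm (V - M) ^ 2 + lam * ∑ s, M s ^ 2) :=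
    Real.le_sqrt_of_sq_le (le_add_of_nonneg_right (by positivity))
  have h3 : 2 * √(∑ s, M s ^ 2) ≤ √(spanSeminorm (V - M) ^ 2 + lam * ∑ s, M s ^ 2) := by
    refine Real.le_sqrt_of_sq_le ?_
    rw [mul_pow, Real.sq_sqrt h1]
    nlinarith [sq_nonneg (spanSeminorm (V - M))]
  linarith

/-- One step of the first phase, without any condition on the bias. -/
theorem HasBellmanSampler.expect_envelope_le {M : RobustMDP S A} {π : S → PMF A} {Nmax : ℕ}
    {R b σ2 r : ℝ} (hM : HasBellmanSampler M π Nmax R b σ2) (hσ : 0 ≤ σ2) (hR : 0 ≤ R)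
    (hr : 1 ≤ r) (s₀ : S) (V : S → ℝ) :
    expect (sampleRound M Nmax V) (fun d => ENNReal.ofReal
      (spanEnvelope (16 * √(r ^ 2 + 1)) (valueUpdate M π s₀ (1 / r ^ 2) 0 V d))) ≤
      ENNReal.ofReal ((1 + (1 + 64 * (Fintype.card S * σ2)) / r ^ 3) * spanEnvelope (16 * r) V +
        2 * R / r ^ 2) := by
  obtain ⟨Ω, hΩ, P, X, m, h1, h2⟩ := hM V
  rw [h1, expect_map, expect_ofReal P fun ω => spanEnvelope_nonneg _ _]
  refine ENNReal.ofReal_le_ofReal ?_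
  rw [← sub_le_iff_le_add]
  refine le_mul_spanEnvelope (by positivity) fun z => ?_
  rw [sub_le_iff_le_add]
  set η := 1 / r ^ 2 with hη
  have hr2 : (1 : ℝ) ≤ r ^ 2 := one_le_pow₀ hr
  have hη0 : 0 ≤ η := by positivity
  have hη1 : η ≤ 1 := by rw [hη, div_le_one (by positivity)]; exact hr2
  set lam := 16 * √(r ^ 2 + 1) with hlam
  have hlam0 : 0 ≤ lam := by positivity
  set w : Ω → S → ℝ := fun ω s => bellmanEstimate M π 0 (X ω) s - m s with hw
  set y : S → ℝ := (1 - η) • (V - z) + η • m with hy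
  have hz0 : 0 ≤ ∑ s, z s ^ 2 := Finset.sum_nonneg fun s _ => sq_nonneg _
  set u := spanSeminorm (V - z) with hu
  set k := √(∑ s, z s ^ 2) with hk
  have hu0 : 0 ≤ u := span_nonneg _
  have hV0 := span_nonneg V
  have hV : spanSeminorm V ≤ u + 2 * k := span_le_add_norm V z
  have hz : ∑ s, z s ^ 2 = k ^ 2 := (Real.sq_sqrt hz0).symm
  -- From any splitting of `V` comes one of the update: all the noise goes to the damped component,
  -- and the rest `y` is deterministic up to an anchoring constant.
  have h3 : ∀ ω, spanEnvelope lam (valueUpdate M π s₀ η 0 V (X ω)) ≤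
      √(spanSeminorm y ^ 2 + lam * ∑ s, ((1 - η) * z s + η * w ω s) ^ 2) := by
    intro ω
    refine (spanEnvelope_le _ _ fun s => (1 - η) * z s + η * w ω s).trans_eq ?_
    have h4 : spanSeminorm (valueUpdate M π s₀ η 0 V (X ω) - fun s => (1 - η) * z s + η * w ω s) =
        spanSeminorm y :=
      seminorm_congr_of_const (spanS S) span_const
        (c := -(V s₀ + η * (bellmanEstimate M π 0 (X ω) s₀ - V s₀))) fun s => by
          simp only [valueUpdate, hy, hw, Pi.sub_apply, Pi.add_apply, Pi.smul_apply, smul_eq_mul]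
          ring
    rw [h4]
  have hy1 : spanSeminorm y ≤ u + 2 * k / r ^ 2 + 2 * R / r ^ 2 := by
    have h4 := map_add_le_add (spanS S) ((1 - η) • (V - z)) (η • m)
    rw [map_smul_eq_mul, map_smul_eq_mul, Real.norm_of_nonneg hη0,
      Real.norm_of_nonneg (sub_nonneg.2 hη1)] at h4
    simp only [spanS_apply] at h4
    -- Only the range of the mean estimate enters, neither contraction nor bias.
    have h5 : spanSeminorm m ≤ 2 * R + (u + 2 * k) := by
      refine span_le_iff.2 fun i j => ?_
      have h6 := (h2 i).2.2.1
      have h7 := (h2 j).2.1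
      rw [spanSeminorm] at hV
      linarith
    have h6 := mul_le_mul_of_nonneg_left h5 hη0
    have h7 : 2 * k / r ^ 2 = 2 * (η * k) := by rw [hη]; ring
    have h8 : 2 * R / r ^ 2 = 2 * (η * R) := by rw [hη]; ring
    rw [h7, h8]
    refine h4.trans ?_
    linarith
  refine (ev_mono h3).trans ((ev_sqrt_le fun ω => by positivity).trans ?_)
  rw [ev_add, ev_const, ev_mul_left, ev_sum]
  have h4 : ∀ s, ev P (fun ω => ((1 - η) * z s + η * w ω s) ^ 2) ≤
      (1 - η) ^ 2 * z s ^ 2 + η ^ 2 * (σ2 * (u + 2 * k) ^ 2) := by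
    intro s
    have h5 : ∀ ω, ((1 - η) * z s + η * w ω s) ^ 2 = (1 - η) ^ 2 * z s ^ 2 +
        2 * (1 - η) * z s * η * w ω s + η ^ 2 * w ω s ^ 2 := fun ω => by ring
    have h6 : ev P (fun ω => w ω s) = 0 := by
      simp only [hw]; rw [ev_sub, ev_const, (h2 s).1, sub_self]
    simp only [h5]
    rw [ev_add, ev_add, ev_const, ev_mul_left, ev_mul_left, h6, mul_zero, add_zero]
    have h7 : ev P (fun ω => w ω s ^ 2) ≤ σ2 * (u + 2 * k) ^ 2 :=
      (h2 s).2.2.2.2.trans (by gcongr)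
    gcongr
  have h5 : ∑ s, ev P (fun ω => ((1 - η) * z s + η * w ω s) ^ 2) ≤
      (1 - η) ^ 2 * k ^ 2 + Fintype.card S * σ2 / (r ^ 2) ^ 2 * (u + 2 * k) ^ 2 := by
    refine (Finset.sum_le_sum fun s _ => h4 s).trans_eq ?_
    rw [Finset.sum_add_distrib, ← Finset.mul_sum, hz]
    simp only [Finset.sum_const, Finset.card_univ, nsmul_eq_mul, hη]
    field_simp
  have hy0 := span_nonneg y
  have hk0 : 0 ≤ k := Real.sqrt_nonneg _
  rw [hz]
  refine le_trans (Real.sqrt_le_sqrt ?_) (envelope_drift hr (A := Fintype.card S * σ2)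
    (by positivity) hR)
  gcongr

/-- The decrement of `n ^ (-1/2)` is at least a quarter of `n ^ (-3/2)`; it pays for the
multiplicative growth in the next argument. -/
theorem one_div_sqrt_succ_le {r : ℝ} (hr : 1 ≤ r) : 1 / √(r ^ 2 + 1) ≤ 1 / r - 1 / (4 * r ^ 3) := by
  have hr0 : 0 < r := by linarith
  have h1 : 1 / r - 1 / (4 * r ^ 3) = (4 * r ^ 2 - 1) / (4 * r ^ 3) := by field_simp
  have h2 : 0 < 4 * r ^ 2 - 1 := by nlinarith
  rw [h1, div_le_div_iff₀ (by positivity) (by positivity), one_mul, ← div_le_iff₀' h2]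
  refine Real.le_sqrt_of_sq_le ?_
  rw [div_pow, div_le_iff₀ (by positivity)]
  nlinarith [pow_le_pow_right₀ hr (by norm_num : 2 ≤ 4), one_le_pow₀ hr (n := 4)]

theorem sum_one_div_le {K : ℝ} (hK : 1 ≤ K) (T : ℕ) :
    ∑ i ∈ Finset.range T, 1 / ((i : ℝ) + K) ≤ 1 + Real.log T := by
  have h1 := harmonic_le_one_add_log T
  refine le_trans ?_ h1
  rw [harmonic]
  push_cast
  refine Finset.sum_le_sum fun i _ => ?_
  rw [one_div]
  gcongr

/-- The first phase, without any condition on the bias. -/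
theorem HasBellmanSampler.expect_valuePhase_span_le {M : RobustMDP S A} {π : S → PMF A} {Nmax : ℕ}
    {R b σ2 κ : ℝ} (hM : HasBellmanSampler M π Nmax R b σ2) (hσ : 0 ≤ σ2) (hR : 0 ≤ R)
    (hκ : κ = 1 + 64 * (Fintype.card S * σ2)) (s₀ : S) (V₀ : S → ℝ) (T : ℕ) :
    expect (valuePhase M π s₀ (fun t => 1 / ((t : ℝ) + 64 * κ ^ 2)) Nmax V₀ T)
      (fun z => ENNReal.ofReal (spanSeminorm z.1)) ≤
      ENNReal.ofReal (4 * (spanSeminorm V₀ + 2 * R * (1 + Real.log T))) := by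
  have hκ1 : 1 ≤ κ := by rw [hκ]; exact le_add_of_nonneg_right (by positivity)
  set K := 64 * κ ^ 2 with hK
  have hK1 : 1 ≤ K := by nlinarith
  have hn : ∀ t : ℕ, 1 ≤ (t : ℝ) + K := fun t => by
    have : (0 : ℝ) ≤ t := Nat.cast_nonneg _
    linarith
  have hsq : ∀ t : ℕ, √((t : ℝ) + K) ^ 2 = t + K := fun t => Real.sq_sqrt (by linarith [hn t])
  have hr1 : ∀ t : ℕ, 1 ≤ √((t : ℝ) + K) := fun t => by
    rw [← Real.sqrt_one]; exact Real.sqrt_le_sqrt (hn t)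
  have hrκ : ∀ t : ℕ, 8 * κ ≤ √((t : ℝ) + K) := fun t => by
    refine Real.le_sqrt_of_sq_le ?_
    have : (0 : ℝ) ≤ t := Nat.cast_nonneg _
    rw [hK]; nlinarith
  set e := spanSeminorm V₀ with he
  have he0 : 0 ≤ e := span_nonneg V₀
  set Z : ℕ → ℝ := fun t => e + 2 * R * ∑ i ∈ Finset.range t, 1 / ((i : ℝ) + K) with hZ
  have hZ0 : ∀ t, 0 ≤ Z t := fun t => by
    refine add_nonneg he0 (mul_nonneg (by positivity) (Finset.sum_nonneg fun i _ => ?_))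
    have := hn i
    positivity
  -- The prefactor `2 - 8 κ / √(t + K)` increases towards `2`, and its increments outweigh the
  -- growth factor `1 + κ / (t + K) ^ (3/2)`. With `K = 64 κ ^ 2` it starts at `1`. The remaining
  -- factor `Z` collects the rewards.
  have h1 := expect_valuePhase_le (M := M) (π := π) (s₀ := s₀) (Nmax := Nmax)
    (η := fun t => 1 / ((t : ℝ) + K)) (V₀ := V₀)
    (F := fun t V => spanEnvelope (16 * √((t : ℝ) + K)) V)
    (k := fun t => 1 + κ / √((t : ℝ) + K) ^ 3) (c := fun t => 2 * R / (t + K))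
    (y := fun t => (2 - 8 * κ / √((t : ℝ) + K)) * Z t)
    (fun t V => spanEnvelope_nonneg _ _) (fun t => by positivity)
    (fun t => by have := hn t; positivity) ?_ (fun t => ?_) (fun t V => ?_) T
  · have h2 : ∀ z : (S → ℝ) × ℕ, ENNReal.ofReal (spanSeminorm z.1) ≤
        ENNReal.ofReal 2 * ENNReal.ofReal (spanEnvelope (16 * √((T : ℝ) + K)) z.1) := by
      intro z
      rw [← ENNReal.ofReal_mul (by norm_num)]
      exact ENNReal.ofReal_le_ofReal (span_le_two_mul_envelope (by linarith [hr1 T]) _)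
    refine (expect_mono h2).trans ?_
    rw [expect_mul_left]
    refine (mul_le_mul_right h1 _).trans ?_
    rw [← ENNReal.ofReal_mul (by norm_num)]
    refine ENNReal.ofReal_le_ofReal ?_
    have h3 : (2 - 8 * κ / √((T : ℝ) + K)) * Z T ≤ 2 * Z T := by
      refine mul_le_mul_of_nonneg_right ?_ (hZ0 T)
      have : 0 ≤ 8 * κ / √((T : ℝ) + K) := by positivity
      linarith
    have h4 := mul_le_mul_of_nonneg_left (sum_one_div_le hK1 T) (by positivity : 0 ≤ 2 * R)
    simp only [hZ] at h3
    linarith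
  · refine (spanEnvelope_le_span _ _).trans ?_
    have h2 : √((0 : ℕ) + K) = 8 * κ := by
      rw [Nat.cast_zero, zero_add, hK, show 64 * κ ^ 2 = (8 * κ) ^ 2 by ring, Real.sqrt_sq (by positivity)]
    simp only [h2, hZ]
    rw [div_self (by positivity)]
    simp only [Finset.range_zero, Finset.sum_empty, mul_zero, add_zero]
    linarith
  · have h2 : Z (t + 1) = Z t + 2 * R / (t + K) := by
      simp only [hZ]; rw [Finset.sum_range_succ]; ring
    have h3 : √(((t + 1 : ℕ) : ℝ) + K) = √(√((t : ℝ) + K) ^ 2 + 1) := by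
      rw [hsq]; push_cast; congr 1; ring
    have h6 : 1 ≤ 2 - 8 * κ / √(((t + 1 : ℕ) : ℝ) + K) := by
      have := (div_le_one (by have := hr1 (t + 1); linarith)).2 (hrκ (t + 1))
      linarith
    simp only [h2]
    rw [h3] at h6 ⊢
    have h4 := one_div_sqrt_succ_le (hr1 t)
    set r := √((t : ℝ) + K)
    have hr0 : 1 ≤ r := hr1 t
    have h5 : (1 + κ / r ^ 3) * (2 - 8 * κ / r) ≤ 2 - 8 * κ / √(r ^ 2 + 1) := by
      have h7 : (1 + κ / r ^ 3) * (2 - 8 * κ / r) =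
          2 - 8 * κ * (1 / r - 1 / (4 * r ^ 3)) - 8 * κ ^ 2 / r ^ 4 := by
        field_simp; ring
      have h8 := mul_le_mul_of_nonneg_left h4 (by positivity : 0 ≤ 8 * κ)
      have h9 : 0 ≤ 8 * κ ^ 2 / r ^ 4 := by positivity
      rw [h7]
      have h10 : 8 * κ / √(r ^ 2 + 1) = 8 * κ * (1 / √(r ^ 2 + 1)) := by ring
      rw [h10]; linarith
    have h7 := mul_le_mul_of_nonneg_right h5 (hZ0 t)
    have h8 : 0 ≤ 2 * R / (t + K) := by have := hn t; positivity
    have h9 := mul_le_mul_of_nonneg_right h6 h8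
    linarith
  · have h2 := hM.expect_envelope_le hσ hR (hr1 t) s₀ V
    rw [← hκ, hsq] at h2
    push_cast
    rw [show (t : ℝ) + 1 + K = t + K + 1 by ring]
    exact h2

end LargeBias

/-! ### Error bounds in terms of bias and variance of the estimator -/

section ErrorBounds

variable {S : Type u} {A : Type v} [Fintype S] [Fintype A] [Nonempty S]

theorem expect_ofReal_le_add {α : Type*} {p : PMF α} {f h : α → ℝ} {e τ : ℝ} (hτ : 0 ≤ τ)
    (hh : ∀ x, 0 ≤ h x) (hf : ∀ x, f x ≤ h x + τ) (he : 0 ≤ e)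
    (hp : expect p (fun x => ENNReal.ofReal (h x)) ≤ ENNReal.ofReal e) :
    expect p (fun x => ENNReal.ofReal (f x)) ≤ ENNReal.ofReal (e + τ) := by
  have h1 : ∀ x, ENNReal.ofReal (f x) ≤ ENNReal.ofReal (h x) + ENNReal.ofReal τ := fun x => by
    rw [← ENNReal.ofReal_add (hh x) hτ]; exact ENNReal.ofReal_le_ofReal (hf x)
  refine (expect_mono h1).trans ?_
  rw [expect_add, expect_const, ENNReal.ofReal_add he hτ]
  exact add_le_add_left hp _

theorem span_sub_le (V W : S → ℝ) : spanSeminorm (V - W) ≤ spanSeminorm V + spanSeminorm W :=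
  map_sub_le_add (spanS S) V W

theorem span_le_sub_add (V W : S → ℝ) : spanSeminorm V ≤ spanSeminorm (V - W) + spanSeminorm W := by
  have := map_add_le_add (spanS S) (V - W) W
  rwa [sub_add_cancel] at this

variable [DecidableEq S] {M : RobustMDP S A} {π : S → PMF A} {N : Seminorm ℝ (S → ℝ)} {γ g B : ℝ}

/-- A smooth semi-norm contracted by the robust Bellman operator, and the solution of the Bellman
equation. -/
theorem exists_smooth_contraction (hB : 1 ≤ B) (he : NominalErgodic M π) (hr : RadiusCondition M π)
    (hN : IsContractionSeminorm M π N γ) (hC : ConstantsAtMost N γ B)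
    (hR : ∀ s a, |M.reward s a| ≤ B) (hg : IsRobustAverageReward M π g) :
    ∃ (q : Seminorm ℝ (S → ℝ)) (V' : S → ℝ), (∀ s, robustBellman M π 0 V' s = V' s + g) ∧
      spanSeminorm V' ≤ 4 * B * tMix M π ∧ IsSmooth q B ∧ (∀ x, spanSeminorm x ≤ q x) ∧
      (∀ x, q x ≤ B ^ 2 * spanSeminorm x) ∧
      ∀ V₁ V₂, q (robustBellman M π 0 V₁ - robustBellman M π 0 V₂) ≤
        (1 - 2 * ((1 - γ) / (2 * B))) * q (V₁ - V₂) := by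
  obtain ⟨h0, h1, hN0, hT⟩ := hN
  have hB0 : 0 < B := by linarith
  obtain ⟨q, γ', hγ0, hγ1, hγ, hq1, hq2, hq, hcontr⟩ := exists_smooth_seminorm h0 h1 hN0 hB hC
  have hU := admissible_of_radiusCondition hr
  have hTq : ∀ V₁ V₂, q (robustBellman M π 0 V₁ - robustBellman M π 0 V₂) ≤ γ' * q (V₁ - V₂) :=
    fun V₁ V₂ => hcontr _ _ (hT V₁ V₂ 0)
  have hqc : ∀ c : ℝ, q (fun _ => c) = 0 := fun c =>
    le_antisymm ((hq2 _).trans_eq (by rw [span_const, mul_zero])) (apply_nonneg _ _)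
  obtain ⟨V', g', hV'⟩ := exists_bellman_solution M π hU q hγ0 hγ1 hq1 hqc hTq
  obtain rfl : g' = g :=
    (isRobustAverageReward_of_bellman hU hV' (Classical.arbitrary S)).unique (hg _)
  refine ⟨q, V', hV', span_bellman_solution_le he hr hV' hR, hq, hq1, hq2, fun V₁ V₂ =>
    (hTq V₁ V₂).trans (mul_le_mul_of_nonneg_right ?_ (apply_nonneg _ _))⟩
  have h2 : 2 * ((1 - γ) / (2 * B)) = (1 - γ) / B := by field_simp
  rw [h2, le_sub_comm, div_le_iff₀ hB0]
  linarith

/-- A bound for the number of states in terms of the problem constants. -/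
def cardBound (B : ℝ) : ℝ := 2 ^ (⌊B * (B ^ 2) ^ 2⌋₊ + 1)

/-- This removes the number of states from the constants: the smooth semi-norm has smoothness `B`
and comparison constant `B ^ 2`. -/
theorem card_le_cardBound (hB : 1 ≤ B) (he : NominalErgodic M π) (hr : RadiusCondition M π)
    (hN : IsContractionSeminorm M π N γ) (hC : ConstantsAtMost N γ B)
    (hR : ∀ s a, |M.reward s a| ≤ B) (hg : IsRobustAverageReward M π g) :
    (Fintype.card S : ℝ) ≤ cardBound B := by
  obtain ⟨q, V', -, -, hq, hq1, hq2, -⟩ := exists_smooth_contraction hB he hr hN hC hR hg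
  have := hq.card_le (by linarith) (by positivity) hq1 hq2
  rw [cardBound]
  exact_mod_cast this

/-- The constant in the error bound for small bias. -/
def errorConst (B : ℝ) : ℝ :=
  46 * B ^ 4 + 14 * B ^ 3 + 2 * B * √(256 * B ^ 2 * (32 * B ^ 5 * cardBound B) +
    (4 + 8 * (32 * B ^ 5 * cardBound B)) * (25 * B ^ 6))

-- The mean square bound on `V_T - V'` is used twice: once in decaying form for the error
-- transmitted to the second phase, and once in uniform form, of the order of the mixing time, for
-- the span that multiplies bias and standard deviation there.
set_option maxHeartbeats 1000000 in
theorem expectedError_le_of_small_bias (hB : 1 ≤ B) (he : NominalErgodic M π)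
    (hr : RadiusCondition M π) (hN : IsContractionSeminorm M π N γ) (hC : ConstantsAtMost N γ B)
    (hR : ∀ s a, |M.reward s a| ≤ B) (hg : IsRobustAverageReward M π g) {Nmax : ℕ} {b σ2 : ℝ}
    (hM : HasSampler M Nmax b σ2) (hb : 0 ≤ b) (hσ : 1 ≤ σ2) (hbγ : 4 * B ^ 3 * b ≤ 1 - γ)
    (s₀ : S) {V₀ : S → ℝ} (hV₀ : spanSeminorm V₀ ≤ B * tMix M π) :
    ∃ a K : ℝ, 0 < a ∧ a ≤ errorConst B / (1 - γ) ∧ 1 ≤ K ∧ ∀ T : ℕ, 1 ≤ T →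
      expectedError M π s₀ (fun t => a / ((t : ℝ) + K)) (fun t => 1 / ((t : ℝ) + 1)) Nmax V₀ T g ≤
        ENNReal.ofReal (errorConst B *
          (tMix M π * b / (1 - γ) + tMix M π * √σ2 / ((1 - γ) * √T))) := by
  have hγ0 := hN.1
  have hγ1 := hN.2.1
  have hcard := card_le_cardBound hB he hr hN hC hR hg
  obtain ⟨q, V', hV', hspan, hq, hq1, hq2, hT⟩ := exists_smooth_contraction hB he hr hN hC hR hg
  have hB0 : 0 < B := by linarith
  have ht : (1 : ℝ) ≤ tMix M π := by exact_mod_cast one_le_tMix he hr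
  set t : ℝ := (tMix M π : ℝ)
  set h := (1 - γ) / (2 * B) with hh
  set n := cardBound B with hn
  have hn0 : 0 ≤ n := (Nat.cast_nonneg _).trans hcard
  have hγ' : 0 < 1 - γ := by linarith
  have hh0 : 0 < h := by positivity
  have hh1 : h ≤ 1 := by rw [hh, div_le_one (by positivity)]; linarith
  have hhγ : 1 - γ = 2 * B * h := by rw [hh]; field_simp
  set τ := 4 * B * t with hτ
  have hτ0 : 0 ≤ τ := by positivity
  set A' := 32 * B * (B ^ 2) ^ 2 * Fintype.card S * σ2 with hA'
  set A₀ := 32 * B ^ 5 * n with hA₀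
  have hA₀0 : 0 ≤ A₀ := by positivity
  have hσ0 : 0 ≤ σ2 := by linarith
  have hA'0 : 0 ≤ A' := by positivity
  have hA'A : A' ≤ A₀ * σ2 := by
    rw [hA', hA₀, show 32 * B * (B ^ 2) ^ 2 * (Fintype.card S : ℝ) * σ2 =
      32 * B ^ 5 * Fintype.card S * σ2 by ring]
    gcongr
  -- The error floor at which the bias is balanced by the reserved half `h` of the contraction gap;
  -- it is of order mixing time times `b / (1 - γ)`.
  set β := 2 * B ^ 2 * b * τ / h with hβ
  set G := 16 * A' * τ ^ 2 / h ^ 2 with hG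
  set K := 4 / h + 8 * A' / h ^ 2 with hK
  set H := G + K * q (V₀ - V') ^ 2 with hH
  have hβ0 : 0 ≤ β := by positivity
  have h4 : 4 ≤ 4 / h := by rw [le_div_iff₀ hh0]; linarith
  have hK4 : 4 / h ≤ K := le_add_of_nonneg_right (by positivity)
  have hK0 : 0 < K := by linarith
  have hG0 : 0 ≤ G := by positivity
  have hH0 : 0 ≤ H := by positivity
  have hbh : 2 * B ^ 2 * b ≤ h := by
    rw [hh, le_div_iff₀ (by positivity)]; linarith
  have hβτ : β ≤ τ := by
    rw [hβ, div_le_iff₀ hh0, mul_comm τ]; gcongr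
  have hu : q (V₀ - V') ≤ 5 * B ^ 3 * t := by
    refine (hq2 _).trans ?_
    have h5 := span_sub_le V₀ V'
    calc B ^ 2 * spanSeminorm (V₀ - V') ≤ B ^ 2 * (B * t + 4 * B * t) := by gcongr; linarith
      _ = 5 * B ^ 3 * t := by ring
  have hu0 : 0 ≤ q (V₀ - V') := apply_nonneg _ _
  have hu2 : q (V₀ - V') ^ 2 ≤ 25 * B ^ 6 * t ^ 2 :=
    (pow_le_pow_left₀ hu0 hu 2).trans_eq (by ring)
  have hS := hM.hasBellmanSampler hR π
  have hmain := fun T : ℕ => hS.expect_valuePhase_sq_le hσ0 hV' hB0.le (sq_nonneg B) hq hq1 hq2 hT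
    rfl hh0 hbh (β := β) (le_of_eq (by rw [hβ]; field_simp)) hb hspan hh1 hG hK V₀ hH s₀ T
  have hE1 : 46 * B ^ 4 ≤ errorConst B := by
    rw [errorConst, add_assoc]; exact le_add_of_nonneg_right (by positivity)
  refine ⟨4 / h, K, by positivity, ?_, by linarith, fun T hT1 => ?_⟩
  · have h5 : 4 / h = 8 * B / (1 - γ) := by rw [hhγ]; field_simp; ring
    rw [h5]
    gcongr
    have : B ≤ B ^ 4 := le_self_pow₀ hB (by norm_num)
    linarith
  have hT0 : (0 : ℝ) < T := by exact_mod_cast hT1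
  have hrT : 0 < √(T : ℝ) := Real.sqrt_pos.2 hT0
  set p := valuePhase M π s₀ (fun t => 4 / h / ((t : ℝ) + K)) Nmax V₀ T with hp
  have hq' : ∀ c : ℝ, 0 ≤ c → 2 * β ^ 2 + H / (T + K) ≤ c ^ 2 →
      expect p (fun z => ENNReal.ofReal (spanSeminorm (z.1 - V'))) ≤ ENNReal.ofReal c := by
    intro c hc hc2
    refine (expect_mono fun z => ENNReal.ofReal_le_ofReal (hq1 _)).trans ?_
    exact expect_le_of_sq hc ((hmain T).trans (ENNReal.ofReal_le_ofReal hc2))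
  -- Uniform bound: `K` contains the term `8 A' / h ^ 2`, so `G / K ≤ 2 τ ^ 2`, and the smallness of
  -- the bias gives `β ≤ τ`.
  have hbd1 := hq' (10 * B ^ 3 * t) (by positivity) (by
    have h5 : H / (T + K) ≤ H / K := by gcongr; linarith
    have h6 : H / K = G / K + q (V₀ - V') ^ 2 := by
      rw [hH, add_div, mul_div_cancel_left₀ _ hK0.ne']
    have h7 : G / K ≤ 2 * τ ^ 2 := by
      rw [div_le_iff₀ hK0]
      have h8 : G = 2 * τ ^ 2 * (8 * A' / h ^ 2) := by rw [hG]; ring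
      rw [h8]
      gcongr
      exact le_add_of_nonneg_left (by positivity)
    have h8 : β ^ 2 ≤ τ ^ 2 := by gcongr
    have h9 : τ ^ 2 = 16 * B ^ 2 * t ^ 2 := by rw [hτ]; ring
    have h10 : B ^ 2 * t ^ 2 ≤ B ^ 6 * t ^ 2 :=
      mul_le_mul_of_nonneg_right (pow_le_pow_right₀ hB (by norm_num)) (sq_nonneg t)
    have h11 : 0 ≤ B ^ 6 * t ^ 2 := by positivity
    have h12 : (10 * B ^ 3 * t) ^ 2 = 100 * (B ^ 6 * t ^ 2) := by ring
    linarith)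
  have hbd2 := hq' (2 * β + √(H / T)) (by positivity) (by
    have h5 : H / (T + K) ≤ H / T := by gcongr; linarith
    have h6 := Real.sq_sqrt (by positivity : 0 ≤ H / T)
    have h7 : 0 ≤ β * √(H / T) := by positivity
    have h8 : (2 * β + √(H / T)) ^ 2 = 4 * β ^ 2 + 4 * (β * √(H / T)) + √(H / T) ^ 2 := by ring
    linarith [sq_nonneg β])
  have hbd3 := expect_ofReal_le_add (f := fun z => spanSeminorm z.1) hτ0 (fun z => span_nonneg _)
    (fun z => (span_le_sub_add z.1 V').trans (by gcongr)) (by positivity) hbd1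
  refine (hS.expectedError_le (admissible_of_radiusCondition hr) hb hσ0 hV' s₀ _ V₀ hT1
    (by positivity) (by positivity) hbd2 hbd3).trans (ENNReal.ofReal_le_ofReal ?_)
  have hb1 : t * b / (1 - γ) = b * t / (2 * B * h) := by rw [hhγ]; ring
  have ht1 : b * (10 * B ^ 3 * t + τ) ≤ 14 * B ^ 3 * (t * b / (1 - γ)) := by
    have h5 : t * b ≤ t * b / (1 - γ) := by
      rw [le_div_iff₀ hγ']
      exact mul_le_of_le_one_right (by positivity) (by linarith)
    have h6 : τ ≤ 4 * B ^ 3 * t := by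
      rw [hτ]; gcongr; exact le_self_pow₀ hB (by norm_num)
    calc b * (10 * B ^ 3 * t + τ) ≤ b * (10 * B ^ 3 * t + 4 * B ^ 3 * t) := by gcongr
      _ = 14 * B ^ 3 * (t * b) := by ring
      _ ≤ _ := by gcongr
  have ht2 : 2 * β = 32 * B ^ 4 * (t * b / (1 - γ)) := by
    rw [hb1, hβ, hτ]; field_simp; ring
  have ht3 : √(σ2 / T) * (10 * B ^ 3 * t + τ) ≤ 14 * B ^ 3 * (t * √σ2 / ((1 - γ) * √T)) := by
    rw [Real.sqrt_div hσ0]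
    have h6 : τ ≤ 4 * B ^ 3 * t := by
      rw [hτ]; gcongr; exact le_self_pow₀ hB (by norm_num)
    calc √σ2 / √T * (10 * B ^ 3 * t + τ) ≤ √σ2 / √T * (10 * B ^ 3 * t + 4 * B ^ 3 * t) := by gcongr
      _ = 14 * B ^ 3 * (t * √σ2 / (1 * √T)) := by ring
      _ ≤ _ := by gcongr; linarith
  have ht4 : √(H / T) ≤ 2 * B * √(256 * B ^ 2 * A₀ + (4 + 8 * A₀) * (25 * B ^ 6)) *
      (t * √σ2 / ((1 - γ) * √T)) := by
    have h5 : H ≤ (256 * B ^ 2 * A₀ + (4 + 8 * A₀) * (25 * B ^ 6)) * (σ2 * t ^ 2 / h ^ 2) := by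
      have h6 : G ≤ 256 * B ^ 2 * A₀ * (σ2 * t ^ 2 / h ^ 2) := by
        calc G ≤ 16 * (A₀ * σ2) * τ ^ 2 / h ^ 2 := by rw [hG]; gcongr
          _ = _ := by rw [hτ]; ring
      have h7 : K ≤ (4 + 8 * A₀) * (σ2 / h ^ 2) := by
        have h8 : 4 / h ≤ 4 * (σ2 / h ^ 2) := by
          rw [← mul_div_assoc, div_le_div_iff₀ hh0 (by positivity)]
          have : h ^ 2 ≤ σ2 * h := by rw [pow_two]; gcongr; linarith
          linarith
        have h9 : 8 * A' / h ^ 2 ≤ 8 * (A₀ * σ2) / h ^ 2 := by gcongr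
        calc K ≤ 4 * (σ2 / h ^ 2) + 8 * (A₀ * σ2) / h ^ 2 := add_le_add h8 h9
          _ = _ := by ring
      calc H ≤ 256 * B ^ 2 * A₀ * (σ2 * t ^ 2 / h ^ 2) +
            (4 + 8 * A₀) * (σ2 / h ^ 2) * (25 * B ^ 6 * t ^ 2) := by
            rw [hH]; gcongr
        _ = _ := by ring
    rw [Real.sqrt_div hH0]
    calc √H / √T ≤ √((256 * B ^ 2 * A₀ + (4 + 8 * A₀) * (25 * B ^ 6)) * (σ2 * t ^ 2 / h ^ 2)) / √T := by
          gcongr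
      _ = √(256 * B ^ 2 * A₀ + (4 + 8 * A₀) * (25 * B ^ 6)) * (√σ2 * t / h) / √T := by
          rw [Real.sqrt_mul (by positivity), Real.sqrt_div (by positivity), Real.sqrt_mul hσ0,
            Real.sqrt_sq (by positivity), Real.sqrt_sq hh0.le]
      _ = _ := by rw [hhγ]; field_simp
  have hx : 0 ≤ t * b / (1 - γ) := by positivity
  have hy : 0 ≤ t * √σ2 / ((1 - γ) * √T) := by positivity
  have hB4 : B ^ 3 ≤ B ^ 4 := pow_le_pow_right₀ hB (by norm_num)
  rw [mul_add, add_mul, ht2]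
  -- The error floor contributes `32` and the bias in the second phase `14`; together they are the
  -- `46` in `errorConst`.
  have e1 : 32 * B ^ 4 * (t * b / (1 - γ)) + 14 * B ^ 3 * (t * b / (1 - γ)) ≤
      errorConst B * (t * b / (1 - γ)) := by
    rw [← add_mul]; gcongr; linarith
  have e2 : 14 * B ^ 3 * (t * √σ2 / ((1 - γ) * √T)) + 2 * B * √(256 * B ^ 2 * A₀ +
      (4 + 8 * A₀) * (25 * B ^ 6)) * (t * √σ2 / ((1 - γ) * √T)) ≤
      errorConst B * (t * √σ2 / ((1 - γ) * √T)) := by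
    rw [← add_mul]
    gcongr
    rw [errorConst, add_assoc]
    exact le_add_of_nonneg_left (by positivity)
  linarith

theorem half_le_log {T : ℕ} (hT : 2 ≤ T) : 1 / 2 ≤ Real.log T := by
  have h1 : Real.log 2 ≤ Real.log T := Real.log_le_log (by norm_num) (by exact_mod_cast hT)
  linarith [Real.log_two_gt_d9]

/-- No convergence is claimed: `V_T` and `V_T - V'` are merely bounded by the mixing time times `log
T`, which is enough when the claimed rate does not decay in `T` faster than that. -/
theorem expectedError_le_of_any_bias (hB : 1 ≤ B) (he : NominalErgodic M π)
    (hr : RadiusCondition M π) (hN : IsContractionSeminorm M π N γ) (hC : ConstantsAtMost N γ B)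
    (hR : ∀ s a, |M.reward s a| ≤ B) (hg : IsRobustAverageReward M π g) {Nmax : ℕ} {b σ2 : ℝ}
    (hM : HasSampler M Nmax b σ2) (hb : 0 ≤ b) (hσ : 0 ≤ σ2)
    (s₀ : S) {V₀ : S → ℝ} (hV₀ : spanSeminorm V₀ ≤ B * tMix M π) :
    ∃ a K : ℝ, 0 < a ∧ a ≤ 1 / (1 - γ) ∧ 1 ≤ K ∧ ∀ T : ℕ, 2 ≤ T →
      expectedError M π s₀ (fun t => a / ((t : ℝ) + K)) (fun t => 1 / ((t : ℝ) + 1)) Nmax V₀ T g ≤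
        ENNReal.ofReal (40 * B * (tMix M π * Real.log T) * (1 + b + √(σ2 / T))) := by
  have hγ0 := hN.1
  have hγ1 := hN.2.1
  obtain ⟨-, V', hV', hspan, -⟩ := exists_smooth_contraction hB he hr hN hC hR hg
  have hB0 : 0 < B := by linarith
  have ht : (1 : ℝ) ≤ tMix M π := by exact_mod_cast one_le_tMix he hr
  set t : ℝ := (tMix M π : ℝ)
  have hS := hM.hasBellmanSampler hR π
  set κ := 1 + 64 * (Fintype.card S * σ2) with hκ
  have hκ1 : 1 ≤ κ := le_add_of_nonneg_right (by positivity)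
  refine ⟨1, 64 * κ ^ 2, one_pos, ?_, by nlinarith, fun T hT => ?_⟩
  · rw [one_le_div (by linarith)]; linarith
  have hl := half_le_log hT
  set l := Real.log T
  have hl0 : 0 ≤ l := by linarith
  have htl : t ≤ 2 * (t * l) := by
    have := mul_le_mul_of_nonneg_left hl (by linarith : 0 ≤ t)
    linarith
  have hlt : l ≤ t * l := le_mul_of_one_le_left hl0 ht
  have h1 := hS.expect_valuePhase_span_le hσ hB0.le hκ s₀ V₀ T
  have h2 : 4 * (spanSeminorm V₀ + 2 * B * (1 + l)) ≤ 32 * B * (t * l) := by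
    have h3 : B * (t + 2 * (1 + l)) ≤ B * (8 * (t * l)) := by gcongr; linarith
    linarith
  have h3 := h1.trans (ENNReal.ofReal_le_ofReal h2)
  have h4 := expect_ofReal_le_add (f := fun z => spanSeminorm (z.1 - V')) (by positivity : 0 ≤ 4 * B * t)
    (fun z => span_nonneg _) (fun z => (span_sub_le z.1 V').trans (by gcongr)) (by positivity) h3
  refine (hS.expectedError_le (admissible_of_radiusCondition hr) hb hσ hV' s₀ _ V₀ (by linarith)
    (by positivity) (by positivity) h4 h3).trans (ENNReal.ofReal_le_ofReal ?_)
  have h5 : B * t ≤ B * (2 * (t * l)) := by gcongr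
  have h6 : 0 ≤ B * (t * l) * (b + √(σ2 / T)) := by positivity
  linarith

end ErrorBounds

/-! ### Rates -/

section Rates

theorem two_rpow_half (N : ℕ) : (2 : ℝ) ^ (-(N : ℝ) / 2) = ((2 : ℝ) ^ (-(N : ℝ) / 4)) ^ 2 := by
  rw [← Real.rpow_natCast, ← Real.rpow_mul (by norm_num)]
  congr 1; push_cast; ring

theorem sqrt_half_pow (N : ℕ) : √((1 / 2 : ℝ) ^ N) = ((2 : ℝ) ^ (-(N : ℝ) / 4)) ^ 2 := by
  rw [← two_rpow_half, Real.sqrt_eq_rpow, one_div, inv_pow, ← Real.rpow_natCast,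
    ← Real.rpow_neg (by norm_num), ← Real.rpow_mul (by norm_num)]
  ring_nf

theorem rpow_three_half {l : ℝ} (hl : 0 ≤ l) : l ^ ((3 : ℝ) / 2) = √l ^ 3 := by
  rw [Real.sqrt_eq_rpow, ← Real.rpow_natCast, ← Real.rpow_mul hl]
  congr 1; norm_num

theorem le_two_mul_sqrt_pow {l : ℝ} (hl : 1 / 2 ≤ l) : l ≤ 2 * √l ^ 3 ∧ 1 ≤ 4 * √l ^ 3 := by
  have h1 : √l ^ 2 = l := Real.sq_sqrt (by linarith)
  have h2 : 1 / 2 ≤ √l := Real.le_sqrt_of_sq_le (by linarith)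
  have h3 : √l ^ 3 = l * √l := by rw [pow_succ, h1]
  rw [h3]
  constructor <;> nlinarith

theorem sqrt_variance_le {n : ℝ} (hn : 0 ≤ n) {N : ℕ} (hN : 1 ≤ N) :
    √(6 * n * (N + 1)) ≤ 4 * √(n * N) := by
  have hN' : (1 : ℝ) ≤ N := by exact_mod_cast hN
  refine (Real.sqrt_le_left (by positivity)).2 ?_
  rw [mul_pow, Real.sq_sqrt (by positivity)]
  nlinarith [mul_le_mul_of_nonneg_left hN' hn]

/-- With `x = p / √k` and `p = 2 ^ (-N / 4)`, the bias contribution is `t s x ^ 2`, while the rate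
offers `t s x` up to logarithms. The condition `s p ^ 2 ≤ k` gives `x ≤ 1`, so the square may be
dropped. -/
theorem small_bias_rate {s t p k l v w rT E : ℝ} (hs : 1 ≤ s) (ht : 0 ≤ t) (hp : 0 ≤ p)
    (hk : 0 < k) (hl : 1 / 2 ≤ l) (hE : 0 ≤ E) (hr : 0 < rT) (hv : v ≤ 4 * w) (hw : 0 ≤ w)
    (hsp : s * p ^ 2 ≤ k) :
    E * (t * (s * p ^ 2) / k + t * v / (k * rT)) ≤
      8 * E * (t * w * l / (rT * k) + s * t * p * √l ^ 3 / √k) := by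
  have h1 : 0 < √k := Real.sqrt_pos.2 hk
  have h2 : √k ^ 2 = k := Real.sq_sqrt hk.le
  have h3 := (le_two_mul_sqrt_pow hl).2
  set x := p / √k with hx
  have hx0 : 0 ≤ x := by positivity
  have hx1 : x ≤ 1 := by
    rw [hx, div_le_one h1]
    refine Real.le_sqrt_of_sq_le (le_trans ?_ hsp)
    exact le_mul_of_one_le_left (sq_nonneg p) hs
  have h4 : t * (s * p ^ 2) / k = t * s * x ^ 2 := by rw [hx, div_pow, h2]; ring
  have h5 : s * t * p * √l ^ 3 / √k = t * s * x * √l ^ 3 := by rw [hx]; ring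
  have h6 : t * s * x ^ 2 ≤ 8 * (t * s * x * √l ^ 3) := by
    calc t * s * x ^ 2 ≤ t * s * x * 1 := by rw [pow_two, ← mul_assoc]; gcongr
      _ ≤ t * s * x * (4 * √l ^ 3) := by gcongr
      _ ≤ 8 * (t * s * x * √l ^ 3) := by
        have : 0 ≤ t * s * x * √l ^ 3 := by positivity
        linarith
  have h7 : t * v / (k * rT) ≤ 8 * (t * w * l / (rT * k)) := by
    have h8 : t * v ≤ 8 * (t * w * l) := by
      have h9 : t * w * (1 / 2) ≤ t * w * l := by gcongr
      linarith [mul_le_mul_of_nonneg_left hv ht]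
    calc t * v / (k * rT) ≤ 8 * (t * w * l) / (k * rT) := by gcongr
      _ = _ := by ring
  rw [h4, h5]
  have := mul_le_mul_of_nonneg_left (add_le_add h6 h7) hE
  linarith

/-- In the complementary case `4 B ^ 3 s x ^ 2 > 1`, and since `B` and `s` are at least `1`, also `4
B ^ 3 s x ≥ 1`. The term linear in `x` then dominates `t log T` outright. -/
theorem large_bias_rate {s t p k l B : ℝ} (hs : 1 ≤ s) (ht : 0 ≤ t) (hp : 0 ≤ p)
    (hk : 0 < k) (hl : 1 / 2 ≤ l) (hB : 1 ≤ B) (hsp : k < 4 * B ^ 3 * (s * p ^ 2)) :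
    t * l ≤ 8 * B ^ 3 * (s * t * p * √l ^ 3 / √k) := by
  have h1 : 0 < √k := Real.sqrt_pos.2 hk
  have h2 : √k ^ 2 = k := Real.sq_sqrt hk.le
  have h3 := (le_two_mul_sqrt_pow hl).1
  set x := p / √k with hx
  have hx0 : 0 ≤ x := by positivity
  have hB3 : 1 ≤ B ^ 3 := one_le_pow₀ hB
  have h4 : 1 < 4 * B ^ 3 * s * x ^ 2 := by
    rw [hx, div_pow, h2, ← mul_div_assoc, one_lt_div hk]; linarith
  have h6 : 1 ≤ 4 * B ^ 3 * s * x := by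
    rcases le_total x 1 with h | h
    · refine h4.le.trans ?_
      gcongr
      exact pow_le_of_le_one hx0 h two_ne_zero
    · have : 1 * 1 * 1 ≤ B ^ 3 * s * x := by gcongr
      linarith
  have h5 : s * t * p * √l ^ 3 / √k = t * s * x * √l ^ 3 := by rw [hx]; ring
  rw [h5]
  calc t * l ≤ t * (2 * √l ^ 3) * 1 := by rw [mul_one]; gcongr
    _ ≤ t * (2 * √l ^ 3) * (4 * B ^ 3 * s * x) := by gcongr
    _ = _ := by ring

theorem one_le_cardBound (B : ℝ) : 1 ≤ cardBound B := one_le_pow₀ (by norm_num)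

theorem le_errorConst {B : ℝ} (hB : 1 ≤ B) : 46 * B ^ 4 ≤ errorConst B := by
  have hB0 : 0 < B := by linarith
  rw [errorConst, add_assoc]; exact le_add_of_nonneg_right (by positivity)

/-- The constant of the main theorem. -/
def mainConst (B : ℝ) : ℝ :=
  1000 * errorConst B +
    400 * errorConst B ^ 2 * cardBound B * (4 * Real.log (2 * errorConst B) + 7) ^ 2

theorem mainConst_ge (B : ℝ) : 1000 * errorConst B ≤ mainConst B :=
  le_add_of_nonneg_right (by have := one_le_cardBound B; positivity)

/-- One factor `N_max + 1` comes from the variance and one factor `N_max + 2` from the cost of a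
round, each of order `1 + l`; the number of states in the variance is absorbed by `cardBound`. -/
theorem mlmc_count_le {B n m P l : ℝ} (hB : 1 ≤ B) (hn : n ≤ cardBound B) (hm : 0 ≤ m)
    (hl : 0 ≤ l) (hP : 0 ≤ P) (h : m + 2 ≤ (4 * Real.log (2 * errorConst B) + 7) * (1 + l)) :
    96 * errorConst B ^ 2 * n * (m + 1) * (m + 2) * P ≤ mainConst B * P * (1 + l) ^ 4 := by
  have hB4 : 1 ≤ B ^ 4 := one_le_pow₀ hB
  have hE1 : 1 ≤ errorConst B := by linarith [le_errorConst hB]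
  have hM : 400 * errorConst B ^ 2 * cardBound B * (4 * Real.log (2 * errorConst B) + 7) ^ 2 ≤
      mainConst B := le_add_of_nonneg_left (by linarith)
  have hM0 : 0 ≤ mainConst B := by linarith [mainConst_ge B]
  have hc := one_le_cardBound B
  generalize 4 * Real.log (2 * errorConst B) + 7 = L at h hM
  have hL : 0 ≤ L * (1 + l) := by linarith
  have h4 : (1 + l) ^ 2 ≤ (1 + l) ^ 4 := pow_le_pow_right₀ (by linarith) (by norm_num)
  calc 96 * errorConst B ^ 2 * n * (m + 1) * (m + 2) * P =
        96 * errorConst B ^ 2 * P * (n * ((m + 1) * (m + 2))) := by ring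
    _ ≤ 96 * errorConst B ^ 2 * P * (cardBound B * ((L * (1 + l)) * (L * (1 + l)))) := by
        gcongr
        linarith
    _ ≤ 400 * errorConst B ^ 2 * P * (cardBound B * ((L * (1 + l)) * (L * (1 + l)))) := by
        gcongr
        norm_num
    _ = 400 * errorConst B ^ 2 * cardBound B * L ^ 2 * P * (1 + l) ^ 2 := by ring
    _ ≤ mainConst B * P * (1 + l) ^ 4 := by gcongr

theorem natCeil_le_two_mul {x : ℝ} (hx : 1 ≤ x) : (⌈x⌉₊ : ℝ) ≤ 2 * x := by
  have := Nat.ceil_lt_add_one (by linarith : 0 ≤ x)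
  linarith

end Rates

/-! ### Rates and sample complexity for each kind of uncertainty set -/

section Cases

variable {S : Type u} {A : Type v} [Fintype S] [Fintype A] [Nonempty S] [DecidableEq S]
  {M : RobustMDP S A} {π : S → PMF A} {N : Seminorm ℝ (S → ℝ)} {γ g B : ℝ}

theorem contamination_rate {δ : ℝ} (hmod : M.model = .contamination δ) (hB : 1 ≤ B)
    (he : NominalErgodic M π) (hr : RadiusCondition M π) (hN : IsContractionSeminorm M π N γ)
    (hC : ConstantsAtMost N γ B) (hR : ∀ s a, |M.reward s a| ≤ B)
    (hg : IsRobustAverageReward M π g) (Nmax : ℕ) (s₀ : S) {V₀ : S → ℝ}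
    (hV₀ : spanSeminorm V₀ ≤ B * tMix M π) :
    ∃ a K : ℝ, 0 < a ∧ a ≤ errorConst B / (1 - γ) ∧ 1 ≤ K ∧ ∀ T : ℕ, 1 ≤ T →
      expectedError M π s₀ (fun t => a / ((t : ℝ) + K)) (fun t => 1 / ((t : ℝ) + 1)) Nmax V₀ T g ≤
        ENNReal.ofReal (errorConst B * (tMix M π / ((1 - γ) * √T))) := by
  have hδ : 0 ≤ δ ∧ δ < 1 := by rw [RadiusCondition, hmod] at hr; exact hr
  have h1 := expectedError_le_of_small_bias hB he hr hN hC hR hg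
    (hasSampler_contamination hmod hδ.1 hδ.2 Nmax) le_rfl le_rfl
    (by rw [mul_zero]; linarith [hN.2.1]) s₀ hV₀
  simpa using h1

theorem contamination_samples {δ : ℝ} (hmod : M.model = .contamination δ) (hB : 1 ≤ B)
    (he : NominalErgodic M π) (hr : RadiusCondition M π) (hN : IsContractionSeminorm M π N γ)
    (hC : ConstantsAtMost N γ B) (hR : ∀ s a, |M.reward s a| ≤ B)
    (hg : IsRobustAverageReward M π g) (s₀ : S) {V₀ : S → ℝ}
    (hV₀ : spanSeminorm V₀ ≤ B * tMix M π) {ε : ℝ} (hε : 0 < ε) (hε1 : ε ≤ 1) :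
    ∃ (a K : ℝ) (Nmax T : ℕ), 0 < a ∧ a ≤ errorConst B / (1 - γ) ∧ 1 ≤ K ∧
      expectedError M π s₀ (fun t => a / ((t : ℝ) + K)) (fun t => 1 / ((t : ℝ) + 1)) Nmax V₀ T g ≤
        ENNReal.ofReal ε ∧
      expectedSamples M π s₀ (fun t => a / ((t : ℝ) + K)) (fun t => 1 / ((t : ℝ) + 1)) Nmax V₀ T ≤
        ENNReal.ofReal (mainConst B * (Fintype.card S * Fintype.card A * (tMix M π : ℝ) ^ 2 /
          (ε ^ 2 * (1 - γ) ^ 2)) * (1 + Real.log (tMix M π / (ε * (1 - γ))))) := by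
  obtain ⟨a, K, ha, ha', hK, h⟩ := contamination_rate hmod hB he hr hN hC hR hg 0 s₀ hV₀
  have ht : (1 : ℝ) ≤ tMix M π := by exact_mod_cast one_le_tMix he hr
  have hk : 0 < 1 - γ := by linarith [hN.2.1]
  have hk1 : 1 - γ ≤ 1 := by linarith [hN.1]
  have hB4 : 1 ≤ B ^ 4 := one_le_pow₀ hB
  have hE1 : 1 ≤ errorConst B := by linarith [le_errorConst hB]
  have hM0 : 0 ≤ mainConst B := by linarith [mainConst_ge B]
  set t : ℝ := (tMix M π : ℝ)
  set k := 1 - γ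
  set E := errorConst B with hE
  set X := t / (ε * k) with hX
  have hX1 : 1 ≤ X := by
    rw [hX, one_le_div (by positivity)]
    exact (mul_le_one₀ hε1 hk.le hk1).trans ht
  have hEX : 1 ≤ (E * X) ^ 2 := one_le_pow₀ (one_le_mul_of_one_le_of_one_le hE1 hX1)
  -- The least number of rounds for which the bound `E X ε / √T` drops to `ε`.
  set T := ⌈(E * X) ^ 2⌉₊ with hT
  have hT1 : 1 ≤ T := Nat.one_le_ceil_iff.2 (by linarith)
  have hT0 : (0 : ℝ) < T := by exact_mod_cast hT1
  have hTr : E * X ≤ √T := Real.le_sqrt_of_sq_le (Nat.le_ceil _)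
  refine ⟨a, K, 0, T, ha, ha', hK, (h T hT1).trans (ENNReal.ofReal_le_ofReal ?_), ?_⟩
  · have h1 : E * (t / (k * √T)) = (E * X) * ε / √T := by rw [hX]; field_simp
    rw [h1, div_le_iff₀ (Real.sqrt_pos.2 hT0)]
    nlinarith
  · refine (expectedSamples_le (fun V => expect_roundCount_contamination hmod 0 V) T).trans
      (ENNReal.ofReal_le_ofReal ?_)
    have h1 := natCeil_le_two_mul hEX
    rw [← hT] at h1
    have h2 : 4 * E ^ 2 ≤ mainConst B := by
      have h3 := one_le_cardBound B
      have h4 : 0 ≤ Real.log (2 * E) := Real.log_nonneg (by linarith)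
      have h5 : 1 ≤ (4 * Real.log (2 * E) + 7) ^ 2 := one_le_pow₀ (by linarith)
      have h6 : 400 * E ^ 2 * 1 * 1 ≤ 400 * E ^ 2 * cardBound B * (4 * Real.log (2 * E) + 7) ^ 2 := by
        gcongr
      rw [mainConst, ← hE]
      nlinarith [sq_nonneg E]
    calc 2 * (T : ℝ) * (Fintype.card S * Fintype.card A * 1) ≤
          2 * (2 * (E * X) ^ 2) * (Fintype.card S * Fintype.card A * 1) := by gcongr
      _ = 4 * E ^ 2 * (Fintype.card S * Fintype.card A * t ^ 2 / (ε ^ 2 * k ^ 2)) * 1 := by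
        rw [hX]; field_simp; ring
      _ ≤ mainConst B * (Fintype.card S * Fintype.card A * t ^ 2 / (ε ^ 2 * k ^ 2)) *
          (1 + Real.log X) := by
        gcongr
        linarith [Real.log_nonneg hX1]

variable {w : S → S → ℝ} {κ : ℝ}

/-- The two regimes are separated by comparing the bias with `(1 - γ) / (4 B ^ 3)`. The choice
depends on `N_max` and not on `T`, so `a` and `K` are fixed before `T`. -/
theorem mlmc_rate (hball : IsTransportBall M.model w κ)
    (hest : ∀ Nmax V p, supportEstimator M.model Nmax V p = mlmcEstimator M.model Nmax V p)
    (hB : 1 ≤ B) (he : NominalErgodic M π) (hr : RadiusCondition M π)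
    (hN : IsContractionSeminorm M π N γ) (hC : ConstantsAtMost N γ B)
    (hR : ∀ s a, |M.reward s a| ≤ B) (hg : IsRobustAverageReward M π g) (Nmax : ℕ) (s₀ : S)
    {V₀ : S → ℝ} (hV₀ : spanSeminorm V₀ ≤ B * tMix M π) :
    ∃ a K : ℝ, 0 < a ∧ a ≤ mainConst B / (1 - γ) ∧ 1 ≤ K ∧ ∀ T : ℕ, 2 ≤ T →
      expectedError M π s₀ (fun t => a / ((t : ℝ) + K)) (fun t => 1 / ((t : ℝ) + 1)) Nmax V₀ T g ≤
        ENNReal.ofReal (mainConst B * (1 / T + Real.log T / T +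
          tMix M π * √(Fintype.card S * Nmax) * Real.log T / (√T * (1 - γ)) +
          √(Fintype.card S) * tMix M π * (2 : ℝ) ^ (-(Nmax : ℝ) / 4) * Real.log T ^ ((3 : ℝ) / 2) /
            √(1 - γ) +
          √(Fintype.card S) * (2 : ℝ) ^ (-(Nmax : ℝ) / 2) * tMix M π * Real.log T)) := by
  have hS := hasSampler_mlmc hball (admissible_of_radiusCondition hr) hest Nmax
  have ht : (1 : ℝ) ≤ tMix M π := by exact_mod_cast one_le_tMix he hr
  have hn : (1 : ℝ) ≤ Fintype.card S := by exact_mod_cast Fintype.card_pos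
  have hk : 0 < 1 - γ := by linarith [hN.2.1]
  have hk1 : 1 - γ < 1 := by linarith [hN.1]
  have hB4 : 1 ≤ B ^ 4 := one_le_pow₀ hB
  have hB3 : 1 ≤ B ^ 3 := one_le_pow₀ hB
  have hBB : B ≤ B ^ 4 := le_self_pow₀ hB (by norm_num)
  have hE1 := le_errorConst hB
  have hmain := mainConst_ge B
  rw [sqrt_half_pow] at hS
  rw [two_rpow_half]
  have hp1 : Nmax = 0 → (2 : ℝ) ^ (-(Nmax : ℝ) / 4) = 1 := by rintro rfl; simp
  have hp0 : 0 < (2 : ℝ) ^ (-(Nmax : ℝ) / 4) := by positivity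
  have hs : 1 ≤ √(Fintype.card S : ℝ) := by rw [← Real.sqrt_one]; exact Real.sqrt_le_sqrt hn
  generalize (2 : ℝ) ^ (-(Nmax : ℝ) / 4) = p at hS hp1 hp0 ⊢
  have hσ : (1 : ℝ) ≤ 6 * Fintype.card S * (Nmax + 1) := by
    have : (0 : ℝ) ≤ Nmax := Nat.cast_nonneg _
    nlinarith
  rcases le_or_gt (4 * B ^ 3 * (√(Fintype.card S) * p ^ 2)) (1 - γ) with hsmall | hlarge
  · obtain ⟨a, K, ha, ha', hK, h⟩ := expectedError_le_of_small_bias hB he hr hN hC hR hg hS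
      (by positivity) hσ hsmall s₀ hV₀
    refine ⟨a, K, ha, ha'.trans (by gcongr; linarith), hK, fun T hT =>
      (h T (by linarith)).trans (ENNReal.ofReal_le_ofReal ?_)⟩
    have hT0 : (0 : ℝ) < T := by exact_mod_cast (by linarith : 0 < T)
    have hl := half_le_log hT
    rw [rpow_three_half (by linarith)]
    have hsp : √(Fintype.card S) * p ^ 2 ≤ 1 - γ := by
      have : 0 ≤ √(Fintype.card S : ℝ) * p ^ 2 := by positivity
      nlinarith
    -- At `N_max = 0` the bias bound is at least `1`, which is not small; hence `N_max + 1` in the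
    -- variance may be replaced by a multiple of `N_max`.
    have hN1 : 1 ≤ Nmax := by
      by_contra h0
      have h1 := hp1 (by omega)
      rw [h1, one_pow, mul_one] at hsp
      linarith
    refine (small_bias_rate hs (by linarith) hp0.le hk hl (by linarith) (Real.sqrt_pos.2 hT0)
      (sqrt_variance_le (by linarith) hN1) (Real.sqrt_nonneg _) hsp).trans ?_
    have hl0 : 0 ≤ Real.log T := by linarith
    refine mul_le_mul (by linarith) ?_ (by positivity) (by linarith)
    have h1 : 0 ≤ 1 / (T : ℝ) := by positivity
    have h2 : 0 ≤ Real.log T / (T : ℝ) := by positivity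
    have h3 : 0 ≤ √(Fintype.card S : ℝ) * p ^ 2 * (tMix M π : ℝ) * Real.log T := by positivity
    linarith
  · obtain ⟨a, K, ha, ha', hK, h⟩ := expectedError_le_of_any_bias hB he hr hN hC hR hg hS
      (by positivity) (by linarith) s₀ hV₀
    refine ⟨a, K, ha, ha'.trans (by gcongr; linarith), hK, fun T hT =>
      (h T hT).trans (ENNReal.ofReal_le_ofReal ?_)⟩
    have hT1 : (1 : ℝ) ≤ T := by exact_mod_cast (by linarith : 1 ≤ T)
    have hl := half_le_log hT
    have hl0 : 0 ≤ Real.log T := by linarith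
    have hrT : 1 ≤ √(T : ℝ) := by rw [← Real.sqrt_one]; exact Real.sqrt_le_sqrt hT1
    have h1 := large_bias_rate (t := tMix M π) hs (by linarith) hp0.le hk hl hB hlarge
    rw [rpow_three_half hl0, Real.sqrt_div (by linarith)]
    have h2 : √(6 * Fintype.card S * ((Nmax : ℝ) + 1)) / √T * (tMix M π * Real.log T) ≤
        4 * (tMix M π * √(Fintype.card S * Nmax) * Real.log T / (√T * (1 - γ))) +
          6 * (√(Fintype.card S) * tMix M π * p * √(Real.log T) ^ 3 / √(1 - γ)) := by
      -- For `N_max = 0` the variance term of the rate vanishes, so the variance is charged to the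
      -- term with `2 ^ (-N_max / 4)`, which has no decay then.
      rcases Nat.eq_zero_or_pos Nmax with h0 | h0
      · rw [hp1 h0, h0]
        have h3 : √(6 * (Fintype.card S : ℝ) * ((0 : ℕ) + 1)) ≤ 3 * √(Fintype.card S) := by
          refine (Real.sqrt_le_left (by positivity)).2 ?_
          rw [mul_pow, Real.sq_sqrt (by positivity)]
          push_cast; linarith
        have h4 := (le_two_mul_sqrt_pow hl).1
        have h5 : √(1 - γ) ≤ 1 := Real.sqrt_le_one.2 hk1.le
        have h6 : 0 < √(1 - γ) := Real.sqrt_pos.2 hk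
        refine le_add_of_nonneg_of_le (by positivity) ?_
        calc √(6 * (Fintype.card S : ℝ) * ((0 : ℕ) + 1)) / √T * (tMix M π * Real.log T) ≤
              3 * √(Fintype.card S) / 1 * (tMix M π * (2 * √(Real.log T) ^ 3)) := by gcongr
          _ = 6 * (√(Fintype.card S) * tMix M π * 1 * √(Real.log T) ^ 3 / 1) := by ring
          _ ≤ _ := by gcongr
      · have h3 := sqrt_variance_le (n := Fintype.card S) (by linarith) h0
        refine le_add_of_le_of_nonneg ?_ (by positivity)
        calc √(6 * Fintype.card S * ((Nmax : ℝ) + 1)) / √T * (tMix M π * Real.log T) ≤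
              4 * √(Fintype.card S * Nmax) / √T * (tMix M π * Real.log T) := by gcongr
          _ = 4 * (tMix M π * √(Fintype.card S * Nmax) * Real.log T / (√T * 1)) := by ring
          _ ≤ _ := by gcongr
    generalize √(6 * Fintype.card S * ((Nmax : ℝ) + 1)) / √T = v at h2 ⊢
    have h3 : 0 ≤ tMix M π * √(Fintype.card S * Nmax) * Real.log T / (√T * (1 - γ)) := by positivity
    have h4 : 0 ≤ √(Fintype.card S) * tMix M π * p * √(Real.log T) ^ 3 / √(1 - γ) := by positivity
    have h5 : 0 ≤ √(Fintype.card S) * p ^ 2 * tMix M π * Real.log T := by positivity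
    have h6 : 0 ≤ 1 / (T : ℝ) + Real.log T / T := by positivity
    generalize tMix M π * √(Fintype.card S * Nmax) * Real.log T / (√T * (1 - γ)) = x₃ at h2 h3 ⊢
    generalize √(Fintype.card S) * tMix M π * p * √(Real.log T) ^ 3 / √(1 - γ) = x₄ at h1 h2 h4 ⊢
    have e5 : √(Fintype.card S) * p ^ 2 * (tMix M π * Real.log T) =
        √(Fintype.card S) * p ^ 2 * tMix M π * Real.log T := by ring
    generalize √(Fintype.card S) * p ^ 2 * tMix M π * Real.log T = x₅ at h5 e5 ⊢
    generalize 1 / (T : ℝ) + Real.log T / T = x₁ at h6 ⊢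
    calc 40 * B * (tMix M π * Real.log T) * (1 + √(Fintype.card S) * p ^ 2 + v) =
          40 * B * (tMix M π * Real.log T + √(Fintype.card S) * p ^ 2 * (tMix M π * Real.log T) +
            v * (tMix M π * Real.log T)) := by ring
      _ ≤ 40 * B * (8 * B ^ 3 * x₄ + x₅ + (4 * x₃ + 6 * x₄)) := by rw [e5]; gcongr
      _ = 320 * B ^ 4 * x₄ + 40 * B * x₅ + 160 * B * x₃ + 240 * B * x₄ := by ring
      _ ≤ 320 * B ^ 4 * x₄ + 40 * B ^ 4 * x₅ + 160 * B ^ 4 * x₃ + 240 * B ^ 4 * x₄ := by gcongr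
      _ ≤ 1000 * B ^ 4 * (x₁ + x₃ + x₄ + x₅) := by
        have := mul_nonneg (by positivity : 0 ≤ B ^ 4) h3
        have := mul_nonneg (by positivity : 0 ≤ B ^ 4) h4
        have := mul_nonneg (by positivity : 0 ≤ B ^ 4) h5
        have := mul_nonneg (by positivity : 0 ≤ B ^ 4) h6
        linarith
      _ ≤ mainConst B * (x₁ + x₃ + x₄ + x₅) := by gcongr; linarith

/-- The error `ε` is split in halves: `N_max` is chosen to make the bias contribution at most `ε /
2`, then `T` to do the same for the variance. -/
theorem mlmc_samples (hball : IsTransportBall M.model w κ)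
    (hest : ∀ Nmax V p, supportEstimator M.model Nmax V p = mlmcEstimator M.model Nmax V p)
    (hB : 1 ≤ B) (he : NominalErgodic M π) (hr : RadiusCondition M π)
    (hN : IsContractionSeminorm M π N γ) (hC : ConstantsAtMost N γ B)
    (hR : ∀ s a, |M.reward s a| ≤ B) (hg : IsRobustAverageReward M π g) (s₀ : S)
    {V₀ : S → ℝ} (hV₀ : spanSeminorm V₀ ≤ B * tMix M π) {ε : ℝ} (hε : 0 < ε) (hε1 : ε ≤ 1) :
    ∃ (a K : ℝ) (Nmax T : ℕ), 0 < a ∧ a ≤ errorConst B / (1 - γ) ∧ 1 ≤ K ∧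
      expectedError M π s₀ (fun t => a / ((t : ℝ) + K)) (fun t => 1 / ((t : ℝ) + 1)) Nmax V₀ T g ≤
        ENNReal.ofReal ε ∧
      expectedSamples M π s₀ (fun t => a / ((t : ℝ) + K)) (fun t => 1 / ((t : ℝ) + 1)) Nmax V₀ T ≤
        ENNReal.ofReal (mainConst B * (Fintype.card S * Fintype.card A * (tMix M π : ℝ) ^ 2 /
          (ε ^ 2 * (1 - γ) ^ 2)) *
            (1 + Real.log (√(Fintype.card S) * tMix M π / (ε * (1 - γ)))) ^ 4) := by
  have hcard := card_le_cardBound hB he hr hN hC hR hg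
  have ht : (1 : ℝ) ≤ tMix M π := by exact_mod_cast one_le_tMix he hr
  have hn : (1 : ℝ) ≤ Fintype.card S := by exact_mod_cast Fintype.card_pos
  have hs : 1 ≤ √(Fintype.card S : ℝ) := by rw [← Real.sqrt_one]; exact Real.sqrt_le_sqrt hn
  have hk : 0 < 1 - γ := by linarith [hN.2.1]
  have hk1 : 1 - γ ≤ 1 := by linarith [hN.1]
  have hB4 : 1 ≤ B ^ 4 := one_le_pow₀ hB
  have hB34 : B ^ 3 ≤ B ^ 4 := pow_le_pow_right₀ hB (by norm_num)
  have hE4 := le_errorConst hB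
  have hE1 : 1 ≤ errorConst B := by linarith
  have hM0 : 0 ≤ mainConst B := by linarith [mainConst_ge B]
  set t : ℝ := (tMix M π : ℝ) with htdef
  set k := 1 - γ with hkdef
  set E := errorConst B with hE
  set X := √(Fintype.card S) * t / (ε * k) with hX
  have hX1 : 1 ≤ X := by
    rw [hX, one_le_div (by positivity)]
    exact (mul_le_one₀ hε1 hk.le hk1).trans (one_le_mul_of_one_le_of_one_le hs ht)
  set Z := 2 * E * X with hZ
  have hZ1 : 1 ≤ Z := one_le_mul_of_one_le_of_one_le (by linarith) hX1
  have hZ0 : 0 < Z := by linarith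
  have hlZ : 0 ≤ Real.log Z := Real.log_nonneg hZ1
  -- Any multiple of `log Z` at least `2 / log 2` gives `2 ^ N_max ≥ Z ^ 2`, so the bias factor `2 ^
  -- (-N_max / 2)` is at most `1 / Z`.
  set Nmax := ⌈4 * Real.log Z⌉₊ with hNmax
  have hN1 : 4 * Real.log Z ≤ Nmax := Nat.le_ceil _
  have hN2 : (Nmax : ℝ) < 4 * Real.log Z + 1 := Nat.ceil_lt_add_one (by positivity)
  have hN0 : (0 : ℝ) ≤ Nmax := Nat.cast_nonneg _
  have hZN : √((1 / 2 : ℝ) ^ Nmax) * Z ≤ 1 := by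
    have h1 : Z ^ 2 ≤ 2 ^ Nmax := by
      rw [← Real.log_le_log_iff (by positivity) (by positivity), Real.log_pow, Real.log_pow]
      push_cast
      nlinarith [Real.log_two_gt_d9]
    have h2 : √((1 / 2 : ℝ) ^ Nmax) * Z = √((1 / 2 : ℝ) ^ Nmax * Z ^ 2) := by
      rw [Real.sqrt_mul (by positivity), Real.sqrt_sq hZ0.le]
    rw [h2, Real.sqrt_le_one, one_div, inv_pow, inv_mul_le_iff₀ (by positivity), mul_one]
    exact h1
  set b := √(Fintype.card S) * √((1 / 2 : ℝ) ^ Nmax) with hb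
  have hb0 : 0 ≤ b := by positivity
  have hbt : E * (t * b / k) ≤ ε / 2 := by
    have h1 : E * (t * b / k) = ε / 2 * (√((1 / 2 : ℝ) ^ Nmax) * Z) := by
      rw [hZ, hX, hb]; field_simp
    rw [h1]
    exact mul_le_of_le_one_right (by positivity) hZN
  -- The accuracy already forces the small-bias regime, because `errorConst B` exceeds `4 B ^ 3` and
  -- `ε ≤ 1`.
  have hsmall : 4 * B ^ 3 * b ≤ k := by
    have h1 : b / k ≤ t * b / k := by gcongr; exact le_mul_of_one_le_left hb0 ht
    have h2 : 4 * B ^ 3 * (b / k) ≤ E * (t * b / k) := by gcongr; linarith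
    have h3 : 4 * B ^ 3 * b / k ≤ 1 := by rw [mul_div_assoc]; linarith
    rwa [div_le_one hk] at h3
  set σ2 : ℝ := 6 * Fintype.card S * (Nmax + 1) with hσ
  have hσ1 : 1 ≤ σ2 := by rw [hσ]; nlinarith
  have hS := hasSampler_mlmc hball (admissible_of_radiusCondition hr) hest Nmax
  obtain ⟨a, K, ha, ha', hK, h⟩ := expectedError_le_of_small_bias hB he hr hN hC hR hg hS
      hb0 hσ1 hsmall s₀ hV₀
  set Y := (2 * E * (t / (ε * k))) ^ 2 * σ2 with hY
  have hX' : 1 ≤ t / (ε * k) := by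
    rw [one_le_div (by positivity)]
    exact (mul_le_one₀ hε1 hk.le hk1).trans ht
  have hY1 : 1 ≤ Y := one_le_mul_of_one_le_of_one_le
    (one_le_pow₀ (one_le_mul_of_one_le_of_one_le (by linarith) hX')) hσ1
  set T := ⌈Y⌉₊ with hT
  have hT1 : 1 ≤ T := Nat.one_le_ceil_iff.2 (by linarith)
  have hT0 : (0 : ℝ) < T := by exact_mod_cast hT1
  have hrT : 0 < √(T : ℝ) := Real.sqrt_pos.2 hT0
  have hTr : 2 * E * (t / (ε * k)) * √σ2 ≤ √T := by
    have h1 := Real.sqrt_le_sqrt (Nat.le_ceil Y)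
    rwa [hY, Real.sqrt_mul (by positivity), Real.sqrt_sq (by positivity)] at h1
  refine ⟨a, K, Nmax, T, ha, ha', hK, (h T hT1).trans (ENNReal.ofReal_le_ofReal ?_), ?_⟩
  · have h1 : E * (t * √σ2 / (k * √T)) = ε / 2 * (2 * E * (t / (ε * k)) * √σ2 / √T) := by
      field_simp
    have h2 : ε / 2 * (2 * E * (t / (ε * k)) * √σ2 / √T) ≤ ε / 2 :=
      mul_le_of_le_one_right (by positivity) ((div_le_one hrT).2 hTr)
    have h3 := hbt
    rw [mul_add, ← htdef, ← hkdef]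
    linarith
  · refine (expectedSamples_le (fun V => expect_roundCount_mlmc hest Nmax V) T).trans
      (ENNReal.ofReal_le_ofReal ?_)
    have h1 := natCeil_le_two_mul hY1
    rw [← hT] at h1
    have hlX : 0 ≤ Real.log X := Real.log_nonneg hX1
    have hlE : 0 ≤ Real.log (2 * E) := Real.log_nonneg (by linarith)
    have h2 : (Nmax : ℝ) + 2 ≤ (4 * Real.log (2 * E) + 7) * (1 + Real.log X) := by
      have h3 : Real.log Z = Real.log (2 * E) + Real.log X := Real.log_mul (by positivity) (by positivity)
      nlinarith [mul_nonneg hlE hlX]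
    calc 2 * (T : ℝ) * (Fintype.card S * Fintype.card A * (Nmax + 2)) ≤
          2 * (2 * Y) * (Fintype.card S * Fintype.card A * (Nmax + 2)) := by gcongr
      _ = 96 * E ^ 2 * Fintype.card S * (Nmax + 1) * (Nmax + 2) *
          (Fintype.card S * Fintype.card A * t ^ 2 / (ε ^ 2 * k ^ 2)) := by
        rw [hY, hσ]; field_simp; ring
      _ ≤ _ := mlmc_count_le hB hcard hN0 hlX (by positivity) h2

end Cases

end RobustAvg

end

/-! ### Assembly over the three uncertainty models -/

theorem theorem8 :
    -- the objects of the result exist for every robust MDP under the assumptions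
    (∀ (S : Type u) (A : Type v) [Fintype S] [DecidableEq S] [Nonempty S] [Fintype A]
        (M : RobustAvg.RobustMDP S A) (π : S → PMF A),
        RobustAvg.NominalErgodic M π → RobustAvg.RadiusCondition M π →
        (∃ g : ℝ, RobustAvg.IsRobustAverageReward M π g) ∧
        (∃ (N : Seminorm ℝ (S → ℝ)) (γ : ℝ), RobustAvg.IsContractionSeminorm M π N γ) ∧
        (∀ (N : Seminorm ℝ (S → ℝ)) (γ : ℝ), RobustAvg.IsContractionSeminorm M π N γ →
          ∃ B : ℝ, RobustAvg.ConstantsAtMost N γ B)) ∧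
    -- error rate and sample complexity, with a constant that depends only on the bound `B`
    (∀ B : ℝ, ∃ C : ℝ, ∀ (S : Type u) (A : Type v) [Fintype S] [DecidableEq S] [Fintype A]
        (M : RobustAvg.RobustMDP S A) (π : S → PMF A) (s₀ : S) (V₀ : S → ℝ)
        (N : Seminorm ℝ (S → ℝ)) (γ g : ℝ),
        RobustAvg.NominalErgodic M π → RobustAvg.RadiusCondition M π →
        RobustAvg.IsContractionSeminorm M π N γ → RobustAvg.ConstantsAtMost N γ B →
        (∀ s a, |M.reward s a| ≤ B) →
        RobustAvg.spanSeminorm V₀ ≤ B * (RobustAvg.tMix M π : ℝ) →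
        RobustAvg.IsRobustAverageReward M π g →
        (∀ Nmax : ℕ, ∃ a K : ℝ, 0 < a ∧ a ≤ C / (1 - γ) ∧ 1 ≤ K ∧ ∀ T : ℕ, 2 ≤ T →
          RobustAvg.expectedError M π s₀ (fun t => a / ((t : ℝ) + K)) (fun t => 1 / ((t : ℝ) + 1))
              Nmax V₀ T g ≤
            ENNReal.ofReal (C * RobustAvg.errorRate M.model (Fintype.card S)
              (RobustAvg.tMix M π) γ Nmax T)) ∧
        (∀ ε : ℝ, 0 < ε → ε ≤ 1 → ∃ (a K : ℝ) (Nmax T : ℕ),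
          0 < a ∧ a ≤ C / (1 - γ) ∧ 1 ≤ K ∧
          RobustAvg.expectedError M π s₀ (fun t => a / ((t : ℝ) + K)) (fun t => 1 / ((t : ℝ) + 1))
              Nmax V₀ T g ≤ ENNReal.ofReal ε ∧
          RobustAvg.expectedSamples M π s₀ (fun t => a / ((t : ℝ) + K))
              (fun t => 1 / ((t : ℝ) + 1)) Nmax V₀ T ≤
            ENNReal.ofReal (C * (Fintype.card S * Fintype.card A * (RobustAvg.tMix M π : ℝ) ^ 2 /
              (ε ^ 2 * (1 - γ) ^ 2)) *
                RobustAvg.logFactor M.model (Fintype.card S) (RobustAvg.tMix M π) γ ε))) := by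
  refine ⟨fun S A _ _ _ _ M π he hr => ⟨?_, ?_, fun N γ hN => ?_⟩, fun B =>
    ⟨RobustAvg.mainConst (max B 1), fun S A _ _ _ M π s₀ V₀ N γ g he hr hN hC hR hV₀ hg => ?_⟩⟩
  · obtain ⟨N, γ, ⟨h0, h1, hN0, hT⟩, hsp⟩ := RobustAvg.exists_contractionSeminorm he hr
    have hU := RobustAvg.admissible_of_radiusCondition hr
    obtain ⟨V, g, h⟩ := RobustAvg.exists_bellman_solution M π hU N h0.le h1 hsp
      (fun c => (hN0 _).2 ⟨c, rfl⟩) fun V₁ V₂ => hT V₁ V₂ 0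
    exact ⟨g, RobustAvg.isRobustAverageReward_of_bellman hU h⟩
  · obtain ⟨N, γ, hN, -⟩ := RobustAvg.exists_contractionSeminorm he hr
    exact ⟨N, γ, hN⟩
  · exact RobustAvg.exists_constantsAtMost N hN.2.2.1 hN.1 hN.2.1
  · have : Nonempty S := ⟨s₀⟩
    have hk : 0 < 1 - γ := by linarith [hN.2.1]
    have ht : (1 : ℝ) ≤ RobustAvg.tMix M π := by exact_mod_cast RobustAvg.one_le_tMix he hr
    -- The law `π s₀` has nonempty support, so there is a reward to compare with and `B ≥ 0`; this
    -- is needed to pass to `max B 1`.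
    obtain ⟨a₀⟩ : Nonempty A := ⟨(π s₀).support_nonempty.some⟩
    have hB0 : 0 ≤ B := (abs_nonneg _).trans (hR s₀ a₀)
    have hBB : B ≤ max B 1 := le_max_left _ _
    have hB1 : 1 ≤ max B 1 := le_max_right _ _
    replace hC := hC.mono hN.2.1 hB0 hBB
    replace hR := fun s a => (hR s a).trans hBB
    replace hV₀ := hV₀.trans (mul_le_mul_of_nonneg_right hBB (by linarith))
    generalize max B 1 = B at hB1 hC hR hV₀ ⊢
    have hE := RobustAvg.le_errorConst hB1
    have hB4 : 1 ≤ B ^ 4 := one_le_pow₀ hB1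
    have hEM : RobustAvg.errorConst B ≤ RobustAvg.mainConst B := by
      linarith [RobustAvg.mainConst_ge B]
    have hr' := hr
    rw [RobustAvg.RadiusCondition] at hr'
    cases hM : M.model with
    | contamination δ =>
      refine ⟨fun Nmax => ?_, fun ε hε hε1 => ?_⟩
      · obtain ⟨a, K, ha, ha', hK, h⟩ :=
          RobustAvg.contamination_rate hM hB1 he hr hN hC hR hg Nmax s₀ hV₀
        refine ⟨a, K, ha, ha'.trans (by gcongr), hK, fun T hT =>
          (h T (by linarith)).trans (ENNReal.ofReal_le_ofReal ?_)⟩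
        simp only [RobustAvg.errorRate]
        have hl := RobustAvg.half_le_log hT
        have hl0 : 0 ≤ Real.log T := by linarith
        set x : ℝ := RobustAvg.tMix M π / ((1 - γ) * √T) with hx
        have hx0 : 0 ≤ x := by positivity
        have h1 : RobustAvg.tMix M π * Real.log T / (√T * (1 - γ)) = x * Real.log T := by
          rw [hx]; ring
        have h2 : 0 ≤ 1 / (T : ℝ) + Real.log T / T := by positivity
        -- The contamination bound has no logarithm; since `log T ≥ 1 / 2` for `T ≥ 2`, inserting
        -- one costs a factor `2`.
        have h3 : x * (1 / 2) ≤ x * Real.log T := by gcongr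
        rw [h1]
        calc RobustAvg.errorConst B * x ≤ RobustAvg.errorConst B * (2 * (1 / (T : ℝ) +
              Real.log T / T + x * Real.log T)) :=
            mul_le_mul_of_nonneg_left (by linarith) (by linarith)
          _ = 2 * RobustAvg.errorConst B * (1 / (T : ℝ) + Real.log T / T + x * Real.log T) := by ring
          _ ≤ _ := mul_le_mul_of_nonneg_right (by linarith [RobustAvg.mainConst_ge B])
            (by positivity)
      · obtain ⟨a, K, Nmax, T, ha, ha', hK, h, h'⟩ :=
          RobustAvg.contamination_samples hM hB1 he hr hN hC hR hg s₀ hV₀ hε hε1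
        exact ⟨a, K, Nmax, T, ha, ha'.trans (by gcongr), hK, h, h'⟩
    | tv δ =>
      rw [hM] at hr'
      have hball : RobustAvg.IsTransportBall M.model _ _ := hM ▸ RobustAvg.isTransportBall_tv hr'.1
      have hest : ∀ Nmax V p, RobustAvg.supportEstimator M.model Nmax V p =
          RobustAvg.mlmcEstimator M.model Nmax V p := fun _ _ _ => by rw [hM]; rfl
      refine ⟨fun Nmax => RobustAvg.mlmc_rate hball hest hB1 he hr hN hC hR hg Nmax s₀ hV₀,
        fun ε hε hε1 => ?_⟩
      obtain ⟨a, K, Nmax, T, ha, ha', hK, h, h'⟩ :=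
        RobustAvg.mlmc_samples hball hest hB1 he hr hN hC hR hg s₀ hV₀ hε hε1
      exact ⟨a, K, Nmax, T, ha, ha'.trans (by gcongr), hK, h, h'⟩
    | wasserstein d l δ =>
      rw [hM] at hr'
      have hball : RobustAvg.IsTransportBall M.model _ _ :=
        hM ▸ RobustAvg.isTransportBall_wasserstein d hr'.1 hr'.2.1
      have hest : ∀ Nmax V p, RobustAvg.supportEstimator M.model Nmax V p =
          RobustAvg.mlmcEstimator M.model Nmax V p := fun _ _ _ => by rw [hM]; rfl
      refine ⟨fun Nmax => RobustAvg.mlmc_rate hball hest hB1 he hr hN hC hR hg Nmax s₀ hV₀,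
        fun ε hε hε1 => ?_⟩
      obtain ⟨a, K, Nmax, T, ha, ha', hK, h, h'⟩ :=
        RobustAvg.mlmc_samples hball hest hB1 he hr hN hC hR hg s₀ hV₀ hε hε1
      exact ⟨a, K, Nmax, T, ha, ha'.trans (by gcongr), hK, h, h'⟩
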